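/- The model of computation is the word RAM with words of $O(\log n)$ bits: each memory cell and register holds one word, the usual arithmetic, bitwise, comparison, jump and indirect load and store instructions cost one step each, and a randomized algorithm may also draw a uniformly random word in one step. All input integers have absolute value at most $n^{u}$ for an arbitrary constant $u$; the algorithm and the implied constants (including those in the word length and in the exponent of the logarithm) may depend on $u$. In $\mathsf{MonoConvolution}$ one is given three integer sequences $a,b,c$, each of length $n$ and indexed by $0,\dots,n-1$, and has to compute the sequence $d_0,\dots,d_{n-1}$ with $d_i=1$ if there is a $j\in\{0,\dots,i\}$ such that $a_j=b_{i-j}=c_i$, and $d_i=0$ otherwise. In $3$SUM one is given three lists $A,B,C$ of $n$ integers each and has to decide whether there are $x\in A$, $y\in B$, $z\in C$ with $x+y=z$. Theorem. Let $\varepsilon$ be a real number. If $\mathsf{MonoConvolution}$ can be solved by a deterministic algorithm in $O(n^{3/2-\varepsilon})$ time, then $3$SUM can be solved by a randomized algorithm in $\tilde O(n^{2-\frac43\varepsilon})$ time, that is, there is a constant $p$ such that on every instance the algorithm always halts within $O(n^{2-\frac43\varepsilon}(\log n)^p)$ steps, and its answer is correct with probability at least $2/3$. -/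

import Mathlib

open Filter Asymptotics

/-! ### The word RAM

A word RAM with word length `w` has registers `R[0], R[1], ...` and a random-access memory `M` with
one cell for each `w`-bit address; every register and every memory cell holds one `w`-bit word.
A program is a finite list of instructions, and each executed instruction costs one step. -/

namespace WordRAM

/-- The binary word operations (unsigned, modulo `2 ^ w`, with a truth value stored as `0` or `1`). -/
inductive BinOp where
  | add | sub | mul | div | mod | and | or | xor | shl | shr | lt

/-- The word computed by a binary operation. -/
def BinOp.eval {w : ℕ} : BinOp → BitVec w → BitVec w → BitVec w
  | .add, x, y => x + y
  | .sub, x, y => x - y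
  | .mul, x, y => x * y
  | .div, x, y => x / y
  | .mod, x, y => x % y
  | .and, x, y => x &&& y
  | .or, x, y => x ||| y
  | .xor, x, y => x ^^^ y
  | .shl, x, y => x <<< y
  | .shr, x, y => x >>> y
  | .lt, x, y => if x < y then 1 else 0

/-- The instructions. -/
inductive Instr where
  /-- `R[r] := v` (modulo `2 ^ w`) -/
  | const (r v : ℕ)
  /-- `R[r] := R[s] o R[t]` -/
  | op (o : BinOp) (r s t : ℕ)
  /-- `R[r] := M[R[s]]` -/
  | load (r s : ℕ)
  /-- `M[R[r]] := R[s]` -/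
  | store (r s : ℕ)
  /-- `R[r] :=` a fresh uniformly random word -/
  | rand (r : ℕ)
  /-- go to instruction `l` -/
  | jump (l : ℕ)
  /-- go to instruction `l` if `R[r] = 0` -/
  | jumpIfZero (r l : ℕ)

/-- A program: a finite list of instructions, numbered from `0`. It does not depend on the input or
on the word length. -/
abbrev Program := List Instr

/-- A program is deterministic if it never asks for a random word. -/
def Program.Deterministic (P : Program) : Prop := ∀ r : ℕ, Instr.rand r ∉ P

/-- A configuration: program counter, registers, memory, and the number of random words that have
been drawn so far. -/
structure Config (w : ℕ) where
  pc : ℕ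
  reg : ℕ → BitVec w
  mem : BitVec w → BitVec w
  drawn : ℕ

/-- The machine has halted when the program counter points past the end of the program. -/
def Config.Halted {w : ℕ} (P : Program) (σ : Config w) : Prop := P.length ≤ σ.pc

/-- The effect of one instruction; `ω i` is the `i`-th random word. -/
def Instr.exec {w : ℕ} (ω : ℕ → BitVec w) (σ : Config w) : Instr → Config w
  | .const r v =>
      { σ with pc := σ.pc + 1, reg := Function.update σ.reg r (BitVec.ofNat w v) }
  | .op o r s t =>
      { σ with pc := σ.pc + 1, reg := Function.update σ.reg r (o.eval (σ.reg s) (σ.reg t)) }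
  | .load r s =>
      { σ with pc := σ.pc + 1, reg := Function.update σ.reg r (σ.mem (σ.reg s)) }
  | .store r s =>
      { σ with pc := σ.pc + 1, mem := Function.update σ.mem (σ.reg r) (σ.reg s) }
  | .rand r =>
      { σ with
        pc := σ.pc + 1, reg := Function.update σ.reg r (ω σ.drawn), drawn := σ.drawn + 1 }
  | .jump l => { σ with pc := l }
  | .jumpIfZero r l => { σ with pc := if σ.reg r = 0 then l else σ.pc + 1 }

/-- One step of the machine. A halted machine does not move. -/
def step {w : ℕ} (P : Program) (ω : ℕ → BitVec w) (σ : Config w) : Config w :=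
  match P[σ.pc]? with
  | some instr => instr.exec ω σ
  | none => σ

/-- The configuration after `t` steps. -/
def run {w : ℕ} (P : Program) (ω : ℕ → BitVec w) (t : ℕ) (σ : Config w) : Config w :=
  (step P ω)^[t] σ

/-- The word length `k * (⌊log₂ n⌋ + 1)`, which is `Θ(log n)`. -/
def wordLength (k n : ℕ) : ℕ := k * (Nat.log 2 n + 1)

/-- The initial configuration on an input that consists of three integer sequences of length `n`:
`R[0] = n`, the cells `M[0], ..., M[3n-1]` hold the entries of the three sequences, one after the
other, in two's complement, and all other registers and cells are `0`. -/
def init (w : ℕ) {n : ℕ} (a b c : Fin n → ℤ) : Config w where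
  pc := 0
  reg := fun r => if r = 0 then BitVec.ofNat w n else 0
  mem := fun x =>
    BitVec.ofInt w ((List.ofFn a ++ List.ofFn b ++ List.ofFn c).getD x.toNat 0)
  drawn := 0

/-- The stream of random words that starts with the finite string `ω` (of uniformly random words).
A run of at most `T` steps never looks beyond the first `T` words. -/
def tape {w T : ℕ} (ω : Fin T → BitVec w) : ℕ → BitVec w :=
  fun i => if h : i < T then ω ⟨i, h⟩ else 0

/-- The probability of the event `E` for a uniformly random string of `T` words. -/
noncomputable def prob {w T : ℕ} (E : (Fin T → BitVec w) → Prop) : ℝ :=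
  (Nat.card {ω : Fin T → BitVec w // E ω} : ℝ) / (Nat.card (Fin T → BitVec w) : ℝ)

end WordRAM

/-! ### The two problems -/

/-- All entries of the three sequences of length `n` have absolute value at most `n ^ u`. -/
def PolyBounded (u : ℕ) {n : ℕ} (a b c : Fin n → ℤ) : Prop :=
  ∀ i : Fin n, |a i| ≤ (n : ℤ) ^ u ∧ |b i| ≤ (n : ℤ) ^ u ∧ |c i| ≤ (n : ℤ) ^ u

/-- The output sequence `d` of MonoConvolution: `d i = 1` if there is a `j` with
`a j = b (i - j) = c i`, and `d i = 0` otherwise (here `l` is `i - j`). -/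
def monoConvolution {n : ℕ} (a b c : Fin n → ℤ) (i : Fin n) : ℕ :=
  if ∃ j l : Fin n, (j : ℕ) + (l : ℕ) = (i : ℕ) ∧ a j = b l ∧ b l = c i then 1 else 0

/-- The answer to a 3SUM instance: `1` if there are `x ∈ A`, `y ∈ B`, `z ∈ C` with `x + y = z`, and
`0` otherwise. -/
def threeSum {n : ℕ} (A B C : Fin n → ℤ) : ℕ :=
  if ∃ i j l : Fin n, A i + B j = C l then 1 else 0

/-- MonoConvolution is in `O(f(n))` time: for every exponent `u` there is a deterministic program
for the word RAM with `O(log n)`-bit words which, on all sequences of `n` integers of absolute value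
at most `n ^ u`, halts within `T n = O(f n)` steps with `d 0, ..., d (n-1)` in the first `n` cells of
the memory. (For `u + 3 ≤ k` the integers and the addresses of the input fit into words.) -/
def MonoConvolutionInTime (f : ℕ → ℝ) : Prop :=
  ∀ u : ℕ, ∃ k : ℕ, u + 3 ≤ k ∧ ∃ (P : WordRAM.Program) (T : ℕ → ℕ),
    P.Deterministic ∧
    (fun n => (T n : ℝ)) =O[atTop] f ∧
    ∀ (n : ℕ) (a b c : Fin n → ℤ), PolyBounded u a b c →
      let w := WordRAM.wordLength k n
      let σ := WordRAM.run P (fun _ => 0) (T n) (WordRAM.init w a b c)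
      σ.Halted P ∧
        ∀ i : Fin n, σ.mem (BitVec.ofNat w i) = BitVec.ofNat w (monoConvolution a b c i)

/-- 3SUM is in randomized `Õ(f(n))` time: for every exponent `u` there is a randomized program for
the word RAM with `O(log n)`-bit words which, on all lists of `n` integers of absolute value at most
`n ^ u`, always halts within `T n = O(f n * (log n) ^ p)` steps, for a constant `p`, and with
probability at least `2 / 3` does so with the correct answer in `R[0]`. -/
def ThreeSumInRandomizedSoftTime (f : ℕ → ℝ) : Prop :=
  ∀ u : ℕ, ∃ k : ℕ, u + 3 ≤ k ∧ ∃ (P : WordRAM.Program) (T : ℕ → ℕ) (p : ℕ),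
    (fun n => (T n : ℝ)) =O[atTop] (fun n => f n * Real.log (n : ℝ) ^ p) ∧
    ∀ (n : ℕ) (A B C : Fin n → ℤ), PolyBounded u A B C →
      let w := WordRAM.wordLength k n
      let final := fun ω : Fin (T n) → BitVec w =>
        WordRAM.run P (WordRAM.tape ω) (T n) (WordRAM.init w A B C)
      (∀ ω, (final ω).Halted P) ∧
        2 / 3 ≤ WordRAM.prob fun ω => (final ω).reg 0 = BitVec.ofNat w (threeSum A B C)

/-! Put S ≈ n^(1/3), Q ≈ n^(4/3), and hash the numbers by two random multiplicative functions, `q1`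
with range Q and `q2` with range S. They are almost linear: if x + y = z, the hash of z is the sum
of the hashes of x and y, up to a carry c ∈ {0, 1} and a wraparound r ∈ {0, 1} (`mulHash_add`). The
numbers are written, in many copies, into three tables of colours of length m = 4Q. The colour meant
for a solution is the pair (α, β) = (q2 x, q2 y). An entry x knows α and tries every β, at position
q1 x + 2β + 1. An entry y knows β and tries every α, at position q1 y + 6α. An entry z tries every α
and all carries, which determine β, at the position where the other two would then add up. With the
right guesses a solution becomes three equal colours at positions p₀, p₁ and p₀ + p₁, which is what
MonoConvolution detects. The instances have length m = Θ(n^(4/3)), and (n^(4/3))^(3/2 - ε) = n^(2 -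
4ε/3).

The convolution only says that some p₀ exists. If p₀ is unique, its bits are read off from one call
per bit t, in which only the first-table positions with t-th bit set are kept. The candidate
obtained for each position is verified by adding the stored numbers, so a positive answer is always
right (`Dim.Tables.sound`).

A fixed solution is found under the conditions `Dim.Clear` (`Dim.Clear.exists_acceptAt`). Its three
cells must not be overwritten: n other numbers per list each collide with probability O(S/Q). No
false triple may have its colour and position: about (n/S)² pairs share the colour, each hitting the
position with probability O(1/Q), and S ≈ n^(1/3) balances these terms. No other true pair for the
same z may share the colour: since there may be many such pairs, the first list is subsampled at
every rate 2^(-κ). At a suitable rate (`exists_sampling_rate`) some but only boundedly many survive,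
and `q2` separates them. `Dim.Small.pr_clear_ge` adds up the failure probabilities and `failure_le`
bounds them by 1/3.

On the machine, the convolution program expects shorter words and zeroed memory. It is simulated
under a word mask, inside a block of cells as large as its whole address space (`Runs.call`). Every
call gets a block never used before, so nothing has to be cleared; longer words of the outer machine
provide the addresses. The code is written in a small structured language whose specification `Runs`
includes a step bound.

The additive cost of order m is absorbed because the exponent 3/2 - ε is at least 1: writing the
output takes n steps (`le_time_of_monoConvolution`), so for ε > 1/2 the hypothesis is contradictory.
-/

namespace WordRAM

/-! ### Running code fragments -/

section Run

variable {w : ℕ} {P : Program} {ω : ℕ → BitVec w}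

theorem run_add (t₁ t₂ : ℕ) (σ : Config w) :
    run P ω (t₁ + t₂) σ = run P ω t₂ (run P ω t₁ σ) := by
  unfold run
  rw [Nat.add_comm, Function.iterate_add_apply]

theorem run_one {σ : Config w} {I : Instr} (h : P[σ.pc]? = some I) :
    run P ω 1 σ = I.exec ω σ := by
  simp [run, step, h]

theorem run_halted {σ : Config w} (h : σ.Halted P) (t : ℕ) : run P ω t σ = σ := by
  have h1 : step P ω σ = σ := by
    simp only [step, List.getElem?_eq_none h]
  exact Function.iterate_fixed h1 t

theorem run_of_halted_le {σ : Config w} {t T : ℕ} (h : (run P ω t σ).Halted P) (hT : t ≤ T) :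
    run P ω T σ = run P ω t σ := by
  obtain ⟨d, rfl⟩ := Nat.exists_eq_add_of_le hT
  rw [run_add, run_halted h]

end Run

/-- The program `P` contains the code `L` at position `o`. -/
def At (P : Program) (o : ℕ) (L : List Instr) : Prop :=
  ∀ i < L.length, P[o + i]? = L[i]?

theorem At.left {P : Program} {o : ℕ} {L₁ L₂ : List Instr} (h : At P o (L₁ ++ L₂)) :
    At P o L₁ := by
  intro i hi
  rw [h i (by simp; omega), List.getElem?_append_left hi]

theorem At.right {P : Program} {o : ℕ} {L₁ L₂ : List Instr} (h : At P o (L₁ ++ L₂)) :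
    At P (o + L₁.length) L₂ := by
  intro i hi
  rw [Nat.add_assoc, h (L₁.length + i) (by simp; omega),
    List.getElem?_append_right (Nat.le_add_right _ _)]
  simp

theorem At.head {P : Program} {o : ℕ} {I : Instr} {L : List Instr} (h : At P o (I :: L)) :
    P[o]? = some I := by
  simpa using h 0 (by simp)

theorem At.tail {P : Program} {o : ℕ} {I : Instr} {L : List Instr} (h : At P o (I :: L)) :
    At P (o + 1) L :=
  At.right (L₁ := [I]) h

/-- The part of a configuration that structured code works on: the variables (the registers below
`40`), the memory and the number of random words drawn, with words read as natural numbers. -/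
structure State where
  reg : ℕ → ℕ
  mem : ℕ → ℕ
  drawn : ℕ

namespace State

/-- Assign a value to a variable. -/
def set (s : State) (v x : ℕ) : State := { s with reg := Function.update s.reg v x }

/-- Store a value in the memory. -/
def put (s : State) (a x : ℕ) : State := { s with mem := Function.update s.mem a x }

/-- Count one more random word. -/
def draw (s : State) : State := { s with drawn := s.drawn + 1 }

@[simp] theorem set_reg_self (s : State) (v x : ℕ) : (s.set v x).reg v = x := by simp [set]

theorem set_reg (s : State) (v x r : ℕ) :
    (s.set v x).reg r = if r = v then x else s.reg r := by
  simp [set, Function.update_apply]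

@[simp] theorem set_reg_ne (s : State) {v r : ℕ} (x : ℕ) (h : r ≠ v) :
    (s.set v x).reg r = s.reg r := by simp [set, h]

@[simp] theorem set_mem (s : State) (v x : ℕ) : (s.set v x).mem = s.mem := rfl
@[simp] theorem set_drawn (s : State) (v x : ℕ) : (s.set v x).drawn = s.drawn := rfl
@[simp] theorem put_reg (s : State) (v x : ℕ) : (s.put v x).reg = s.reg := rfl
@[simp] theorem put_drawn (s : State) (v x : ℕ) : (s.put v x).drawn = s.drawn := rfl
@[simp] theorem draw_reg (s : State) : s.draw.reg = s.reg := rfl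
@[simp] theorem draw_mem (s : State) : s.draw.mem = s.mem := rfl
@[simp] theorem draw_drawn (s : State) : s.draw.drawn = s.drawn + 1 := rfl

theorem put_mem (s : State) (a x b : ℕ) :
    (s.put a x).mem b = if b = a then x else s.mem b := by
  simp [put, Function.update_apply]

@[simp] theorem put_mem_self (s : State) (a x : ℕ) : (s.put a x).mem a = x := by simp [put]

theorem put_mem_ne (s : State) {a b : ℕ} (x : ℕ) (h : b ≠ a) :
    (s.put a x).mem b = s.mem b := by simp [put, h]

end State

/-- The abstract state describes the configuration. -/
structure Rel {w : ℕ} (s : State) (σ : Config w) : Prop where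
  reg : ∀ r < 40, (σ.reg r).toNat = s.reg r
  mem : ∀ x, (σ.mem x).toNat = s.mem x.toNat
  drawn : σ.drawn = s.drawn

theorem Rel.reg_lt {w : ℕ} {s : State} {σ : Config w} (h : Rel s σ) {r : ℕ} (hr : r < 40) :
    s.reg r < 2 ^ w := by
  rw [← h.reg r hr]; exact (σ.reg r).isLt

theorem Rel.mem_lt {w : ℕ} {s : State} {σ : Config w} (h : Rel s σ) {a : ℕ} (ha : a < 2 ^ w) :
    s.mem a < 2 ^ w := by
  have := h.mem (BitVec.ofNat w a)
  rw [BitVec.toNat_ofNat, Nat.mod_eq_of_lt ha] at this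
  rw [← this]; exact (σ.mem _).isLt

/-! ### Expressions -/

/-- The word operations on natural numbers. -/
def BinOp.evalNat (w : ℕ) : BinOp → ℕ → ℕ → ℕ
  | .add, x, y => (x + y) % 2 ^ w
  | .sub, x, y => (2 ^ w - y + x) % 2 ^ w
  | .mul, x, y => (x * y) % 2 ^ w
  | .div, x, y => x / y
  | .mod, x, y => x % y
  | .and, x, y => x &&& y
  | .or, x, y => x ||| y
  | .xor, x, y => x ^^^ y
  | .shl, x, y => (x <<< y) % 2 ^ w
  | .shr, x, y => x >>> y
  | .lt, x, y => if x < y then 1 else 0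

theorem BinOp.toNat_eval {w : ℕ} [NeZero w] (o : BinOp) (x y : BitVec w) :
    (o.eval x y).toNat = o.evalNat w x.toNat y.toNat := by
  have hw : w ≠ 0 := NeZero.ne w
  cases o <;> simp [BinOp.eval, BinOp.evalNat, BitVec.toNat_sub]
  · split_ifs with h1 h2 h2
    · simp [Nat.pos_of_ne_zero hw]
    · exact absurd (BitVec.lt_def.1 h1) h2
    · exact absurd (BitVec.lt_def.2 h2) h1
    · simp

/-- Expressions over the variables and the memory. -/
inductive Expr where
  | lit (v : ℕ)
  | var (v : ℕ)
  | bin (o : BinOp) (a b : Expr)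
  | ld (a : Expr)

namespace Expr

/-- The value of an expression. -/
def eval (w : ℕ) (s : State) : Expr → ℕ
  | lit v => v % 2 ^ w
  | var v => s.reg v
  | bin o a b => o.evalNat w (a.eval w s) (b.eval w s)
  | ld a => s.mem (a.eval w s)

/-- Only variables below `40` occur. -/
def WF : Expr → Prop
  | lit _ => True
  | var v => v < 40
  | bin _ a b => a.WF ∧ b.WF
  | ld a => a.WF

instance decidableWF : ∀ e : Expr, Decidable e.WF
  | lit _ => isTrue trivial
  | var v => inferInstanceAs (Decidable (v < 40))
  | bin _ a b => @instDecidableAnd _ _ (decidableWF a) (decidableWF b)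
  | ld a => decidableWF a

/-- Code that computes the expression in register `40 + d`, using the registers above it. -/
def compile : Expr → ℕ → List Instr
  | lit v, d => [.const (40 + d) v]
  | var v, d => [.op .or (40 + d) v v]
  | bin o a b, d => a.compile d ++ (b.compile (d + 1) ++ [.op o (40 + d) (40 + d) (40 + (d + 1))])
  | ld a, d => a.compile d ++ [.load (40 + d) (40 + d)]

/-- The number of instructions of the compiled expression. -/
def size : Expr → ℕ
  | lit _ => 1
  | var _ => 1
  | bin _ a b => a.size + (b.size + 1)
  | ld a => a.size + 1

theorem length_compile (e : Expr) (d : ℕ) : (e.compile d).length = e.size := by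
  induction e generalizing d with
  | lit v => rfl
  | var v => rfl
  | bin o a b iha ihb => simp [compile, size, iha, ihb]
  | ld a ih => simp [compile, size, ih]

/-- The registers from `40` on serve as an evaluation stack with top `40 + d`. The clause about `r <
40 + d` keeps the left operand of a binary operation alive while the right one is computed. -/
theorem run_compile {w : ℕ} [NeZero w] {P : Program} {ω : ℕ → BitVec w} {s : State} (e : Expr) :
    ∀ (d o : ℕ) (σ : Config w), e.WF → At P o (e.compile d) → σ.pc = o → Rel s σ →
      ∃ σ', run P ω e.size σ = σ' ∧ σ'.pc = o + e.size ∧ Rel s σ' ∧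
        (σ'.reg (40 + d)).toNat = e.eval w s ∧ ∀ r < 40 + d, σ'.reg r = σ.reg r := by
  induction e with
  | lit v =>
    intro d o σ _ hat hpc hrel
    have h1 : P[σ.pc]? = some (.const (40 + d) v) := by rw [hpc]; exact hat.head
    refine ⟨_, run_one h1, ?_, ⟨?_, ?_, ?_⟩, ?_, ?_⟩
    · simp [Instr.exec, hpc, size]
    · intro r hr
      simp [Instr.exec, Function.update_of_ne (show r ≠ 40 + d by omega), hrel.reg r hr]
    · exact hrel.mem
    · exact hrel.drawn
    · simp [Instr.exec, eval]
    · intro r hr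
      simp [Instr.exec, Function.update_of_ne (show r ≠ 40 + d by omega)]
  | var v =>
    intro d o σ hwf hat hpc hrel
    have h1 : P[σ.pc]? = some (.op .or (40 + d) v v) := by rw [hpc]; exact hat.head
    refine ⟨_, run_one h1, ?_, ⟨?_, ?_, ?_⟩, ?_, ?_⟩
    · simp [Instr.exec, hpc, size]
    · intro r hr
      simp [Instr.exec, Function.update_of_ne (show r ≠ 40 + d by omega), hrel.reg r hr]
    · exact hrel.mem
    · exact hrel.drawn
    · simp [Instr.exec, eval, BinOp.eval, hrel.reg v hwf]
    · intro r hr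
      simp [Instr.exec, Function.update_of_ne (show r ≠ 40 + d by omega)]
  | bin op a b iha ihb =>
    intro d o σ hwf hat hpc hrel
    obtain ⟨σ₁, hr1, hp1, hrel1, hv1, hf1⟩ := iha d o σ hwf.1 hat.left hpc hrel
    have hat' := hat.right
    rw [length_compile] at hat'
    obtain ⟨σ₂, hr2, hp2, hrel2, hv2, hf2⟩ := ihb (d + 1) _ σ₁ hwf.2 hat'.left hp1 hrel1
    have hat'' := hat'.right
    rw [length_compile] at hat''
    have h1 : P[σ₂.pc]? = some (.op op (40 + d) (40 + d) (40 + (d + 1))) := by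
      rw [hp2]; exact hat''.head
    refine ⟨Instr.exec ω σ₂ (.op op (40 + d) (40 + d) (40 + (d + 1))), ?_, ?_, ⟨?_, ?_, ?_⟩,
      ?_, ?_⟩
    · rw [size, run_add, hr1, run_add, hr2, run_one h1]
    · simp [Instr.exec, hp2, size]; omega
    · intro r hr
      simp [Instr.exec, Function.update_of_ne (show r ≠ 40 + d by omega), hrel2.reg r hr]
    · exact hrel2.mem
    · exact hrel2.drawn
    · simp only [Instr.exec, Function.update_self, BinOp.toNat_eval, eval]
      rw [hv2, hf2 _ (by omega), hv1]
    · intro r hr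
      simp only [Instr.exec, Function.update_of_ne (show r ≠ 40 + d by omega)]
      rw [hf2 r (by omega), hf1 r hr]
  | ld a ih =>
    intro d o σ hwf hat hpc hrel
    obtain ⟨σ₁, hr1, hp1, hrel1, hv1, hf1⟩ := ih d o σ hwf hat.left hpc hrel
    have hat' := hat.right
    rw [length_compile] at hat'
    have h1 : P[σ₁.pc]? = some (.load (40 + d) (40 + d)) := by rw [hp1]; exact hat'.head
    refine ⟨Instr.exec ω σ₁ (.load (40 + d) (40 + d)), ?_, ?_, ⟨?_, ?_, ?_⟩, ?_, ?_⟩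
    · rw [size, run_add, hr1, run_one h1]
    · simp [Instr.exec, hp1, size]; omega
    · intro r hr
      simp [Instr.exec, Function.update_of_ne (show r ≠ 40 + d by omega), hrel1.reg r hr]
    · exact hrel1.mem
    · exact hrel1.drawn
    · simp only [Instr.exec, Function.update_self, eval]
      rw [hrel1.mem, hv1]
    · intro r hr
      simp only [Instr.exec, Function.update_of_ne (show r ≠ 40 + d by omega)]
      rw [hf1 r hr]

end Expr

/-! ### Relocatable code with a specification -/

/-- Relocatable code: `code o` is the code placed at position `o`. -/
structure Frag where
  len : ℕ
  code : ℕ → List Instr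
  length_code : ∀ o, (code o).length = len

/-- Started in state `s`, the code reaches its end within `B` steps, in a state with `Q`. -/
def Runs {w : ℕ} (ω : ℕ → BitVec w) (F : Frag) (s : State) (B : ℕ) (Q : State → Prop) : Prop :=
  ∀ (P : Program) (o : ℕ), At P o (F.code o) → ∀ σ : Config w, σ.pc = o → Rel s σ →
    ∃ t ≤ B, ∃ s', Rel s' (run P ω t σ) ∧ (run P ω t σ).pc = o + F.len ∧ Q s'

section Runs

variable {w : ℕ} {ω : ℕ → BitVec w}

theorem Runs.mono {F : Frag} {s : State} {B B' : ℕ} {Q Q' : State → Prop} (h : Runs ω F s B Q)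
    (hB : B ≤ B') (hQ : ∀ s', Q s' → Q' s') : Runs ω F s B' Q' := by
  intro P o hat σ hpc hrel
  obtain ⟨t, ht, s', h1, h2, h3⟩ := h P o hat σ hpc hrel
  exact ⟨t, ht.trans hB, s', h1, h2, hQ s' h3⟩

/-- Values of variables and cells are words. -/
theorem Runs.of_lt {F : Frag} {s : State} {B : ℕ} {Q : State → Prop}
    (h : (∀ r < 40, s.reg r < 2 ^ w) → (∀ a < 2 ^ w, s.mem a < 2 ^ w) → Runs ω F s B Q) :
    Runs ω F s B Q := by
  intro P o hat σ hpc hrel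
  exact h (fun r hr => hrel.reg_lt hr) (fun a ha => hrel.mem_lt ha) P o hat σ hpc hrel

/-- Sequential composition. -/
def Frag.seq (F G : Frag) : Frag where
  len := F.len + G.len
  code o := F.code o ++ G.code (o + F.len)
  length_code o := by simp [F.length_code, G.length_code]

theorem Runs.seq {F G : Frag} {s : State} {B₁ B₂ : ℕ} {R Q : State → Prop}
    (hF : Runs ω F s B₁ R) (hG : ∀ s', R s' → Runs ω G s' B₂ Q) :
    Runs ω (F.seq G) s (B₁ + B₂) Q := by
  intro P o hat σ hpc hrel
  obtain ⟨t, ht, s', h1, h2, h3⟩ := hF P o hat.left σ hpc hrel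
  have hat' := hat.right
  rw [F.length_code] at hat'
  obtain ⟨t', ht', s'', h1', h2', h3'⟩ := hG s' h3 P _ hat' _ h2 h1
  refine ⟨t + t', by omega, s'', ?_, ?_, h3'⟩
  · rw [run_add]; exact h1'
  · rw [run_add, h2']; simp only [Frag.seq]; omega

/-- Assignments, stores and draws of random words. -/
inductive Stmt where
  | set (v : ℕ) (e : Expr)
  | put (a e : Expr)
  | draw (v : ℕ)

namespace Stmt

/-- Only variables below `40` occur. -/
def WF : Stmt → Prop
  | set v e => v < 40 ∧ e.WF
  | put a e => a.WF ∧ e.WF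
  | draw v => v < 40

instance decidableWF : ∀ c : Stmt, Decidable c.WF
  | set v e => inferInstanceAs (Decidable (v < 40 ∧ e.WF))
  | put a e => inferInstanceAs (Decidable (a.WF ∧ e.WF))
  | draw v => inferInstanceAs (Decidable (v < 40))

/-- The effect of a statement. -/
def exec (ω : ℕ → BitVec w) (s : State) : Stmt → State
  | set v e => s.set v (e.eval w s)
  | put a e => s.put (a.eval w s) (e.eval w s)
  | draw v => (s.set v (ω s.drawn).toNat).draw

/-- The code of a statement. -/
def compile : Stmt → List Instr
  | set v e => e.compile 0 ++ [.op .or v 40 40]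
  | put a e => a.compile 0 ++ (e.compile 1 ++ [.store 40 41])
  | draw v => [.rand v]

/-- The number of instructions of a statement. -/
def size : Stmt → ℕ
  | set _ e => e.size + 1
  | put a e => a.size + (e.size + 1)
  | draw _ => 1

theorem length_compile (c : Stmt) : c.compile.length = c.size := by
  cases c <;> simp [compile, size, Expr.length_compile]

theorem run_compile [NeZero w] {P : Program} {s : State} (c : Stmt) (o : ℕ) (σ : Config w)
    (hwf : c.WF) (hat : At P o c.compile) (hpc : σ.pc = o) (hrel : Rel s σ) :
    Rel (c.exec ω s) (run P ω c.size σ) ∧ (run P ω c.size σ).pc = o + c.size := by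
  cases c with
  | set v e =>
    obtain ⟨σ₁, hr1, hp1, hrel1, hv1, hf1⟩ := e.run_compile (ω := ω) 0 o σ hwf.2 hat.left hpc hrel
    have hat' := hat.right
    rw [Expr.length_compile] at hat'
    have h1 : P[σ₁.pc]? = some (.op .or v 40 40) := by rw [hp1]; exact hat'.head
    rw [size, run_add, hr1, run_one h1]
    refine ⟨⟨?_, hrel1.mem, hrel1.drawn⟩, ?_⟩
    · intro r hr
      by_cases hrv : r = v
      · subst hrv
        simpa [Instr.exec, exec, BinOp.eval] using hv1
      · simp [Instr.exec, exec, hrv, hrel1.reg r hr]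
    · simp [Instr.exec, hp1]; omega
  | put a e =>
    obtain ⟨σ₁, hr1, hp1, hrel1, hv1, hf1⟩ := a.run_compile (ω := ω) 0 o σ hwf.1 hat.left hpc hrel
    have hat' := hat.right
    rw [Expr.length_compile] at hat'
    obtain ⟨σ₂, hr2, hp2, hrel2, hv2, hf2⟩ :=
      e.run_compile (ω := ω) 1 _ σ₁ hwf.2 hat'.left hp1 hrel1
    have hat'' := hat'.right
    rw [Expr.length_compile] at hat''
    have h1 : P[σ₂.pc]? = some (.store 40 41) := by rw [hp2]; exact hat''.head
    rw [size, run_add, hr1, run_add, hr2, run_one h1]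
    refine ⟨⟨hrel2.reg, ?_, hrel2.drawn⟩, ?_⟩
    · intro x
      have h40 : (σ₂.reg 40).toNat = a.eval w s := by rw [hf2 40 (by omega)]; exact hv1
      simp only [Instr.exec, exec, State.put_mem]
      by_cases hx : x = σ₂.reg 40
      · subst hx
        rw [Function.update_self, if_pos h40]; exact hv2
      · rw [Function.update_of_ne hx, if_neg, hrel2.mem]
        rw [← h40]; exact fun h => hx (BitVec.eq_of_toNat_eq h)
    · simp [Instr.exec, hp2]; omega
  | draw v =>
    have h1 : P[σ.pc]? = some (.rand v) := by rw [hpc]; exact hat.head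
    rw [size, run_one h1]
    refine ⟨⟨?_, hrel.mem, ?_⟩, ?_⟩
    · intro r hr
      by_cases hrv : r = v
      · subst hrv
        simp [Instr.exec, exec, hrel.drawn]
      · simp [Instr.exec, exec, hrv, hrel.reg r hr]
    · simp [Instr.exec, exec, hrel.drawn]
    · simp [Instr.exec, hpc]

end Stmt

/-- The code of a list of statements. -/
def blockCode : List Stmt → List Instr
  | [] => []
  | c :: l => c.compile ++ blockCode l

/-- The number of instructions of a list of statements. -/
def blockSize : List Stmt → ℕ
  | [] => 0
  | c :: l => c.size + blockSize l

theorem length_blockCode (l : List Stmt) : (blockCode l).length = blockSize l := by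
  induction l with
  | nil => rfl
  | cons c l ih => simp [blockCode, blockSize, ih, Stmt.length_compile]

/-- A list of statements. -/
def block (l : List Stmt) : Frag where
  len := blockSize l
  code _ := blockCode l
  length_code _ := length_blockCode l

/-- The weakest precondition of a list of statements. -/
def WP (ω : ℕ → BitVec w) : List Stmt → State → (State → Prop) → Prop
  | [], s, Q => Q s
  | c :: l, s, Q => c.WF ∧ WP ω l (c.exec ω s) Q

theorem WP.set {v : ℕ} {e : Expr} {l : List Stmt} {s : State} {Q : State → Prop} (x : ℕ)
    (hwf : (Stmt.set v e).WF) (hx : e.eval w s = x) (h : WP ω l (s.set v x) Q) :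
    WP ω (.set v e :: l) s Q :=
  ⟨hwf, by simpa [Stmt.exec, hx] using h⟩

theorem WP.put {a e : Expr} {l : List Stmt} {s : State} {Q : State → Prop} (y x : ℕ)
    (hwf : (Stmt.put a e).WF) (hy : a.eval w s = y) (hx : e.eval w s = x)
    (h : WP ω l (s.put y x) Q) :
    WP ω (.put a e :: l) s Q :=
  ⟨hwf, by simpa [Stmt.exec, hx, hy] using h⟩

theorem WP.draw {v : ℕ} {l : List Stmt} {s : State} {Q : State → Prop}
    (hwf : (Stmt.draw v).WF) (h : WP ω l (s.set v (ω s.drawn).toNat).draw Q) :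
    WP ω (.draw v :: l) s Q :=
  ⟨hwf, h⟩

theorem WP.mono {l : List Stmt} {s : State} {Q Q' : State → Prop} (h : WP ω l s Q)
    (hQ : ∀ s', Q s' → Q' s') : WP ω l s Q' := by
  induction l generalizing s with
  | nil => exact hQ s h
  | cons c l ih => exact ⟨h.1, ih h.2⟩

theorem Runs.block [NeZero w] {l : List Stmt} {s : State} {B : ℕ} {Q : State → Prop}
    (h : WP ω l s Q) (hB : blockSize l ≤ B) : Runs ω (block l) s B Q := by
  suffices Runs ω (WordRAM.block l) s (blockSize l) Q from this.mono hB fun _ => id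
  clear hB
  induction l generalizing s with
  | nil =>
    intro P o hat σ hpc hrel
    exact ⟨0, le_rfl, s, hrel, hpc, h⟩
  | cons c l ih =>
    intro P o hat σ hpc hrel
    obtain ⟨hc, h⟩ := h
    change At P o (c.compile ++ blockCode l) at hat
    obtain ⟨h1, h2⟩ := c.run_compile (ω := ω) o σ hc hat.left hpc hrel
    have hat' := hat.right
    rw [Stmt.length_compile] at hat'
    obtain ⟨t, ht, s', h3, h4, h5⟩ := ih h P _ hat' _ h2 h1
    refine ⟨c.size + t, by simpa [blockSize] using ht, s', ?_, ?_, h5⟩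
    · rw [run_add]; exact h3
    · rw [run_add, h4]; simp only [WordRAM.block, blockSize]; omega

/-- `for v in 0 ..< b do F`, where `b` is a variable. -/
def forLoop (v b : ℕ) (F : Frag) : Frag where
  len := F.len + 6
  -- The six extra instructions are initialisation, comparison, exit jump, and the three that
  -- increment and jump back. Jump targets are absolute, which is why code depends on its position.
  code o := [.const v 0, .op .lt 40 v b, .jumpIfZero 40 (o + (F.len + 6))] ++ (F.code (o + 3) ++
    [.const 40 1, .op .add v v 40, .jump (o + 1)])
  length_code o := by simp [F.length_code]

/-- Each round costs five steps besides the body. The last 3 accounts for the initialisation and the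
final failing test. The body has to preserve the counter and the bound. -/
theorem Runs.forLoop [NeZero w] {v b N B : ℕ} {F : Frag} {s : State} {Q : State → Prop}
    (Inv : ℕ → State → Prop) (hv : v < 40) (hb : b < 40) (hvb : v ≠ b) (hN : s.reg b = N)
    (hinit : Inv 0 (s.set v 0))
    (hstep : ∀ i < N, ∀ s', s'.reg v = i → s'.reg b = N → Inv i s' →
      Runs ω F s' B fun s'' => s''.reg v = i ∧ s''.reg b = N ∧ Inv (i + 1) (s''.set v (i + 1)))
    (hend : ∀ s', s'.reg v = N → Inv N s' → Q s') :
    Runs ω (forLoop v b F) s (N * (B + 5) + 3) Q := by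
  have hw : w ≠ 0 := NeZero.ne w
  intro P o hat σ hpc hrel
  have hat1 := hat.head
  have hat2 := hat.tail.head
  have hat3 := hat.tail.tail.head
  have hat4 : At P (o + 3) (F.code (o + 3)) := hat.right.left
  have hat5 := hat.right.right
  rw [F.length_code] at hat5
  simp only [List.length_cons, List.length_nil, zero_add, Nat.reduceAdd] at hat5
  have hat6 := hat5.tail.head
  have hat7 := hat5.tail.tail.head
  have hat5' := hat5.head
  have key : ∀ d i, i + d = N → ∀ (s' : State) (σ' : Config w), Rel s' σ' → σ'.pc = o + 1 →
      s'.reg v = i → s'.reg b = N → Inv i s' →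
      ∃ t ≤ d * (B + 5) + 2, ∃ s'', Rel s'' (run P ω t σ') ∧
        (run P ω t σ').pc = o + (F.len + 6) ∧ Q s'' := by
    intro d
    induction d with
    | zero =>
      intro i hi s' σ' hrel' hpc' hvi hbN hInv
      have e1 := run_one (ω := ω) (hpc' ▸ hat2)
      set σ₁ := Instr.exec ω σ' (.op .lt 40 v b) with hσ₁
      have hlt : ¬ σ'.reg v < σ'.reg b := by
        rw [BitVec.lt_def, hrel'.reg v hv, hrel'.reg b hb, hvi, hbN]; omega
      have hp1 : σ₁.pc = o + 1 + 1 := by simp [hσ₁, Instr.exec, hpc']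
      have e2 := run_one (ω := ω) (hp1 ▸ hat3)
      have h40 : σ₁.reg 40 = 0 := by simp [hσ₁, Instr.exec, BinOp.eval, hlt]
      refine ⟨1 + 1, by omega, s', ?_, ?_, hend s' (by omega) (by
        rw [← show i = N by omega]; exact hInv)⟩
      · rw [run_add, e1, e2]
        refine ⟨fun r hr => ?_, hrel'.mem, hrel'.drawn⟩
        simp [hσ₁, Instr.exec, Function.update_of_ne (show r ≠ 40 by omega), hrel'.reg r hr]
      · rw [run_add, e1, e2]
        simp [Instr.exec, h40]
    | succ d ih =>
      intro i hi s' σ' hrel' hpc' hvi hbN hInv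
      -- The bound is the content of a register, hence a word, so the increment of the counter does
      -- not wrap.
      have hNlt : N < 2 ^ w := by rw [← hbN]; exact hrel'.reg_lt hb
      have e1 := run_one (ω := ω) (hpc' ▸ hat2)
      set σ₁ := Instr.exec ω σ' (.op .lt 40 v b) with hσ₁
      have hlt : σ'.reg v < σ'.reg b := by
        rw [BitVec.lt_def, hrel'.reg v hv, hrel'.reg b hb, hvi, hbN]; omega
      have hp1 : σ₁.pc = o + 1 + 1 := by simp [hσ₁, Instr.exec, hpc']
      have e2 := run_one (ω := ω) (hp1 ▸ hat3)
      have h40 : σ₁.reg 40 ≠ 0 := by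
        simp [hσ₁, Instr.exec, BinOp.eval, hlt, hw]
      set σ₂ := Instr.exec ω σ₁ (.jumpIfZero 40 (o + (F.len + 6))) with hσ₂
      have hp2 : σ₂.pc = o + 3 := by
        simp only [hσ₂, Instr.exec, if_neg h40, hp1]
      have hrel2 : Rel s' σ₂ := by
        refine ⟨fun r hr => ?_, hrel'.mem, hrel'.drawn⟩
        simp [hσ₂, hσ₁, Instr.exec, Function.update_of_ne (show r ≠ 40 by omega), hrel'.reg r hr]
      obtain ⟨t, ht, s₃, hrel3, hp3, hv3, hb3, hI3⟩ :=
        hstep i (by omega) s' hvi hbN hInv P _ hat4 σ₂ hp2 hrel2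
      set σ₃ := run P ω t σ₂ with hσ₃
      have hp3' : σ₃.pc = o + 3 + F.len := hp3
      have e4 := run_one (ω := ω) (hp3' ▸ hat5')
      set σ₄ := Instr.exec ω σ₃ (.const 40 1) with hσ₄
      have hp4 : σ₄.pc = o + 3 + F.len + 1 := by simp [hσ₄, Instr.exec, hp3']
      have e5 := run_one (ω := ω) (hp4 ▸ hat6)
      set σ₅ := Instr.exec ω σ₄ (.op .add v v 40) with hσ₅
      have hp5 : σ₅.pc = o + 3 + F.len + 1 + 1 := by simp [hσ₅, Instr.exec, hp4]
      have e6 := run_one (ω := ω) (hp5 ▸ hat7)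
      set σ₆ := Instr.exec ω σ₅ (.jump (o + 1)) with hσ₆
      have hp6 : σ₆.pc = o + 1 := by simp [hσ₆, Instr.exec]
      have hrel6 : Rel (s₃.set v (i + 1)) σ₆ := by
        refine ⟨fun r hr => ?_, hrel3.mem, hrel3.drawn⟩
        by_cases hrv : r = v
        · subst hrv
          have h1 : (σ₃.reg r).toNat = i := by rw [hrel3.reg r hv, hv3]
          simp only [hσ₆, hσ₅, hσ₄, Instr.exec, Function.update_self, BinOp.eval,
            State.set_reg_self, BitVec.toNat_add, Function.update_of_ne (show r ≠ 40 by omega),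
            h1, BitVec.toNat_ofNat]
          rw [Nat.add_mod_mod, Nat.mod_eq_of_lt (by omega)]
        · simp [hσ₆, hσ₅, hσ₄, Instr.exec, Function.update_of_ne (show r ≠ 40 by omega), hrv,
            hrel3.reg r hr]
      obtain ⟨t', ht', s'', h1, h2, h3⟩ := ih (i + 1) (by omega) (s₃.set v (i + 1)) σ₆ hrel6 hp6
        (by simp) (by simp [Ne.symm hvb, hb3]) hI3
      have hrun : run P ω (1 + (1 + (t + (1 + (1 + (1 + t')))))) σ' = run P ω t' σ₆ := by
        rw [run_add, e1, run_add, e2, run_add, run_add, e4, run_add, e5, run_add, e6]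
      refine ⟨1 + (1 + (t + (1 + (1 + (1 + t'))))), ?_, s'', ?_, ?_, h3⟩
      · rw [Nat.succ_mul]; omega
      · rw [hrun]; exact h1
      · rw [hrun]; exact h2
  have e0 := run_one (ω := ω) (hpc ▸ hat1)
  set σ₀ := Instr.exec ω σ (.const v 0) with hσ₀
  obtain ⟨t, ht, s', h1, h2, h3⟩ := key N 0 (by omega) (s.set v 0) σ₀
    (by
      refine ⟨fun r hr => ?_, hrel.mem, hrel.drawn⟩
      by_cases hrv : r = v
      · subst hrv; simp [hσ₀, Instr.exec]
      · simp [hσ₀, Instr.exec, hrv, hrel.reg r hr])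
    (by simp [hσ₀, Instr.exec, hpc]) (by simp) (by simp [Ne.symm hvb, hN]) hinit
  refine ⟨1 + t, by omega, s', ?_, ?_, h3⟩
  · rw [run_add, e0]; exact h1
  · rw [run_add, e0, h2]; rfl

end Runs

/-! ### Simulating a program with shorter words

The registers `R[r]` of the simulated program are kept in `R[41 + r]`, its memory is kept in the cells
from address `R[13]` on, and `R[8]` holds the mask `2 ^ w' - 1`. -/

/-- The two instructions that simulate an instruction of a program of length `len`. -/
def simInstr (o len : ℕ) : Instr → List Instr
  -- Masking after each computation restores the invariant that simulated registers hold short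
  -- words.
  | .const r v => [.const (41 + r) v, .op .and (41 + r) (41 + r) 8]
  | .op c r s t => [.op c (41 + r) (41 + s) (41 + t), .op .and (41 + r) (41 + r) 8]
  | .load r s => [.op .add 40 13 (41 + s), .load (41 + r) 40]
  | .store r s => [.op .add 40 13 (41 + r), .store 40 (41 + s)]
  -- This case is never executed, because the simulated program is deterministic. Here and below the
  -- second instruction pads to length two, so that instruction `i` sits at offset `2 * i`.
  | .rand _ => [.const 40 0, .const 40 0]
  -- A jump past the end of the simulated program must land exactly at the end of the simulating
  -- code.
  | .jump l => [.jump (o + 2 * min l len), .const 40 0]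
  | .jumpIfZero r l => [.jumpIfZero (41 + r) (o + 2 * min l len), .const 40 0]

theorem length_simInstr (o len : ℕ) (I : Instr) : (simInstr o len I).length = 2 := by
  cases I <;> rfl

/-- The simulating code. -/
def simProgram (P : Program) (o : ℕ) : List Instr := P.flatMap (simInstr o P.length)

theorem length_flatMap_two {α β : Type*} {f : α → List β} (hf : ∀ x, (f x).length = 2)
    (L : List α) : (L.flatMap f).length = 2 * L.length := by
  induction L with
  | nil => rfl
  | cons a L ih => simp [List.flatMap_cons, hf, ih]; omega

theorem At.flatMap {α : Type*} {Q : Program} {f : α → List Instr} (hf : ∀ x, (f x).length = 2)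
    (L : List α) : ∀ (o i : ℕ) (x : α), At Q o (L.flatMap f) → L[i]? = some x →
      At Q (o + 2 * i) (f x) := by
  induction L with
  | nil => intro o i x _ h; simp at h
  | cons a L ih =>
    intro o i x hat h
    rw [List.flatMap_cons] at hat
    cases i with
    | zero =>
      simp only [List.getElem?_cons_zero, Option.some.injEq] at h
      subst h; exact hat.left
    | succ i =>
      have h2 := hat.right
      rw [hf] at h2
      have := ih (o + 2) i x h2 (by simpa using h)
      rwa [show o + 2 * (i + 1) = o + 2 + 2 * i by ring]

/-- A strict upper bound for the registers of an instruction. -/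
def Instr.regBound : Instr → ℕ
  | .const r _ => r + 1
  | .op _ r s t => r + s + t + 1
  | .load r s => r + s + 1
  | .store r s => r + s + 1
  | .rand r => r + 1
  | .jump _ => 1
  | .jumpIfZero r _ => r + 1

/-- A strict upper bound for the registers of a program. -/
def Program.regBound (P : Program) : ℕ := (P.map Instr.regBound).sum + 1

theorem Program.regBound_le {P : Program} {I : Instr} (h : I ∈ P) : I.regBound ≤ P.regBound := by
  have := List.single_le_sum (l := P.map Instr.regBound) (by simp) I.regBound
    (List.mem_map_of_mem h)
  unfold Program.regBound; omega

/-- For addition, subtraction, multiplication and left shift the low bits survive because `2 ^ w'`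
divides `2 ^ w`. The other operations turn short operands into a short result anyway. -/
theorem BinOp.evalNat_mod {w w' : ℕ} (hw' : 0 < w') (h : w' ≤ w) (c : BinOp) {x y : ℕ}
    (hx : x < 2 ^ w') (hy : y < 2 ^ w') : c.evalNat w x y % 2 ^ w' = c.evalNat w' x y := by
  have hd : 2 ^ w' ∣ 2 ^ w := pow_dvd_pow 2 h
  have h1 : 1 < 2 ^ w' := Nat.one_lt_two_pow hw'.ne'
  cases c <;> simp only [BinOp.evalNat]
  · exact Nat.mod_mod_of_dvd _ hd
  · rw [Nat.mod_mod_of_dvd _ hd]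
    obtain ⟨k, hk⟩ := hd
    have hk0 : 0 < k := by
      rcases Nat.eq_zero_or_pos k with rfl | h0
      · have : 0 < 2 ^ w := by positivity
        omega
      · exact h0
    obtain ⟨k, rfl⟩ : ∃ k', k = k' + 1 := ⟨k - 1, by omega⟩
    rw [Nat.mul_succ] at hk
    rw [show 2 ^ w - y + x = (2 ^ w' - y + x) + 2 ^ w' * k by omega, Nat.add_mul_mod_self_left]
  · exact Nat.mod_mod_of_dvd _ hd
  · exact Nat.mod_eq_of_lt ((Nat.div_le_self _ _).trans_lt hx)
  · exact Nat.mod_eq_of_lt ((Nat.mod_le _ _).trans_lt hx)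
  · exact Nat.mod_eq_of_lt (Nat.and_lt_two_pow _ hy)
  · exact Nat.mod_eq_of_lt (Nat.or_lt_two_pow hx hy)
  · exact Nat.mod_eq_of_lt (Nat.xor_lt_two_pow hx hy)
  · exact Nat.mod_mod_of_dvd _ hd
  · exact Nat.mod_eq_of_lt ((Nat.shiftRight_le _ _).trans_lt hx)
  · exact Nat.mod_eq_of_lt (by split_ifs <;> omega)

/-- The configuration `σ` of the simulating machine, which started in `σ₀`, represents the
configuration `τ` of the simulated one. -/
structure SimRel {w w' : ℕ} (P : Program) (o B : ℕ) (σ₀ σ : Config w) (τ : Config w') : Prop where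
  pc : σ.pc = o + 2 * min τ.pc P.length
  reg : ∀ r < P.regBound, (σ.reg (41 + r)).toNat = (τ.reg r).toNat
  low : ∀ r < 40, σ.reg r = σ₀.reg r
  mem_in : ∀ x : BitVec w', (σ.mem (BitVec.ofNat w (B + x.toNat))).toNat = (τ.mem x).toNat
  mem_out : ∀ y : BitVec w, y.toNat < B ∨ B + 2 ^ w' ≤ y.toNat → σ.mem y = σ₀.mem y
  drawn : σ.drawn = σ₀.drawn

section Sim

variable {w w' : ℕ} {P Q : Program} {ω : ℕ → BitVec w} {ω' : ℕ → BitVec w'} {o B : ℕ}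
  {σ₀ σ : Config w} {τ : Config w'}

/-- Writing a register of the simulated program, up to the mask. -/
theorem SimRel.masked {r : ℕ} (hat₁ : Q[σ.pc + 1]? = some (.op .and (41 + r) (41 + r) 8))
    {I : Instr} (hat₀ : Q[σ.pc]? = some I)
    {v : BitVec w} (hI : I.exec ω σ = { σ with
      pc := σ.pc + 1, reg := Function.update σ.reg (41 + r) v })
    (hmask : (σ₀.reg 8).toNat = 2 ^ w' - 1) (h : SimRel P o B σ₀ σ τ) (hlt : τ.pc < P.length)
    {v' : BitVec w'} (hv : v.toNat % 2 ^ w' = v'.toNat) :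
    SimRel P o B σ₀ (run Q ω 2 σ)
      { τ with pc := τ.pc + 1, reg := Function.update τ.reg r v' } := by
  have e : run Q ω (1 + 1) σ = Instr.exec ω { σ with
      pc := σ.pc + 1, reg := Function.update σ.reg (41 + r) v }
      (.op .and (41 + r) (41 + r) 8) := by
    rw [run_add, run_one hat₀, hI, run_one (I := .op .and (41 + r) (41 + r) 8) hat₁]
  rw [show 2 = 1 + 1 from rfl, e]
  have h8 : Function.update σ.reg (41 + r) v 8 = σ₀.reg 8 := by
    rw [Function.update_of_ne (by omega), h.low 8 (by omega)]
  refine ⟨?_, ?_, ?_, h.mem_in, h.mem_out, h.drawn⟩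
  · simp only [Instr.exec, h.pc]; omega
  · intro r' hr'
    by_cases hr : r' = r
    · subst hr
      simp only [Instr.exec, BinOp.eval, Function.update_self, h8, BitVec.toNat_and, hmask,
        Nat.and_two_pow_sub_one_eq_mod, hv]
    · simp only [Instr.exec, Function.update_of_ne (show 41 + r' ≠ 41 + r by omega),
        Function.update_of_ne hr, h.reg r' hr']
  · intro r' hr'
    simp only [Instr.exec, Function.update_of_ne (show r' ≠ 41 + r by omega), h.low r' hr']

/-- A halted machine costs no step, a taken jump one, everything else two. By `hB` the block does
not wrap around the address space, so different simulated addresses stay different. -/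
theorem SimRel.step (hw' : 0 < w') (hB : B + 2 ^ w' ≤ 2 ^ w) (hbase : (σ₀.reg 13).toNat = B)
    (hmask : (σ₀.reg 8).toNat = 2 ^ w' - 1) (hat : At Q o (simProgram P o))
    (hdet : P.Deterministic) (h : SimRel P o B σ₀ σ τ) :
    ∃ t ≤ 2, SimRel P o B σ₀ (run Q ω t σ) (WordRAM.step P ω' τ) := by
  have hww : w' ≤ w := (Nat.pow_le_pow_iff_right (by norm_num)).1 (show 2 ^ w' ≤ 2 ^ w by omega)
  have hw : 0 < w := by omega
  have : NeZero w := ⟨hw.ne'⟩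
  have : NeZero w' := ⟨hw'.ne'⟩
  by_cases hlt : τ.pc < P.length
  swap
  · refine ⟨0, by omega, ?_⟩
    rw [WordRAM.step, List.getElem?_eq_none (by omega)]
    exact h
  obtain ⟨I, hI⟩ : ∃ I, P[τ.pc]? = some I := ⟨P[τ.pc], List.getElem?_eq_getElem hlt⟩
  have hIP : I ∈ P := List.mem_of_getElem? hI
  have hbd := Program.regBound_le hIP
  have hpc : σ.pc = o + 2 * τ.pc := by rw [h.pc, min_eq_left hlt.le]
  have hatI : At Q σ.pc (simInstr o P.length I) := by
    rw [hpc]; exact At.flatMap (length_simInstr o P.length) P o τ.pc I hat hI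
  have hstep : WordRAM.step P ω' τ = I.exec ω' τ := by simp [WordRAM.step, hI]
  rw [hstep]
  cases I with
  | const r v =>
    exact ⟨2, le_rfl, SimRel.masked (r := r) hatI.tail.head hatI.head (v := BitVec.ofNat w v) rfl
      hmask h hlt (by simp [Nat.mod_mod_of_dvd _ (pow_dvd_pow 2 hww)])⟩
  | op c r s t =>
    simp only [Instr.regBound] at hbd
    refine ⟨2, le_rfl, SimRel.masked (r := r) hatI.tail.head hatI.head
      (v := c.eval (σ.reg (41 + s)) (σ.reg (41 + t))) rfl hmask h hlt ?_⟩
    rw [BinOp.toNat_eval, BinOp.toNat_eval, h.reg s (by omega), h.reg t (by omega)]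
    exact BinOp.evalNat_mod hw' hww c (τ.reg s).isLt (τ.reg t).isLt
  | load r s =>
    simp only [Instr.regBound] at hbd
    refine ⟨2, le_rfl, ?_⟩
    have e : run Q ω (1 + 1) σ = Instr.exec ω (Instr.exec ω σ (.op .add 40 13 (41 + s)))
        (.load (41 + r) 40) := by
      rw [run_add, run_one hatI.head, run_one hatI.tail.head]
    rw [show 2 = 1 + 1 from rfl, e]
    have hadr : σ.reg 13 + σ.reg (41 + s) = BitVec.ofNat w (B + (τ.reg s).toNat) := by
      apply BitVec.eq_of_toNat_eq
      rw [BitVec.toNat_add, h.low 13 (by omega), hbase, h.reg s (by omega), BitVec.toNat_ofNat]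
    refine ⟨?_, ?_, ?_, h.mem_in, h.mem_out, h.drawn⟩
    · simp only [Instr.exec, hpc]; omega
    · intro r' hr'
      by_cases hr : r' = r
      · subst hr
        simp only [Instr.exec, Function.update_self, BinOp.eval, hadr, h.mem_in]
      · simp only [Instr.exec, Function.update_of_ne (show 41 + r' ≠ 41 + r by omega),
          Function.update_of_ne (show 41 + r' ≠ 40 by omega), Function.update_of_ne hr, h.reg r' hr']
    · intro r' hr'
      simp only [Instr.exec, Function.update_of_ne (show r' ≠ 41 + r by omega),
        Function.update_of_ne (show r' ≠ 40 by omega), h.low r' hr']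
  | store r s =>
    simp only [Instr.regBound] at hbd
    refine ⟨2, le_rfl, ?_⟩
    have e : run Q ω (1 + 1) σ = Instr.exec ω (Instr.exec ω σ (.op .add 40 13 (41 + r)))
        (.store 40 (41 + s)) := by
      rw [run_add, run_one hatI.head, run_one hatI.tail.head]
    rw [show 2 = 1 + 1 from rfl, e]
    have hadr : σ.reg 13 + σ.reg (41 + r) = BitVec.ofNat w (B + (τ.reg r).toNat) := by
      apply BitVec.eq_of_toNat_eq
      rw [BitVec.toNat_add, h.low 13 (by omega), hbase, h.reg r (by omega), BitVec.toNat_ofNat]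
    have hr41 : (41 + s : ℕ) ≠ 40 := by omega
    refine ⟨?_, ?_, ?_, ?_, ?_, h.drawn⟩
    · simp only [Instr.exec, hpc]; omega
    · intro r' hr'
      simp only [Instr.exec, Function.update_of_ne (show 41 + r' ≠ 40 by omega), h.reg r' hr']
    · intro r' hr'
      simp only [Instr.exec, Function.update_of_ne (show r' ≠ 40 by omega), h.low r' hr']
    · intro x
      simp only [Instr.exec, Function.update_self, BinOp.eval, hadr, Function.update_of_ne hr41]
      by_cases hx : x = τ.reg r
      · subst hx
        rw [Function.update_self, Function.update_self, h.reg s (by omega)]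
      · rw [Function.update_of_ne hx, Function.update_of_ne, h.mem_in]
        intro hc
        have := congrArg BitVec.toNat hc
        rw [BitVec.toNat_ofNat, BitVec.toNat_ofNat,
          Nat.mod_eq_of_lt (by have := x.isLt; omega),
          Nat.mod_eq_of_lt (by have := (τ.reg r).isLt; omega)] at this
        exact hx (BitVec.eq_of_toNat_eq (by omega))
    · intro y hy
      simp only [Instr.exec, Function.update_self, BinOp.eval, hadr]
      rw [Function.update_of_ne, h.mem_out y hy]
      rintro rfl
      have h3 := (τ.reg r).isLt
      rw [BitVec.toNat_ofNat, Nat.mod_eq_of_lt (by omega)] at hy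
      omega
  | rand r => exact absurd hIP (hdet r)
  | jump l =>
    refine ⟨1, by omega, ?_⟩
    rw [run_one hatI.head]
    exact ⟨rfl, h.reg, h.low, h.mem_in, h.mem_out, h.drawn⟩
  | jumpIfZero r l =>
    simp only [Instr.regBound] at hbd
    have hz : σ.reg (41 + r) = 0 ↔ τ.reg r = 0 := by
      have := h.reg r (by omega)
      constructor <;> intro h0 <;> apply BitVec.eq_of_toNat_eq
      · rw [← this, h0]; simp
      · rw [this, h0]; simp
    by_cases h0 : τ.reg r = 0
    · refine ⟨1, by omega, ?_⟩
      rw [run_one hatI.head]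
      refine ⟨?_, h.reg, h.low, h.mem_in, h.mem_out, h.drawn⟩
      simp only [Instr.exec, if_pos h0, if_pos (hz.2 h0)]
    · refine ⟨2, le_rfl, ?_⟩
      have e1 := run_one (ω := ω) hatI.head
      have hne : ¬ σ.reg (41 + r) = 0 := fun h => h0 (hz.1 h)
      simp only [Instr.exec, if_neg hne] at e1
      have e : run Q ω (1 + 1) σ = Instr.exec ω { σ with pc := σ.pc + 1 } (.const 40 0) := by
        rw [run_add, e1, run_one (I := .const 40 0) hatI.tail.head]
      rw [show 2 = 1 + 1 from rfl, e]
      refine ⟨?_, ?_, ?_, h.mem_in, h.mem_out, h.drawn⟩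
      · simp only [Instr.exec, if_neg h0, hpc]; omega
      · intro r' hr'
        simp only [Instr.exec, Function.update_of_ne (show 41 + r' ≠ 40 by omega), h.reg r' hr']
      · intro r' hr'
        simp only [Instr.exec, Function.update_of_ne (show r' ≠ 40 by omega), h.low r' hr']

theorem SimRel.run (hw' : 0 < w') (hB : B + 2 ^ w' ≤ 2 ^ w) (hbase : (σ₀.reg 13).toNat = B)
    (hmask : (σ₀.reg 8).toNat = 2 ^ w' - 1) (hat : At Q o (simProgram P o))
    (hdet : P.Deterministic) (h : SimRel P o B σ₀ σ τ) (T : ℕ) :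
    ∃ t ≤ 2 * T, SimRel P o B σ₀ (run Q ω t σ) (WordRAM.run P ω' T τ) := by
  induction T with
  | zero => exact ⟨0, by omega, h⟩
  | succ T ih =>
    obtain ⟨t, ht, h1⟩ := ih
    obtain ⟨t', ht', h2⟩ := SimRel.step (ω := ω) (ω' := ω') hw' hB hbase hmask hat hdet h1
    refine ⟨t + t', by omega, ?_⟩
    rw [run_add]
    have e : WordRAM.run P ω' (T + 1) τ = WordRAM.step P ω' (WordRAM.run P ω' T τ) := by
      rw [run_add]; rfl
    rw [e]; exact h2

/-- The registers above `40` contain remains of expression evaluation and of earlier calls, while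
`init` requires zeros. -/
theorem run_clear (R o d : ℕ) (σ : Config w) (hpc : σ.pc = o)
    (hat : At Q o ((List.range' d R).map fun r => Instr.const (41 + r) 0)) :
    ∃ σ', run Q ω R σ = σ' ∧ σ'.pc = o + R ∧ σ'.mem = σ.mem ∧ σ'.drawn = σ.drawn ∧
      (∀ r < 41 + d, σ'.reg r = σ.reg r) ∧ ∀ r, d ≤ r → r < d + R → σ'.reg (41 + r) = 0 := by
  induction R generalizing o d σ with
  | zero => exact ⟨σ, rfl, by simp [hpc], rfl, rfl, fun _ _ => rfl, fun r h1 h2 => by omega⟩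
  | succ R ih =>
    rw [List.range'_succ, List.map_cons] at hat
    have h1 := run_one (ω := ω) (hpc ▸ hat.head)
    set σ₁ := Instr.exec ω σ (.const (41 + d) 0) with hσ₁
    obtain ⟨σ', e, hp, hm, hd, hlow, hz⟩ := ih (o + 1) (d + 1) σ₁
      (by simp [hσ₁, Instr.exec, hpc]) hat.tail
    refine ⟨σ', ?_, by omega, by rw [hm]; rfl, by rw [hd]; rfl, ?_, ?_⟩
    · rw [Nat.add_comm, run_add, h1, e]
    · intro r hr
      rw [hlow r (by omega)]
      simp [hσ₁, Instr.exec, Function.update_of_ne (show r ≠ 41 + d by omega)]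
    · intro r h2 h3
      by_cases hr : r = d
      · subst hr
        rw [hlow _ (by omega)]
        simp [hσ₁, Instr.exec]
      · exact hz r (by omega) (by omega)

end Sim

/-- Call the program `P` with shorter words: its input size is the variable `6`, its memory starts at
the variable `13`, and its word mask is the variable `8`. -/
def callFrag (P : Program) : Frag where
  len := P.regBound + (1 + 2 * P.length)
  code o := (List.range' 0 P.regBound).map (fun r => Instr.const (41 + r) 0) ++
    ([.op .or 41 6 6] ++ simProgram P (o + P.regBound + 1))
  length_code o := by
    simp [simProgram, length_flatMap_two (length_simInstr _ _)]; omega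

/-- `hmem` concerns the whole block, including the zeros behind the input; this is why a call needs
a fresh block. -/
theorem Runs.call {w w' m B T : ℕ} {P : Program} {ω : ℕ → BitVec w} {s : State}
    (hw' : 0 < w') (hB : B + 2 ^ w' ≤ 2 ^ w) (hbase : s.reg 13 = B)
    (hmask : s.reg 8 = 2 ^ w' - 1) (hm : s.reg 6 = m) (hmw : m < 2 ^ w') (hdet : P.Deterministic)
    (a b c : Fin m → ℤ)
    (hmem : ∀ x : BitVec w', s.mem (B + x.toNat) = ((init w' a b c).mem x).toNat)
    (hhalt : (run P (fun _ => 0) T (init w' a b c)).Halted P) :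
    Runs ω (callFrag P) s (P.regBound + 1 + 2 * T) fun s' =>
      s'.reg = s.reg ∧ s'.drawn = s.drawn ∧ (∀ y, y < B ∨ B + 2 ^ w' ≤ y → s'.mem y = s.mem y) ∧
        ∀ x : BitVec w', s'.mem (B + x.toNat) =
          ((run P (fun _ => 0) T (init w' a b c)).mem x).toNat := by
  intro Q o hat σ hpc hrel
  have hat1 : At Q o ((List.range' 0 P.regBound).map fun r => Instr.const (41 + r) 0) := hat.left
  have hat2 : At Q (o + P.regBound) ([.op .or 41 6 6] ++ simProgram P (o + P.regBound + 1)) := by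
    have := hat.right
    rwa [List.length_map, List.length_range'] at this
  have hat3 : At Q (o + P.regBound + 1) (simProgram P (o + P.regBound + 1)) := hat2.tail
  obtain ⟨σ₁, e1, hp1, hm1, hd1, hlow1, hz1⟩ := run_clear (ω := ω) P.regBound o 0 σ hpc hat1
  have e2 := run_one (ω := ω) (hp1 ▸ hat2.head)
  set σ₂ := Instr.exec ω σ₁ (.op .or 41 6 6) with hσ₂
  have hlow2 : ∀ r < 40, σ₂.reg r = σ.reg r := by
    intro r hr
    simp only [hσ₂, Instr.exec, Function.update_of_ne (show r ≠ 41 by omega)]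
    exact hlow1 r (by omega)
  have hrel0 : SimRel P (o + P.regBound + 1) B σ₂ σ₂ (init w' a b c) := by
    refine ⟨?_, ?_, fun _ _ => rfl, ?_, fun _ _ => rfl, rfl⟩
    · simp [hσ₂, Instr.exec, hp1, init]
    · intro r hr
      by_cases h0 : r = 0
      · subst h0
        simp only [hσ₂, Instr.exec, init, BinOp.eval, Nat.add_zero, Function.update_self, if_true]
        rw [BitVec.or_self, hlow1 6 (by omega), hrel.reg 6 (by omega), hm, BitVec.toNat_ofNat,
          Nat.mod_eq_of_lt hmw]
      · simp only [hσ₂, Instr.exec, Function.update_of_ne (show 41 + r ≠ 41 by omega)]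
        rw [hz1 r (by omega) (by omega)]
        simp [init, h0]
    · intro x
      have hx := x.isLt
      rw [← hmem x]
      have : σ₂.mem = σ.mem := hm1
      rw [this, hrel.mem, BitVec.toNat_ofNat, Nat.mod_eq_of_lt (by omega)]
  obtain ⟨t, ht, hsim⟩ := SimRel.run (ω := ω) (ω' := fun _ => 0) hw' hB
    (by rw [hlow2 13 (by omega), hrel.reg 13 (by omega), hbase])
    (by rw [hlow2 8 (by omega), hrel.reg 8 (by omega), hmask]) hat3 hdet hrel0 T
  have e : run Q ω (P.regBound + (1 + t)) σ = run Q ω t σ₂ := by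
    rw [run_add, e1, run_add, e2]
  set σ₃ := run Q ω t σ₂ with hσ₃
  have hin : ∀ y < 2 ^ w, (BitVec.ofNat w y).toNat = y := fun y hy => by
    rw [BitVec.toNat_ofNat, Nat.mod_eq_of_lt hy]
  refine ⟨P.regBound + (1 + t), by omega,
    -- The abstract memory also has cells beyond the address space, and these are left as they were.
    ⟨s.reg, fun y => if y < 2 ^ w then (σ₃.mem (BitVec.ofNat w y)).toNat else s.mem y, s.drawn⟩,
    ?_, ?_, rfl, rfl, ?_, ?_⟩
  · rw [e]
    refine ⟨?_, ?_, ?_⟩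
    · intro r hr
      rw [hsim.low r hr, hlow2 r hr, hrel.reg r hr]
    · intro x
      simp [x.isLt]
    · rw [hsim.drawn]
      exact hd1.trans hrel.drawn
  · rw [e, hsim.pc, min_eq_right hhalt]
    simp only [callFrag]; omega
  · intro y hy
    simp only
    split_ifs with hyw
    · rw [hsim.mem_out _ (by rwa [hin y hyw])]
      have : σ₂.mem = σ.mem := hm1
      rw [this, hrel.mem, hin y hyw]
    · rfl
  · intro x
    have hx := x.isLt
    simp only
    rw [if_pos (by omega), hsim.mem_in]

namespace Expr

instance : Add Expr := ⟨.bin .add⟩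
instance : Sub Expr := ⟨.bin .sub⟩
instance : Mul Expr := ⟨.bin .mul⟩
instance : Div Expr := ⟨.bin .div⟩
instance : AndOp Expr := ⟨.bin .and⟩
instance : OrOp Expr := ⟨.bin .or⟩
instance : XorOp Expr := ⟨.bin .xor⟩
instance : ShiftLeft Expr := ⟨.bin .shl⟩
instance : ShiftRight Expr := ⟨.bin .shr⟩

/-- The truth value of a comparison. -/
def lt (a b : Expr) : Expr := .bin .lt a b

section

variable (w : ℕ) (s : State) (a b : Expr)

@[simp] theorem eval_lit (v : ℕ) : (lit v).eval w s = v % 2 ^ w := rfl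
@[simp] theorem eval_var (v : ℕ) : (var v).eval w s = s.reg v := rfl
@[simp] theorem eval_ld : (ld a).eval w s = s.mem (a.eval w s) := rfl
@[simp] theorem eval_add : (a + b).eval w s = (a.eval w s + b.eval w s) % 2 ^ w := rfl
@[simp] theorem eval_sub :
    (a - b).eval w s = (2 ^ w - b.eval w s + a.eval w s) % 2 ^ w := rfl
@[simp] theorem eval_mul : (a * b).eval w s = (a.eval w s * b.eval w s) % 2 ^ w := rfl
@[simp] theorem eval_div : (a / b).eval w s = a.eval w s / b.eval w s := rfl
@[simp] theorem eval_and : (a &&& b).eval w s = a.eval w s &&& b.eval w s := rfl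
@[simp] theorem eval_or : (a ||| b).eval w s = a.eval w s ||| b.eval w s := rfl
@[simp] theorem eval_xor : (a ^^^ b).eval w s = a.eval w s ^^^ b.eval w s := rfl
@[simp] theorem eval_shl : (a <<< b).eval w s = (a.eval w s <<< b.eval w s) % 2 ^ w := rfl
@[simp] theorem eval_shr : (a >>> b).eval w s = a.eval w s >>> b.eval w s := rfl
@[simp] theorem eval_lt :
    (a.lt b).eval w s = if a.eval w s < b.eval w s then 1 else 0 := rfl

end

end Expr

open WordRAM.Expr WordRAM.Stmt

/-! ### Filling a table

A table of size `m` at address `A` consists of `m` colours, where `0` marks an empty position,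
followed by `m` values. -/

/-- Every position of the table is empty or holds an entry of `W`, and it is empty only if `W` has no
entry for it. -/
def Filled (mem : ℕ → ℕ) (A m : ℕ) (W : ℕ → ℕ → ℕ → Prop) : Prop :=
  ∀ p < m, (mem (A + p) = 0 ∧ ∀ c v, ¬ W p c v) ∨ W p (mem (A + p)) (mem (A + m + p))

theorem Filled.congr {mem mem' : ℕ → ℕ} {A m : ℕ} {W W' : ℕ → ℕ → ℕ → Prop}
    (h : Filled mem A m W) (hmem : ∀ y, A ≤ y → y < A + 2 * m → mem' y = mem y)
    (hW : ∀ p c v, W p c v ↔ W' p c v) : Filled mem' A m W' := by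
  intro p hp
  rw [hmem (A + p) (by omega) (by omega), hmem (A + m + p) (by omega) (by omega)]
  simpa only [hW] using h p hp

/-- A later entry overwrites an earlier one. `Filled` only promises that some entry of `W` stands at
each position that has one, so it survives overwriting. -/
theorem Filled.write {mem : ℕ → ℕ} {A m : ℕ} {W : ℕ → ℕ → ℕ → Prop} (h : Filled mem A m W)
    {p : ℕ} (hp : p < m) (c v : ℕ) :
    Filled (Function.update (Function.update mem (A + p) c) (A + p + m) v) A m
      fun p' c' v' => W p' c' v' ∨ (p' = p ∧ c' = c ∧ v' = v) := by
  intro p' hp'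
  by_cases hpp : p' = p
  · subst hpp
    right; right
    rw [Function.update_of_ne (by omega), Function.update_self,
      show A + m + p' = A + p' + m by omega, Function.update_self]
    exact ⟨rfl, rfl, rfl⟩
  · rw [Function.update_of_ne (by omega), Function.update_of_ne (by omega),
      Function.update_of_ne (by omega), Function.update_of_ne (by omega)]
    rcases h p' hp' with ⟨h1, h2⟩ | h1
    · exact Or.inl ⟨h1, fun c v => by simp [h2, hpp]⟩
    · exact Or.inr (Or.inl h1)

section Fill

variable {w : ℕ} [NeZero w] {ω : ℕ → BitVec w} {s : State} {A m N : ℕ}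

theorem Runs.fillInner {C x : ℕ} {pos col : ℕ → ℕ} {body : List Stmt}
    (hN : s.reg 22 = N) (hpos : ∀ e < N, pos e < m)
    (hbody : ∀ e < N, ∀ s', (∀ r ≤ 22, s'.reg r = s.reg r) → s'.reg 23 = e →
      WP ω body s' fun s'' => (∀ r ≤ 23, s''.reg r = s'.reg r) ∧ s''.drawn = s'.drawn ∧
        s''.mem = Function.update (Function.update s'.mem (A + pos e) (col e)) (A + pos e + m) x)
    (hC : blockSize body ≤ C) (W : ℕ → ℕ → ℕ → Prop) (hW : Filled s.mem A m W) :
    Runs ω (WordRAM.forLoop 23 22 (WordRAM.block body)) s (N * (C + 5) + 3) fun s' =>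
      (∀ r ≤ 22, s'.reg r = s.reg r) ∧ s'.drawn = s.drawn ∧
      (∀ y, y < A ∨ A + 2 * m ≤ y → s'.mem y = s.mem y) ∧
      Filled s'.mem A m fun p c v => W p c v ∨ ∃ e < N, p = pos e ∧ c = col e ∧ v = x := by
  apply Runs.forLoop (fun i s' => (∀ r ≤ 22, s'.reg r = s.reg r) ∧ s'.drawn = s.drawn ∧
      (∀ y, y < A ∨ A + 2 * m ≤ y → s'.mem y = s.mem y) ∧
      Filled s'.mem A m fun p c v => W p c v ∨ ∃ e < i, p = pos e ∧ c = col e ∧ v = x)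
    (by omega) (by omega) (by omega) hN
  · refine ⟨fun r hr => State.set_reg_ne _ _ (by omega), rfl, fun _ _ => rfl, ?_⟩
    exact hW.congr (fun _ _ _ => rfl) (by simp)
  · intro i hi s' h23 h22 ⟨hreg, hdr, hout, hfill⟩
    apply Runs.block _ hC
    refine (hbody i hi s' hreg h23).mono ?_
    rintro s'' ⟨hreg', hdr', hmem'⟩
    refine ⟨by rw [hreg' 23 le_rfl, h23], by rw [hreg' 22 (by omega), h22], ?_, ?_, ?_, ?_⟩
    · intro r hr
      rw [State.set_reg_ne _ _ (by omega), hreg' r (by omega), hreg r hr]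
    · rw [State.set_drawn, hdr', hdr]
    · intro y hy
      have := hpos i hi
      rw [State.set_mem, hmem', Function.update_of_ne (by omega), Function.update_of_ne (by omega),
        hout y hy]
    · rw [State.set_mem, hmem']
      refine (hfill.write (hpos i hi) (col i) x).congr (fun _ _ _ => rfl) ?_
      intro p c v
      constructor
      · rintro ((h | ⟨e, he, h⟩) | h)
        · exact Or.inl h
        · exact Or.inr ⟨e, by omega, h⟩
        · exact Or.inr ⟨i, by omega, h⟩
      · rintro (h | ⟨e, he, h⟩)
        · exact Or.inl (Or.inl h)
        · rcases Nat.lt_succ_iff_lt_or_eq.1 he with h' | rfl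
          · exact Or.inl (Or.inr ⟨e, h', h⟩)
          · exact Or.inr h
  · rintro s' - h
    exact h

/-- The code that fills a table: the outer loop runs over the list entries, `outer` computes the entry
and its hash values and sets the bound of the inner loop. -/
def fillFrag (outer inner : List Stmt) : Frag :=
  WordRAM.forLoop 18 0 ((WordRAM.block outer).seq (WordRAM.forLoop 23 22 (WordRAM.block inner)))

/-- `dd` is the number of random words drawn per list entry: one for the sampled first list, none
for the others. -/
theorem Runs.fill {n C₁ C₂ dd : ℕ} {x y z cnt : ℕ → ℕ} {pos col : ℕ → ℕ → ℕ}
    {outer inner : List Stmt} (hn : s.reg 0 = n) (hcnt : ∀ i < n, cnt i ≤ N)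
    (hpos : ∀ i < n, ∀ e < cnt i, pos i e < m)
    (houter : ∀ i < n, ∀ s', (∀ r ≤ 17, s'.reg r = s.reg r) → s'.reg 18 = i →
      s'.drawn = s.drawn + dd * i → (∀ y, y < A ∨ A + 2 * m ≤ y → s'.mem y = s.mem y) →
      WP ω outer s' fun s'' => (∀ r ≤ 18, s''.reg r = s'.reg r) ∧ s''.drawn = s'.drawn + dd ∧
        s''.mem = s'.mem ∧ s''.reg 19 = x i ∧ s''.reg 20 = y i ∧ s''.reg 21 = z i ∧
        s''.reg 22 = cnt i)
    (hinner : ∀ i < n, ∀ e < cnt i, ∀ s', (∀ r ≤ 17, s'.reg r = s.reg r) → s'.reg 19 = x i →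
      s'.reg 20 = y i → s'.reg 21 = z i → s'.reg 23 = e →
      WP ω inner s' fun s'' => (∀ r ≤ 23, s''.reg r = s'.reg r) ∧ s''.drawn = s'.drawn ∧
        s''.mem = Function.update (Function.update s'.mem (A + pos i e) (col i e))
          (A + pos i e + m) (x i))
    (hC₁ : blockSize outer ≤ C₁) (hC₂ : blockSize inner ≤ C₂)
    (hzero : ∀ p < m, s.mem (A + p) = 0) :
    Runs ω (fillFrag outer inner) s (n * (C₁ + (N * (C₂ + 5) + 3) + 5) + 3) fun s' =>
      (∀ r ≤ 17, s'.reg r = s.reg r) ∧ s'.drawn = s.drawn + dd * n ∧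
      (∀ y, y < A ∨ A + 2 * m ≤ y → s'.mem y = s.mem y) ∧
      Filled s'.mem A m fun p c v =>
        ∃ i < n, ∃ e < cnt i, p = pos i e ∧ c = col i e ∧ v = x i := by
  apply Runs.forLoop (fun k s' => (∀ r ≤ 17, s'.reg r = s.reg r) ∧
      s'.drawn = s.drawn + dd * k ∧ (∀ y, y < A ∨ A + 2 * m ≤ y → s'.mem y = s.mem y) ∧
      Filled s'.mem A m fun p c v =>
        ∃ i < k, ∃ e < cnt i, p = pos i e ∧ c = col i e ∧ v = x i)
    (by omega) (by omega) (by omega) hn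
  · refine ⟨fun r hr => State.set_reg_ne _ _ (by omega), by simp, fun _ _ => rfl, ?_⟩
    intro p hp
    exact Or.inl ⟨hzero p hp, by simp⟩
  · intro i hi s' h18 h0 ⟨hreg, hdr, hout, hfill⟩
    refine Runs.seq (R := fun s'' => (∀ r ≤ 18, s''.reg r = s'.reg r) ∧
        s''.drawn = s'.drawn + dd ∧ s''.mem = s'.mem ∧ s''.reg 19 = x i ∧ s''.reg 20 = y i ∧
        s''.reg 21 = z i ∧ s''.reg 22 = cnt i)
      (Runs.block (houter i hi s' hreg h18 hdr hout) hC₁) ?_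
    rintro s₁ ⟨hreg1, hdr1, hmem1, h19, h20, h21, h22⟩
    refine (Runs.fillInner (C := C₂) (x := x i) (pos := pos i) (col := col i) (A := A) (m := m)
      h22 (hpos i hi) ?_ hC₂ _ (by rw [hmem1]; exact hfill)).mono ?_ ?_
    · intro e he s₂ hreg2 h23
      refine hinner i hi e he s₂ ?_ ?_ ?_ ?_ h23
      · intro r hr
        rw [hreg2 r (by omega), hreg1 r (by omega), hreg r hr]
      · rw [hreg2 19 (by omega), h19]
      · rw [hreg2 20 (by omega), h20]
      · rw [hreg2 21 (by omega), h21]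
    · have := Nat.mul_le_mul_right (C₂ + 5) (hcnt i hi)
      omega
    · rintro s₂ ⟨hreg2, hdr2, hout2, hfill2⟩
      refine ⟨?_, ?_, ?_, ?_, ?_, ?_⟩
      · rw [hreg2 18 (by omega), hreg1 18 (by omega), h18]
      · rw [hreg2 0 (by omega), hreg1 0 (by omega), h0]
      · intro r hr
        rw [State.set_reg_ne _ _ (by omega), hreg2 r (by omega), hreg1 r (by omega), hreg r hr]
      · rw [State.set_drawn, hdr2, hdr1, hdr]; ring
      · intro y hy
        rw [State.set_mem, hout2 y hy, hmem1, hout y hy]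
      · rw [State.set_mem]
        refine hfill2.congr (fun _ _ _ => rfl) ?_
        intro p c v
        constructor
        · rintro (⟨j, hj, h⟩ | h)
          · exact ⟨j, by omega, h⟩
          · exact ⟨i, by omega, h⟩
        · rintro ⟨j, hj, h⟩
          rcases Nat.lt_succ_iff_lt_or_eq.1 hj with h' | rfl
          · exact Or.inl ⟨j, h', h⟩
          · exact Or.inr h
  · rintro s' - h
    exact h

end Fill

/-! ### Sizes, hash functions and the three colour tables. -/

/-- The sizes that the reduction works with on words of length `w`: `n` is the length of the 3SUM lists,
`S = 2 ^ l2` and `Q = 2 ^ l1` are the ranges of the two hash functions, `m = 2 ^ mu` is the length of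
the convolution instances and `w'` is the word length of the convolution program. -/
structure Dim (w : ℕ) where
  (n lam S Q mu m Z l1 l2 w' : ℕ)
  hS : S = 2 ^ l2
  hQ : Q = 2 ^ l1
  hm : m = 2 ^ mu
  hZ : Z = 2 ^ w'
  one_le_l2 : 1 ≤ l2
  l1_le : l1 ≤ w
  l2_le : l2 ≤ w
  -- The largest position is below 2Q + 8S, from two hash values or one hash value with wraparound,
  -- plus the shifts of the copies. The next field makes this less than 4Q.
  hmQ : m = 4 * Q
  hSQ : 16 * S ≤ Q
  -- Colours are pairs in base S, shifted by 2 to avoid the values 0 and 1. This bound makes them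
  -- legal entries for exponent 1.
  hSS : S * S + 2 ≤ m
  -- One block of `Z` cells holds three tables, each with `m` colours and `m` values.
  hmZ : 6 * m ≤ Z
  hnZ : 3 * n ≤ Z
  lam_le : lam ≤ w
  -- There is one block for the input, and on each of the `lam` levels one block for the tables and
  -- `mu` for the calls.
  total_lt : (lam * (mu + 1) + 1) * Z < 2 ^ w

/-- The top bits of the product `a * x`, as an almost linear hash function. -/
def mulHash (w sh a x : ℕ) : ℕ := (a * x % 2 ^ w) >>> sh

theorem mulHash_lt {w l : ℕ} (h : l ≤ w) (a x : ℕ) : mulHash w (w - l) a x < 2 ^ l := by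
  unfold mulHash
  rw [Nat.shiftRight_eq_div_pow, Nat.div_lt_iff_lt_mul (by positivity), ← pow_add,
    show l + (w - l) = w by omega]
  exact Nat.mod_lt _ (by positivity)

namespace Dim

variable {w : ℕ} (D : Dim w)

theorem two_le_S : 2 ≤ D.S := by
  rw [D.hS]
  calc 2 = 2 ^ 1 := rfl
    _ ≤ _ := Nat.pow_le_pow_right (by norm_num) D.one_le_l2

/-- The hash function for positions. -/
def q1 (a x : ℕ) : ℕ := mulHash w (w - D.l1) a x

/-- The hash function for colours. -/
def q2 (a x : ℕ) : ℕ := mulHash w (w - D.l2) a x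

theorem q1_lt (a x : ℕ) : D.q1 a x < D.Q := by rw [D.hQ]; exact mulHash_lt D.l1_le a x
theorem q2_lt (a x : ℕ) : D.q2 a x < D.S := by rw [D.hS]; exact mulHash_lt D.l2_le a x

/-- The variables that are constant in the main loop. -/
structure Consts (s : State) : Prop where
  r0 : s.reg 0 = D.n
  r1 : s.reg 1 = D.lam
  r2 : s.reg 2 = w
  r3 : s.reg 3 = D.S
  r4 : s.reg 4 = D.Q
  r5 : s.reg 5 = D.mu
  r6 : s.reg 6 = D.m
  r7 : s.reg 7 = D.Z
  r8 : s.reg 8 = D.Z - 1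
  r9 : s.reg 9 = w - D.l1
  r10 : s.reg 10 = w - D.l2
  r11 : s.reg 11 = 8 * D.S

variable {D}

theorem Consts.congr {s s' : State} (h : D.Consts s) (hr : ∀ r ≤ 11, s'.reg r = s.reg r) :
    D.Consts s' := by
  constructor <;> rw [hr _ (by omega)]
  exacts [h.r0, h.r1, h.r2, h.r3, h.r4, h.r5, h.r6, h.r7, h.r8, h.r9, h.r10, h.r11]

variable (D)

/-! #### The three tables -/

/-- The code that fills the table for the first list. -/
def fillA : Frag :=
  fillFrag
    [.draw 22,
     -- The entry gets `S` copies if the top κ bits of its random word vanish, and none otherwise;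
     -- this is sampling at rate 2^(-κ).
     .set 22 (var 3 * ((var 22 >>> (var 2 - var 12)).lt (lit 1))),
     .set 19 (ld (var 18)),
     .set 20 ((var 15 * var 19) >>> var 9),
     .set 21 ((var 16 * var 19) >>> var 10)]
    [.set 24 (var 17 + (var 20 + (lit 2 * var 23 + lit 1))),
     .put (var 24) (var 21 * var 3 + (var 23 + lit 2)),
     .put (var 24 + var 6) (var 19)]

/-- The code that fills the table for the second list. -/
def fillB : Frag :=
  fillFrag
    [.set 22 (var 3),
     .set 19 (ld (var 0 + var 18)),
     .set 20 ((var 15 * var 19) >>> var 9),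
     .set 21 ((var 16 * var 19) >>> var 10)]
    [.set 24 ((var 17 + lit 2 * var 6) + (var 20 + lit 6 * var 23)),
     .put (var 24) (var 23 * var 3 + (var 21 + lit 2)),
     .put (var 24 + var 6) (var 19)]

/-- The code that fills the table for the third list. -/
def fillC : Frag :=
  fillFrag
    [.set 22 (var 11),
     .set 19 (ld (lit 2 * var 0 + var 18)),
     .set 20 ((var 15 * var 19) >>> var 9),
     .set 21 ((var 16 * var 19) >>> var 10)]
    -- The copy number encodes the guess: e = 8α + 4c₂ + 2r₁ + c₁, where c₂ and c₁ are the carries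
    -- of `q2` and `q1` and r₁ is the wraparound of `q1`.
    [.set 25 (var 23 >>> lit 3),
     .set 26 ((var 21 - var 25 - ((var 23 >>> lit 2) &&& lit 1)) &&& (var 3 - lit 1)),
     .set 24 ((var 17 + lit 4 * var 6) + ((var 20 + ((var 23 >>> lit 1) &&& lit 1) * var 4 +
       lit 2 * (var 26 + lit 3 * var 25) + lit 1) - (var 23 &&& lit 1))),
     .put (var 24) (var 25 * var 3 + (var 26 + lit 2)),
     .put (var 24 + var 6) (var 19)]

/-- The second colour component of the `e`-th copy of an entry of the third list. -/
def beta (q e : ℕ) : ℕ := (q + 2 * D.S - e / 8 - e / 4 % 2) % D.S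

/-- The position of the `e`-th copy of an entry of the third list. -/
def posC (p q e : ℕ) : ℕ :=
  p + e / 2 % 2 * D.Q + 2 * (D.beta q e + 3 * (e / 8)) + 1 - e % 2

theorem beta_lt (q e : ℕ) : D.beta q e < D.S := Nat.mod_lt _ (by have := D.two_le_S; omega)

theorem posC_lt {p q e : ℕ} (hp : p < D.Q) (he : e < 8 * D.S) : D.posC p q e < D.m := by
  have h1 := D.beta_lt q e
  have h2 := D.hSQ
  have h3 := D.hmQ
  have h4 : e / 2 % 2 * D.Q ≤ 1 * D.Q := Nat.mul_le_mul_right _ (by omega)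
  unfold posC
  omega

variable {In : ℕ → ℕ} {ω : ℕ → BitVec w} {s : State} {κ arr a₁ a₂ : ℕ}

/-- The situation after the allocation of the tables of a level. -/
structure Level (In : ℕ → ℕ) (κ arr a₁ a₂ : ℕ) (s : State) : Prop where
  consts : D.Consts s
  r12 : s.reg 12 = κ
  hκ : κ < D.lam
  r15 : s.reg 15 = a₁
  r16 : s.reg 16 = a₂
  r17 : s.reg 17 = arr
  input : ∀ y < 3 * D.n, s.mem y = In y
  le_arr : D.Z ≤ arr
  arr_lt : arr + (D.mu + 1) * D.Z < 2 ^ w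

variable {D}

theorem Level.congr {s' : State} (h : D.Level In κ arr a₁ a₂ s)
    (hr : ∀ r ≤ 17, s'.reg r = s.reg r) (hm : ∀ y < 3 * D.n, s'.mem y = s.mem y) :
    D.Level In κ arr a₁ a₂ s' where
  consts := h.consts.congr fun r h => hr r (by omega)
  r12 := by rw [hr _ (by omega), h.r12]
  hκ := h.hκ
  r15 := by rw [hr _ (by omega), h.r15]
  r16 := by rw [hr _ (by omega), h.r16]
  r17 := by rw [hr _ (by omega), h.r17]
  input y hy := by rw [hm y hy, h.input y hy]
  le_arr := h.le_arr
  arr_lt := h.arr_lt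

theorem Level.Z_le (h : D.Level In κ arr a₁ a₂ s) : arr + D.Z ≤ 2 ^ w := by
  have h1 := h.arr_lt
  have h2 := Nat.mul_le_mul_right D.Z (show 1 ≤ D.mu + 1 by omega)
  omega

/-- The indices of the first list that are used. -/
def survives (w κ : ℕ) (ρ : ℕ → ℕ) (i : ℕ) : Prop := ρ i >>> (w - κ) = 0

instance (w κ : ℕ) (ρ : ℕ → ℕ) (i : ℕ) : Decidable (survives w κ ρ i) :=
  inferInstanceAs (Decidable (_ = _))

theorem Level.fillA [NeZero w] (h : D.Level In κ arr a₁ a₂ s)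
    (hzero : ∀ y, arr ≤ y → s.mem y = 0) :
    Runs ω fillA s (D.n * (D.S * 100 + 100) + 3) fun s' =>
      (∀ r ≤ 17, s'.reg r = s.reg r) ∧ s'.drawn = s.drawn + D.n ∧
      (∀ y, y < arr ∨ arr + 2 * D.m ≤ y → s'.mem y = s.mem y) ∧
      Filled s'.mem arr D.m fun p c v => ∃ i < D.n,
        ∃ e < if survives w κ (fun j => (ω (s.drawn + j)).toNat) i then D.S else 0,
        p = D.q1 a₁ (In i) + (2 * e + 1) ∧ c = D.q2 a₂ (In i) * D.S + (e + 2) ∧ v = In i := by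
  have hZ := h.Z_le
  have hle := h.le_arr
  have h6 := D.hmZ
  have hn := D.hnZ
  have hSQ := D.hSQ
  have hmQ := D.hmQ
  have hSS := D.hSS
  have hS2 := D.two_le_S
  have hww : w < 2 ^ w := Nat.lt_two_pow_self
  have hlit : ∀ x ≤ 8, x % 2 ^ w = x := fun x hx => Nat.mod_eq_of_lt (by omega)
  refine (Runs.fill (ω := ω) (s := s) (A := arr) (m := D.m) (N := D.S) (n := D.n) (C₁ := 90)
    (C₂ := 90) (dd := 1)
    (x := In) (y := fun i => D.q1 a₁ (In i)) (z := fun i => D.q2 a₂ (In i))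
    (cnt := fun i => if survives w κ (fun j => (ω (s.drawn + j)).toNat) i then D.S else 0)
    (pos := fun i e => D.q1 a₁ (In i) + (2 * e + 1))
    (col := fun i e => D.q2 a₂ (In i) * D.S + (e + 2))
    h.consts.r0 (fun i _ => by split_ifs <;> omega) ?_ ?_ ?_ (by decide) (by decide)
    (fun p hp => hzero _ (by omega))).mono ?_ ?_
  · intro i _ e he
    have := D.q1_lt a₁ (In i)
    have : e < D.S := lt_of_lt_of_le he (by split_ifs <;> omega)
    omega
  · intro i hi s' hreg h18 hdr hmem
    have hL := h.congr hreg fun y hy => hmem y (by omega)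
    apply WP.draw (by decide)
    apply WP.set (if survives w κ (fun j => (ω (s.drawn + j)).toNat) i then D.S else 0) (by decide)
    · have hκ := h.hκ
      have hl := D.lam_le
      simp only [eval_mul, eval_var, eval_lt, eval_shr, eval_sub, eval_lit, State.draw_reg,
        State.set_reg_self, State.set_reg_ne _ _ (show 3 ≠ 22 by omega),
        State.set_reg_ne _ _ (show 2 ≠ 22 by omega), State.set_reg_ne _ _ (show 12 ≠ 22 by omega),
        hL.consts.r3, hL.consts.r2, hL.r12, hlit 1 (by omega), Nat.lt_one_iff, hdr,
        one_mul]
      rw [show 2 ^ w - κ + w = (w - κ) + 2 ^ w by omega, Nat.add_mod_right,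
        Nat.mod_eq_of_lt (show w - κ < 2 ^ w by omega)]
      by_cases hs : survives w κ (fun j => (ω (s.drawn + j)).toNat) i
      · rw [if_pos hs, if_pos (show (ω (s.drawn + i)).toNat >>> (w - κ) = 0 from hs), mul_one, Nat.mod_eq_of_lt (by omega)]
      · rw [if_neg hs, if_neg (show ¬ (ω (s.drawn + i)).toNat >>> (w - κ) = 0 from hs), mul_zero,
          Nat.zero_mod]
    apply WP.set (In i) (by decide)
    · simp only [eval_ld, eval_var, State.draw_reg, State.set_mem, State.draw_mem,
        State.set_reg_ne _ _ (show 18 ≠ 22 by omega), h18]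
      exact hL.input i (by omega)
    apply WP.set (D.q1 a₁ (In i)) (by decide)
    · simp [hL.r15, hL.consts.r9, q1, mulHash]
    apply WP.set (D.q2 a₂ (In i)) (by decide)
    · simp [hL.r16, hL.consts.r10, q2, mulHash]
    refine ⟨?_, ?_, ?_, ?_, ?_, ?_, ?_⟩
    · intro r hr
      simp [show r ≠ 22 by omega, show r ≠ 19 by omega, show r ≠ 20 by omega,
        show r ≠ 21 by omega]
    all_goals simp
  · intro i hi e he s' hreg h19 h20 h21 h23
    have he' : e < D.S := lt_of_lt_of_le he (by split_ifs <;> omega)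
    have hc := h.consts.congr fun r hr => hreg r (by omega)
    have h17 : s'.reg 17 = arr := by rw [hreg 17 (by omega), h.r17]
    have hq1 := D.q1_lt a₁ (In i)
    have hq2 := D.q2_lt a₂ (In i)
    have hmul := Nat.mul_le_mul_right D.S (show D.q2 a₂ (In i) + 1 ≤ D.S by omega)
    rw [Nat.succ_mul] at hmul
    apply WP.set (arr + (D.q1 a₁ (In i) + (2 * e + 1))) (by decide)
    · simp only [eval_add, eval_var, eval_mul, eval_lit, Nat.add_mod_mod, Nat.mod_add_mod, h17, h20,
        h23, hlit 2 (by omega)]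
      exact Nat.mod_eq_of_lt (by omega)
    apply WP.put (arr + (D.q1 a₁ (In i) + (2 * e + 1))) (D.q2 a₂ (In i) * D.S + (e + 2)) (by decide)
    · simp
    · simp only [eval_add, eval_var, eval_mul, eval_lit, Nat.add_mod_mod, Nat.mod_add_mod,
        State.set_reg, Nat.reduceEqDiff, reduceIte, h21, h23, hc.r3, hlit 2 (by omega)]
      exact Nat.mod_eq_of_lt (by omega)
    apply WP.put (arr + (D.q1 a₁ (In i) + (2 * e + 1)) + D.m) (In i) (by decide)
    · simp only [eval_add, eval_var, State.set_reg, State.put_reg, hc.r6]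
      exact Nat.mod_eq_of_lt (by simp; omega)
    · simp [h19]
    refine ⟨?_, rfl, rfl⟩
    intro r hr
    simp [show r ≠ 24 by omega]
  · nlinarith
  · rintro s' ⟨h1, h2, h3, h4⟩
    exact ⟨h1, by rw [h2, one_mul], h3, h4⟩

theorem Level.fillB [NeZero w] (h : D.Level In κ arr a₁ a₂ s)
    (hzero : ∀ y, arr + 2 * D.m ≤ y → s.mem y = 0) :
    Runs ω fillB s (D.n * (D.S * 100 + 100) + 3) fun s' =>
      (∀ r ≤ 17, s'.reg r = s.reg r) ∧ s'.drawn = s.drawn ∧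
      (∀ y, y < arr + 2 * D.m ∨ arr + 2 * D.m + 2 * D.m ≤ y → s'.mem y = s.mem y) ∧
      Filled s'.mem (arr + 2 * D.m) D.m fun p c v => ∃ i < D.n, ∃ e < D.S,
        p = D.q1 a₁ (In (D.n + i)) + 6 * e ∧ c = e * D.S + (D.q2 a₂ (In (D.n + i)) + 2) ∧
        v = In (D.n + i) := by
  have hZ := h.Z_le
  have hle := h.le_arr
  have h6 := D.hmZ
  have hn := D.hnZ
  have hSQ := D.hSQ
  have hmQ := D.hmQ
  have hSS := D.hSS
  have hS2 := D.two_le_S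
  have hlit : ∀ x ≤ 8, x % 2 ^ w = x := fun x hx => Nat.mod_eq_of_lt (by omega)
  refine (Runs.fill (ω := ω) (s := s) (A := arr + 2 * D.m) (m := D.m) (N := D.S) (n := D.n)
    (C₁ := 90) (C₂ := 90) (dd := 0)
    (x := fun i => In (D.n + i)) (y := fun i => D.q1 a₁ (In (D.n + i)))
    (z := fun i => D.q2 a₂ (In (D.n + i))) (cnt := fun _ => D.S)
    (pos := fun i e => D.q1 a₁ (In (D.n + i)) + 6 * e)
    (col := fun i e => e * D.S + (D.q2 a₂ (In (D.n + i)) + 2))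
    h.consts.r0 (fun i _ => le_rfl) ?_ ?_ ?_ (by decide) (by decide)
    (fun p hp => hzero _ (by omega))).mono ?_ ?_
  · intro i _ e he
    have := D.q1_lt a₁ (In (D.n + i))
    omega
  · intro i hi s' hreg h18 hdr hmem
    have hL := h.congr hreg fun y hy => hmem y (by omega)
    apply WP.set D.S (by decide)
    · simp [hL.consts.r3]
    apply WP.set (In (D.n + i)) (by decide)
    · simp only [eval_ld, eval_var, eval_add, State.set_mem,
        State.set_reg_ne _ _ (show 18 ≠ 22 by omega), State.set_reg_ne _ _ (show 0 ≠ 22 by omega),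
        h18, hL.consts.r0]
      rw [Nat.mod_eq_of_lt (by omega)]
      exact hL.input _ (by omega)
    apply WP.set (D.q1 a₁ (In (D.n + i))) (by decide)
    · simp [hL.r15, hL.consts.r9, q1, mulHash]
    apply WP.set (D.q2 a₂ (In (D.n + i))) (by decide)
    · simp [hL.r16, hL.consts.r10, q2, mulHash]
    refine ⟨?_, ?_, ?_, ?_, ?_, ?_, ?_⟩
    · intro r hr
      simp [show r ≠ 22 by omega, show r ≠ 19 by omega, show r ≠ 20 by omega,
        show r ≠ 21 by omega]
    all_goals simp
  · intro i hi e he s' hreg h19 h20 h21 h23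
    have hc := h.consts.congr fun r hr => hreg r (by omega)
    have h17 : s'.reg 17 = arr := by rw [hreg 17 (by omega), h.r17]
    have hq1 := D.q1_lt a₁ (In (D.n + i))
    have hq2 := D.q2_lt a₂ (In (D.n + i))
    have hmul := Nat.mul_le_mul_right D.S (show e + 1 ≤ D.S by omega)
    rw [Nat.succ_mul] at hmul
    apply WP.set (arr + 2 * D.m + (D.q1 a₁ (In (D.n + i)) + 6 * e)) (by decide)
    · simp only [eval_add, eval_var, eval_mul, eval_lit, Nat.add_mod_mod, Nat.mod_add_mod, h17, h20,
        h23, hc.r6, hlit 2 (by omega), hlit 6 (by omega)]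
      exact Nat.mod_eq_of_lt (by omega)
    apply WP.put (arr + 2 * D.m + (D.q1 a₁ (In (D.n + i)) + 6 * e))
      (e * D.S + (D.q2 a₂ (In (D.n + i)) + 2)) (by decide)
    · simp
    · simp only [eval_add, eval_var, eval_mul, eval_lit, Nat.add_mod_mod, Nat.mod_add_mod,
        State.set_reg, Nat.reduceEqDiff, reduceIte, h21, h23, hc.r3, hlit 2 (by omega)]
      exact Nat.mod_eq_of_lt (by omega)
    apply WP.put (arr + 2 * D.m + (D.q1 a₁ (In (D.n + i)) + 6 * e) + D.m) (In (D.n + i))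
      (by decide)
    · simp only [eval_add, eval_var, State.set_reg, State.put_reg, hc.r6]
      exact Nat.mod_eq_of_lt (by simp; omega)
    · simp [h19]
    refine ⟨?_, rfl, rfl⟩
    intro r hr
    simp [show r ≠ 24 by omega]
  · nlinarith
  · rintro s' ⟨h1, h2, h3, h4⟩
    exact ⟨h1, by rw [h2, zero_mul, add_zero], h3, h4⟩

/-- S is a power of two dividing `2 ^ w`, so wraparound of the word subtraction is harmless modulo S
and the mask S - 1 reduces modulo S. On the right, `2 * D.S` keeps the truncated subtraction exact.
-/
theorem sub_sub_and_eq (D : Dim w) {q a c : ℕ} (h : a + c ≤ D.S) (hS : D.S < 2 ^ w) :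
    (2 ^ w - c + (2 ^ w - a + q) % 2 ^ w) % 2 ^ w &&& (2 ^ w - 1 + D.S) % 2 ^ w =
      (q + 2 * D.S - a - c) % D.S := by
  have h2 := D.two_le_S
  obtain ⟨K, hK⟩ : D.S ∣ 2 ^ w := by rw [D.hS]; exact pow_dvd_pow 2 D.l2_le
  have e1 : (2 ^ w - 1 + D.S) % 2 ^ w = 2 ^ D.l2 - 1 := by
    rw [← D.hS, show 2 ^ w - 1 + D.S = D.S - 1 + 2 ^ w by omega, Nat.add_mod_right,
      Nat.mod_eq_of_lt (by omega)]
  rw [e1, Nat.and_two_pow_sub_one_eq_mod, Nat.add_mod_mod, ← D.hS,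
    Nat.mod_mod_of_dvd _ ⟨K, hK⟩]
  obtain ⟨K, rfl⟩ : ∃ K', K = K' + 1 := ⟨K - 1, by
    rcases Nat.eq_zero_or_pos K with rfl | h0
    · have : 0 < 2 ^ w := by positivity
      omega
    · omega⟩
  rw [Nat.mul_succ] at hK
  rw [show 2 ^ w - c + (2 ^ w - a + q) = (q + 2 * D.S - a - c) + D.S * (2 * K) by
    rw [Nat.mul_left_comm]; omega, Nat.add_mul_mod_self_left]

theorem Level.fillC [NeZero w] (h : D.Level In κ arr a₁ a₂ s)
    (hzero : ∀ y, arr + 4 * D.m ≤ y → s.mem y = 0) :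
    Runs ω fillC s (D.n * (8 * D.S * 100 + 100) + 3) fun s' =>
      (∀ r ≤ 17, s'.reg r = s.reg r) ∧ s'.drawn = s.drawn ∧
      (∀ y, y < arr + 4 * D.m ∨ arr + 4 * D.m + 2 * D.m ≤ y → s'.mem y = s.mem y) ∧
      Filled s'.mem (arr + 4 * D.m) D.m fun p c v => ∃ i < D.n, ∃ e < 8 * D.S,
        p = D.posC (D.q1 a₁ (In (2 * D.n + i))) (D.q2 a₂ (In (2 * D.n + i))) e ∧
        c = e / 8 * D.S + (D.beta (D.q2 a₂ (In (2 * D.n + i))) e + 2) ∧ v = In (2 * D.n + i) := by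
  have hZ := h.Z_le
  have hle := h.le_arr
  have h6 := D.hmZ
  have hn := D.hnZ
  have hSQ := D.hSQ
  have hmQ := D.hmQ
  have hSS := D.hSS
  have hS2 := D.two_le_S
  have hlit : ∀ x ≤ 8, x % 2 ^ w = x := fun x hx => Nat.mod_eq_of_lt (by omega)
  refine (Runs.fill (ω := ω) (s := s) (A := arr + 4 * D.m) (m := D.m) (N := 8 * D.S) (n := D.n)
    (C₁ := 90) (C₂ := 90) (dd := 0)
    (x := fun i => In (2 * D.n + i)) (y := fun i => D.q1 a₁ (In (2 * D.n + i)))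
    (z := fun i => D.q2 a₂ (In (2 * D.n + i))) (cnt := fun _ => 8 * D.S)
    (pos := fun i e =>
      D.posC (D.q1 a₁ (In (2 * D.n + i))) (D.q2 a₂ (In (2 * D.n + i))) e)
    (col := fun i e => e / 8 * D.S + (D.beta (D.q2 a₂ (In (2 * D.n + i))) e + 2))
    h.consts.r0 (fun i _ => le_rfl) ?_ ?_ ?_ (by decide) (by decide)
    (fun p hp => hzero _ (by omega))).mono ?_ ?_
  · intro i _ e he
    exact D.posC_lt (D.q1_lt _ _) he
  · intro i hi s' hreg h18 hdr hmem
    have hL := h.congr hreg fun y hy => hmem y (by omega)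
    apply WP.set (8 * D.S) (by decide)
    · simp [hL.consts.r11]
    apply WP.set (In (2 * D.n + i)) (by decide)
    · simp only [eval_ld, eval_var, eval_add, eval_mul, eval_lit, State.set_mem,
        State.set_reg_ne _ _ (show 18 ≠ 22 by omega), State.set_reg_ne _ _ (show 0 ≠ 22 by omega),
        h18, hL.consts.r0, hlit 2 (by omega), Nat.mod_add_mod]
      rw [Nat.mod_eq_of_lt (by omega)]
      exact hL.input _ (by omega)
    apply WP.set (D.q1 a₁ (In (2 * D.n + i))) (by decide)
    · simp [hL.r15, hL.consts.r9, q1, mulHash]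
    apply WP.set (D.q2 a₂ (In (2 * D.n + i))) (by decide)
    · simp [hL.r16, hL.consts.r10, q2, mulHash]
    refine ⟨?_, ?_, ?_, ?_, ?_, ?_, ?_⟩
    · intro r hr
      simp [show r ≠ 22 by omega, show r ≠ 19 by omega, show r ≠ 20 by omega,
        show r ≠ 21 by omega]
    all_goals simp
  · intro i hi e he s' hreg h19 h20 h21 h23
    have hc := h.consts.congr fun r hr => hreg r (by omega)
    have h17 : s'.reg 17 = arr := by rw [hreg 17 (by omega), h.r17]
    set p := D.q1 a₁ (In (2 * D.n + i)) with hp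
    set q := D.q2 a₂ (In (2 * D.n + i)) with hq
    have hq1 : p < D.Q := D.q1_lt a₁ (In (2 * D.n + i))
    have hposlt := D.posC_lt (q := q) hq1 he
    have hb := D.beta_lt q e
    have hmul := Nat.mul_le_mul_right D.S (show e / 8 + 1 ≤ D.S by omega)
    rw [Nat.succ_mul] at hmul
    have hand : ∀ k ≤ 8, e >>> k &&& 1 = e / 2 ^ k % 2 := fun k _ => by
      rw [Nat.and_one_is_mod, Nat.shiftRight_eq_div_pow]
    apply WP.set (e / 8) (by decide)
    · simp only [eval_shr, eval_var, eval_lit, h23, hlit 3 (by omega),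
        Nat.shiftRight_eq_div_pow, Nat.reducePow]
    apply WP.set (D.beta q e) (by decide)
    · simp only [eval_shr, eval_var, eval_lit, eval_and, eval_sub, State.set_reg,
        Nat.reduceEqDiff, reduceIte, h21, h23, hc.r3, hlit 2 (by omega), hlit 1 (by omega),
        hand 2 (by omega), Nat.reducePow]
      exact sub_sub_and_eq D (by omega) (by omega)
    apply WP.set (arr + 4 * D.m + D.posC p q e) (by decide)
    · simp only [eval_shr, eval_var, eval_lit, eval_and, eval_sub, eval_add, eval_mul,
        State.set_reg, Nat.reduceEqDiff, reduceIte, h17, h20, h23, hc.r6, hc.r4, hlit 1 (by omega),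
        hlit 2 (by omega), hlit 3 (by omega), hlit 4 (by omega), hand 1 (by omega),
        Nat.and_one_is_mod, pow_one, Nat.add_mod_mod, Nat.mod_add_mod, Nat.mul_mod_mod]
      have hwr : e / 2 % 2 * D.Q ≤ 1 * D.Q := Nat.mul_le_mul_right _ (by omega)
      rw [show arr + 4 * D.m + (2 ^ w - e % 2 + (p + e / 2 % 2 * D.Q +
        2 * (D.beta q e + 3 * (e / 8)) + 1)) = arr + 4 * D.m + D.posC p q e + 2 ^ w by
          unfold posC; omega, Nat.add_mod_right]
      exact Nat.mod_eq_of_lt (by omega)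
    apply WP.put (arr + 4 * D.m + D.posC p q e) (e / 8 * D.S + (D.beta q e + 2)) (by decide)
    · simp
    · simp only [eval_add, eval_var, eval_mul, eval_lit, Nat.add_mod_mod, Nat.mod_add_mod,
        State.set_reg, Nat.reduceEqDiff, reduceIte, hc.r3, hlit 2 (by omega)]
      exact Nat.mod_eq_of_lt (by omega)
    apply WP.put (arr + 4 * D.m + D.posC p q e + D.m) (In (2 * D.n + i)) (by decide)
    · simp only [eval_add, eval_var, State.set_reg, State.put_reg, Nat.reduceEqDiff, reduceIte,
        hc.r6]
      exact Nat.mod_eq_of_lt (by omega)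
    · simp [h19]
    refine ⟨?_, rfl, rfl⟩
    intro r hr
    simp [show r ≠ 24 by omega, show r ≠ 25 by omega, show r ≠ 26 by omega]
  · nlinarith
  · rintro s' ⟨h1, h2, h3, h4⟩
    exact ⟨h1, by rw [h2, zero_mul, add_zero], h3, h4⟩

end Dim

/-! ### Calls of the convolution program. -/

/-- The program `P` solves MonoConvolution in time `T` on instances of length `m` with words of length
`w'`. -/
def Solves (P : Program) (w' m T : ℕ) : Prop :=
  ∀ a b c : Fin m → ℤ, PolyBounded 1 a b c →
    (run P (fun _ => 0) T (init w' a b c)).Halted P ∧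
      ∀ i : Fin m, (run P (fun _ => 0) T (init w' a b c)).mem (BitVec.ofNat w' i) =
        BitVec.ofNat w' (monoConvolution a b c i)

/-- Keep the entries at positions whose `t`-th bit is set. -/
def bitTable (f : ℕ → ℕ) (t j : ℕ) : ℕ := f j * (j / 2 ^ t % 2)

/-- Replace `0` by `1`. -/
def noZero (x : ℕ) : ℕ := if x = 0 then 1 else x

open Classical in
/-- The answer of the convolution at `i`, for the entries of `f` at positions with `t`-th bit set. -/
noncomputable def hit (f g h : ℕ → ℕ) (t i : ℕ) : ℕ :=
  if ∃ j l, j + l = i ∧ bitTable f t j = g l ∧ g l = noZero (h i) then 1 else 0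

theorem hit_le_one (f g h : ℕ → ℕ) (t i : ℕ) : hit f g h t i ≤ 1 := by
  unfold hit; split_ifs <;> omega

/-- From j + l = i < m both indices are automatically in range, so unbounded indices suffice. -/
theorem monoConvolution_eq_hit {m : ℕ} (f g h : ℕ → ℕ) (t : ℕ) (i : Fin m) :
    monoConvolution (fun j : Fin m => (bitTable f t j : ℤ)) (fun j : Fin m => (g j : ℤ))
      (fun j : Fin m => (noZero (h j) : ℤ)) i = hit f g h t i := by
  unfold monoConvolution hit
  congr 1
  apply propext
  constructor
  · rintro ⟨j, l, h1, h2, h3⟩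
    simp only [Nat.cast_inj] at h2 h3
    exact ⟨j, l, h1, h2, h3⟩
  · rintro ⟨j, l, h1, h2, h3⟩
    have hi := i.isLt
    exact ⟨⟨j, by omega⟩, ⟨l, by omega⟩, h1, congrArg Nat.cast h2, congrArg Nat.cast h3⟩

theorem getD_three {m : ℕ} (a b c : Fin m → ℤ) (f g h : ℕ → ℤ) (ha : ∀ i : Fin m, a i = f i)
    (hb : ∀ i : Fin m, b i = g i) (hc : ∀ i : Fin m, c i = h i) (x : ℕ) :
    (List.ofFn a ++ List.ofFn b ++ List.ofFn c).getD x 0 =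
      if x < m then f x else if x < 2 * m then g (x - m) else
        if x < 3 * m then h (x - 2 * m) else 0 := by
  rw [List.getD_eq_getElem?_getD]
  by_cases h1 : x < m
  · rw [List.append_assoc, List.getElem?_append_left (by simpa using h1), if_pos h1]
    simp [h1, ha]
  rw [if_neg h1]
  by_cases h2 : x < 2 * m
  · rw [List.append_assoc, List.getElem?_append_right (by simpa using h1),
      List.getElem?_append_left (by simp; omega), if_pos h2]
    simp [show x - m < m by omega, hb]
  rw [if_neg h2, List.getElem?_append_right (by simp; omega)]
  by_cases h3 : x < 3 * m
  · rw [if_pos h3]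
    have h4 : x - 2 * m < m := by omega
    simp [h4, hc, show m + m = 2 * m by ring]
  · rw [if_neg h3]
    simp [show ¬ x - (m + m) < m by omega]

namespace Dim

variable {w : ℕ} {D : Dim w} {In : ℕ → ℕ} {ω : ℕ → BitVec w} {s : State} {κ arr a₁ a₂ : ℕ}

/-- The code that prepares the memory for a call of the convolution program. -/
def copyLoop : Frag :=
  forLoop 23 6 (block
    [.put (var 13 + var 23) (ld (var 17 + var 23) * ((var 23 >>> var 18) &&& lit 1)),
     .put (var 13 + var 6 + var 23) (ld (var 17 + lit 2 * var 6 + var 23)),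
     .set 24 (ld (var 17 + lit 4 * var 6 + var 23)),
     -- Zeros mark empty or removed positions and would match each other. Turning those of the third
     -- sequence into 1, which is no colour, rules this out.
     .put (var 13 + lit 2 * var 6 + var 23) (var 24 + (var 24).lt (lit 1))])

theorem Level.copyLoop [NeZero w] (h : D.Level In κ arr a₁ a₂ s) {t B : ℕ} (h18 : s.reg 18 = t)
    (h13 : s.reg 13 = B) (hB : arr + D.Z ≤ B) (hB' : B + D.Z ≤ 2 ^ w)
    {f g k : ℕ → ℕ} (hf : ∀ j < D.m, s.mem (arr + j) = f j)
    (hg : ∀ j < D.m, s.mem (arr + 2 * D.m + j) = g j)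
    (hk : ∀ j < D.m, s.mem (arr + 4 * D.m + j) = k j)
    (hfm : ∀ j < D.m, f j ≤ D.m) (hkm : ∀ j < D.m, k j ≤ D.m) :
    Runs ω copyLoop s (D.m * 100 + 3) fun s' => (∀ r ≤ 22, s'.reg r = s.reg r) ∧
      s'.drawn = s.drawn ∧ (∀ y, y < B ∨ B + 3 * D.m ≤ y → s'.mem y = s.mem y) ∧
      ∀ j < D.m, s'.mem (B + j) = bitTable f t j ∧ s'.mem (B + D.m + j) = g j ∧
        s'.mem (B + 2 * D.m + j) = noZero (k j) := by
  have hZ := h.Z_le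
  have hle := h.le_arr
  have h6 := D.hmZ
  have hSQ := D.hSQ
  have hmQ := D.hmQ
  have hS2 := D.two_le_S
  have hlit : ∀ x ≤ 8, x % 2 ^ w = x := fun x hx => Nat.mod_eq_of_lt (by omega)
  refine (Runs.forLoop (ω := ω) (s := s) (B := 90) (fun i s' => (∀ r ≤ 22, s'.reg r = s.reg r) ∧
      s'.drawn = s.drawn ∧ (∀ y, y < B ∨ B + 3 * D.m ≤ y → s'.mem y = s.mem y) ∧
      ∀ j < i, s'.mem (B + j) = bitTable f t j ∧ s'.mem (B + D.m + j) = g j ∧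
        s'.mem (B + 2 * D.m + j) = noZero (k j))
    (by omega) (by omega) (by omega) h.consts.r6 ?_ ?_ ?_).mono (by omega) fun _ h => h
  · exact ⟨fun r hr => State.set_reg_ne _ _ (by omega), rfl, fun _ _ => rfl, by simp⟩
  · rintro i hi s' h23 h6' ⟨hreg, hdr, hout, hin⟩
    have hc := h.consts.congr fun r hr => hreg r (by omega)
    have r13 : s'.reg 13 = B := by rw [hreg 13 (by omega), h13]
    have r17 : s'.reg 17 = arr := by rw [hreg 17 (by omega), h.r17]
    have r18 : s'.reg 18 = t := by rw [hreg 18 (by omega), h18]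
    have hbit : f i * (i / 2 ^ t % 2) ≤ f i * 1 := Nat.mul_le_mul_left _ (by omega)
    have hfi := hfm i hi
    have hki := hkm i hi
    apply Runs.block _ (by decide)
    apply WP.put (B + i) (bitTable f t i) (by decide)
    · simp only [eval_add, eval_var, r13, h23]
      exact Nat.mod_eq_of_lt (by omega)
    · simp only [eval_add, eval_var, eval_mul, eval_ld, eval_and, eval_shr, eval_lit, r17, h23, r18,
        hlit 1 (by omega)]
      rw [Nat.mod_eq_of_lt (show arr + i < 2 ^ w by omega), hout _ (by omega), hf i hi,
        Nat.and_one_is_mod, Nat.shiftRight_eq_div_pow]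
      exact Nat.mod_eq_of_lt (by omega)
    apply WP.put (B + D.m + i) (g i) (by decide)
    · simp only [eval_add, eval_var, State.put_reg, r13, h23, hc.r6, Nat.mod_add_mod]
      exact Nat.mod_eq_of_lt (by omega)
    · simp only [eval_add, eval_var, eval_mul, eval_ld, eval_lit, State.put_reg, r17, h23, hc.r6,
        hlit 2 (by omega), Nat.mod_add_mod, Nat.add_mod_mod]
      rw [Nat.mod_eq_of_lt (show arr + 2 * D.m + i < 2 ^ w by omega),
        State.put_mem_ne _ _ (by omega), hout _ (by omega), hg i hi]
    apply WP.set (k i) (by decide)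
    · simp only [eval_add, eval_var, eval_mul, eval_ld, eval_lit, State.put_reg, r17, h23, hc.r6,
        hlit 4 (by omega), Nat.mod_add_mod, Nat.add_mod_mod]
      rw [Nat.mod_eq_of_lt (show arr + 4 * D.m + i < 2 ^ w by omega),
        State.put_mem_ne _ _ (by omega), State.put_mem_ne _ _ (by omega), hout _ (by omega), hk i hi]
    apply WP.put (B + 2 * D.m + i) (noZero (k i)) (by decide)
    · simp only [eval_add, eval_var, eval_mul, eval_lit, State.put_reg, State.set_reg,
        Nat.reduceEqDiff, reduceIte, r13, h23, hc.r6, hlit 2 (by omega), Nat.mod_add_mod,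
        Nat.add_mod_mod]
      exact Nat.mod_eq_of_lt (by omega)
    · simp only [eval_add, eval_var, eval_lt, eval_lit, State.set_reg_self, hlit 1 (by omega),
        noZero, Nat.lt_one_iff]
      rw [Nat.mod_eq_of_lt (by split_ifs <;> omega)]
      split_ifs <;> omega
    refine ⟨by simpa using h23, by simpa using h6', ?_, ?_, ?_, ?_⟩
    · intro r hr
      simp [show r ≠ 23 by omega, show r ≠ 24 by omega, hreg r hr]
    · simp [hdr]
    · intro y hy
      rw [State.set_mem, State.put_mem_ne _ _ (by omega), State.set_mem,
        State.put_mem_ne _ _ (by omega), State.put_mem_ne _ _ (by omega), hout y hy]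
    · intro j hj
      simp only [State.set_mem, State.put_mem]
      by_cases hji : j = i
      · subst hji
        rw [if_neg (by omega), if_neg (by omega), if_pos rfl, if_neg (by omega), if_pos rfl,
          if_pos rfl]
        exact ⟨rfl, rfl, rfl⟩
      · obtain ⟨e1, e2, e3⟩ := hin j (by omega)
        rw [if_neg (by omega), if_neg (by omega), if_neg (by omega), if_neg (by omega),
          if_neg (by omega), if_neg (by omega), if_neg (by omega), if_neg (by omega),
          if_neg (by omega)]
        exact ⟨e1, e2, e3⟩
  · rintro s' - h
    exact h

/-- One call of the convolution program. -/
def callStep (P : Program) : Frag :=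
  copyLoop.seq ((callFrag P).seq (block [.set 13 (var 13 + var 7)]))

theorem Level.callStep [NeZero w] (h : D.Level In κ arr a₁ a₂ s) {P : Program} {T t B : ℕ}
    (hdet : P.Deterministic) (hP : Solves P D.w' D.m T) (h18 : s.reg 18 = t)
    (h13 : s.reg 13 = B) (hB : arr + D.Z ≤ B) (hB' : B + D.Z < 2 ^ w)
    {f g k : ℕ → ℕ} (hf : ∀ j < D.m, s.mem (arr + j) = f j)
    (hg : ∀ j < D.m, s.mem (arr + 2 * D.m + j) = g j)
    (hk : ∀ j < D.m, s.mem (arr + 4 * D.m + j) = k j)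
    (hfm : ∀ j < D.m, f j ≤ D.m) (hgm : ∀ j < D.m, g j ≤ D.m) (hkm : ∀ j < D.m, k j ≤ D.m)
    (hzero : ∀ y, B ≤ y → s.mem y = 0) :
    Runs ω (callStep P) s (D.m * 100 + 2 * T + P.regBound + 20) fun s' =>
      (∀ r ≤ 22, r ≠ 13 → s'.reg r = s.reg r) ∧ s'.reg 13 = B + D.Z ∧
      s'.drawn = s.drawn ∧ (∀ y, y < B ∨ B + D.Z ≤ y → s'.mem y = s.mem y) ∧
      ∀ i < D.m, s'.mem (B + i) = hit f g k t i := by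
  have h6 := D.hmZ
  have hmQ := D.hmQ
  have hS2 := D.two_le_S
  have hSQ := D.hSQ
  have hZw := D.hZ
  have hZ1 : 1 < 2 ^ D.w' := by omega
  have hw' : 0 < D.w' := by
    rcases Nat.eq_zero_or_pos D.w' with h0 | h0
    · rw [h0] at hZ1; omega
    · exact h0
  refine (Runs.seq (h.copyLoop (ω := ω) h18 h13 hB hB'.le hf hg hk hfm hkm)
    (B₂ := P.regBound + 1 + 2 * T + 6) ?_).mono (by omega) fun _ h => h
  rintro s₁ ⟨hreg1, hdr1, hout1, hin1⟩
  have hc1 := h.consts.congr fun r hr => hreg1 r (by omega)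
  have hnz : ∀ x ≤ D.m, noZero x ≤ D.m := fun x hx => by unfold noZero; split_ifs <;> omega
  have hbt : ∀ j < D.m, bitTable f t j ≤ D.m := fun j hj =>
    (Nat.mul_le_mul_left (f j) (show j / 2 ^ t % 2 ≤ 1 by omega)).trans (by
      have := hfm j hj; omega)
  obtain ⟨hhalt, hres⟩ := hP (fun j : Fin D.m => (bitTable f t j : ℤ))
    (fun j : Fin D.m => (g j : ℤ)) (fun j : Fin D.m => (noZero (k j) : ℤ)) (by
      intro i
      simp only [pow_one, Nat.abs_cast]
      exact ⟨by exact_mod_cast hbt i i.isLt, by exact_mod_cast hgm i i.isLt,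
        by exact_mod_cast hnz _ (hkm i i.isLt)⟩)
  refine Runs.seq (Runs.call (w' := D.w') (m := D.m) (B := B) (T := T) hw' (by omega)
    (by rw [hreg1 13 (by omega), h13]) (by rw [hc1.r8, hZw]) hc1.r6 (by omega) hdet _ _ _ ?_ hhalt)
    (B₂ := 6) ?_
  · intro x
    have hx := x.isLt
    have hofInt : ∀ v ≤ D.m, (BitVec.ofInt D.w' (v : ℤ)).toNat = v := fun v hv => by
      rw [BitVec.ofInt_natCast, BitVec.toNat_ofNat, Nat.mod_eq_of_lt (by omega)]
    simp only [init]
    rw [getD_three _ _ _ (fun j => (bitTable f t j : ℤ)) (fun j => (g j : ℤ))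
      (fun j => (noZero (k j) : ℤ)) (fun _ => rfl) (fun _ => rfl) (fun _ => rfl)]
    by_cases h1 : x.toNat < D.m
    · rw [if_pos h1, hofInt _ (hbt _ h1), (hin1 _ h1).1]
    rw [if_neg h1]
    by_cases h2 : x.toNat < 2 * D.m
    · have h2' : x.toNat - D.m < D.m := by omega
      rw [if_pos h2, hofInt _ (hgm _ h2'), ← (hin1 _ h2').2.1]
      congr 1; omega
    rw [if_neg h2]
    by_cases h3 : x.toNat < 3 * D.m
    · have h3' : x.toNat - 2 * D.m < D.m := by omega
      rw [if_pos h3, hofInt _ (hnz _ (hkm _ h3')), ← (hin1 _ h3').2.2]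
      congr 1; omega
    -- Behind the three sequences the block has never been written, matching the default 0 of
    -- `init`.
    · rw [if_neg h3, hout1 _ (by omega), hzero _ (by omega)]
      simp
  · rintro s₂ ⟨hreg2, hdr2, hout2, hin2⟩
    apply Runs.block _ (by decide)
    apply WP.set (B + D.Z) (by decide)
    · simp only [eval_add, eval_var, hreg2, hc1.r7, hreg1 13 (by omega), h13]
      exact Nat.mod_eq_of_lt hB'
    refine ⟨?_, by simp, ?_, ?_, ?_⟩
    · intro r hr h13'
      rw [State.set_reg_ne _ _ h13', hreg2, hreg1 r hr]
    · rw [State.set_drawn, hdr2, hdr1]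
    · intro y hy
      rw [State.set_mem, hout2 y (by omega), hout1 y (by omega)]
    · intro i hi
      have hi' : (BitVec.ofNat D.w' i).toNat = i := by
        rw [BitVec.toNat_ofNat, Nat.mod_eq_of_lt (by omega)]
      have e1 := hin2 (BitVec.ofNat D.w' i)
      have e2 := hres ⟨i, hi⟩
      simp only at e2
      rw [hi', e2, monoConvolution_eq_hit f g k t ⟨i, hi⟩, BitVec.toNat_ofNat] at e1
      rw [State.set_mem, e1]
      exact Nat.mod_eq_of_lt (by have := hit_le_one f g k t i; simp only; omega)

/-- The calls of the convolution program, one for each bit. -/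
def callLoop (P : Program) : Frag := forLoop 18 5 (callStep P)

/-- The call for bit t works in block t + 1 after the tables, and its output stays there. The code
therefore never spends steps on clearing the `Z` cells of a block. -/
theorem Level.callLoop [NeZero w] (h : D.Level In κ arr a₁ a₂ s) {P : Program} {T : ℕ}
    (hdet : P.Deterministic) (hP : Solves P D.w' D.m T) (h13 : s.reg 13 = arr + D.Z)
    {f g k : ℕ → ℕ} (hf : ∀ j < D.m, s.mem (arr + j) = f j)
    (hg : ∀ j < D.m, s.mem (arr + 2 * D.m + j) = g j)
    (hk : ∀ j < D.m, s.mem (arr + 4 * D.m + j) = k j)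
    (hfm : ∀ j < D.m, f j ≤ D.m) (hgm : ∀ j < D.m, g j ≤ D.m) (hkm : ∀ j < D.m, k j ≤ D.m)
    (hzero : ∀ y, arr + D.Z ≤ y → s.mem y = 0) :
    Runs ω (callLoop P) s (D.mu * (D.m * 100 + 2 * T + P.regBound + 25) + 3) fun s' =>
      (∀ r ≤ 17, r ≠ 13 → s'.reg r = s.reg r) ∧ s'.reg 13 = arr + (D.mu + 1) * D.Z ∧
      s'.drawn = s.drawn ∧ (∀ y < arr + D.Z, s'.mem y = s.mem y) ∧
      (∀ y, arr + (D.mu + 1) * D.Z ≤ y → s'.mem y = 0) ∧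
      ∀ t < D.mu, ∀ i < D.m, s'.mem (arr + (t + 1) * D.Z + i) = hit f g k t i := by
  have h6 := D.hmZ
  have hle := h.le_arr
  have hn := D.hnZ
  refine Runs.forLoop (ω := ω) (s := s) (fun t s' =>
      (∀ r ≤ 17, r ≠ 13 → s'.reg r = s.reg r) ∧ s'.reg 13 = arr + (t + 1) * D.Z ∧
      s'.drawn = s.drawn ∧ (∀ y < arr + D.Z, s'.mem y = s.mem y) ∧
      (∀ y, arr + (t + 1) * D.Z ≤ y → s'.mem y = 0) ∧
      ∀ t' < t, ∀ i < D.m, s'.mem (arr + (t' + 1) * D.Z + i) = hit f g k t' i)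
    (by omega) (by omega) (by omega) h.consts.r5 ?_ ?_ ?_
  · refine ⟨fun r hr _ => State.set_reg_ne _ _ (by omega), ?_, rfl, fun _ _ => rfl, ?_, by simp⟩
    · simp [h13]
    · intro y hy
      exact hzero y (by omega)
  · rintro t ht s' h18 h5 ⟨hreg, h13', hdr, hlow, hz, hres⟩
    have hL : D.Level In κ arr a₁ a₂ s' := by
      refine ⟨h.consts.congr fun r hr => hreg r (by omega) (by omega), ?_, h.hκ, ?_, ?_, ?_, ?_,
        h.le_arr, h.arr_lt⟩
      · rw [hreg 12 (by omega) (by omega), h.r12]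
      · rw [hreg 15 (by omega) (by omega), h.r15]
      · rw [hreg 16 (by omega) (by omega), h.r16]
      · rw [hreg 17 (by omega) (by omega), h.r17]
      · intro y hy
        rw [hlow y (by omega), h.input y hy]
    have hZt : (t + 1 + 1) * D.Z ≤ (D.mu + 1) * D.Z := Nat.mul_le_mul_right _ (by omega)
    have hZs : (t + 1 + 1) * D.Z = (t + 1) * D.Z + D.Z := Nat.succ_mul _ _
    have hZ1 : 1 * D.Z ≤ (t + 1) * D.Z := Nat.mul_le_mul_right _ (by omega)
    have harr := h.arr_lt
    refine (hL.callStep (ω := ω) hdet hP h18 h13' (by omega) (by omega) (f := f) (g := g) (k := k)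
      ?_ ?_ ?_ hfm hgm hkm hz).mono le_rfl ?_
    · intro j hj
      rw [hlow _ (by omega), hf j hj]
    · intro j hj
      rw [hlow _ (by omega), hg j hj]
    · intro j hj
      rw [hlow _ (by omega), hk j hj]
    · rintro s'' ⟨hreg', h13'', hdr', hout', hres'⟩
      refine ⟨by rw [hreg' 18 (by omega) (by omega), h18], by rw [hreg' 5 (by omega) (by omega), h5],
        ?_, ?_, ?_, ?_, ?_, ?_⟩
      · intro r hr hr13
        rw [State.set_reg_ne _ _ (by omega), hreg' r (by omega) hr13, hreg r hr hr13]
      · rw [State.set_reg_ne _ _ (by omega), h13'', hZs]; omega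
      · rw [State.set_drawn, hdr', hdr]
      · intro y hy
        rw [State.set_mem, hout' y (by omega), hlow y hy]
      · intro y hy
        rw [State.set_mem, hout' y (by omega), hz y (by omega)]
      · intro t' ht' i hi
        rw [State.set_mem]
        rcases Nat.lt_succ_iff_lt_or_eq.1 ht' with h' | rfl
        · have h1 : (t' + 1 + 1) * D.Z ≤ (t + 1) * D.Z := Nat.mul_le_mul_right _ (by omega)
          rw [Nat.succ_mul] at h1
          rw [hout' _ (by omega), hres t' h' i hi]
        · exact hres' i hi
  · rintro s' - h
    exact h

/-! #### Checking the candidates -/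

/-- The number with bits `d 0 i, d 1 i, ...`. -/
def candidate (d : ℕ → ℕ → ℕ) (mu i : ℕ) : ℕ := ∑ t ∈ Finset.range mu, d t i * 2 ^ t

theorem candidate_lt {d : ℕ → ℕ → ℕ} (hd : ∀ t i, d t i ≤ 1) (mu i : ℕ) :
    candidate d mu i < 2 ^ mu := by
  induction mu with
  | zero => simp [candidate]
  | succ mu ih =>
    have h1 : candidate d (mu + 1) i = candidate d mu i + d mu i * 2 ^ mu :=
      Finset.sum_range_succ _ _
    have h2 := Nat.mul_le_mul_right (2 ^ mu) (hd mu i)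
    rw [h1, pow_succ]; omega

/-- The candidate `j` for position `i` belongs to a solution. -/
def Accept (w : ℕ) (f vf g vg k vk : ℕ → ℕ) (j i : ℕ) : Prop :=
  j ≤ i ∧ f j ≠ 0 ∧ f j = g (i - j) ∧ g (i - j) = k i ∧ (vf j + vg (i - j)) % 2 ^ w = vk i

/-- The code that checks the candidate for a position. -/
def checkStep : Frag :=
  (block [.set 24 (lit 0)]).seq ((forLoop 23 5 (block
    [.set 24 (var 24 + (ld (var 17 + (var 23 + lit 1) * var 7 + var 18) <<< var 23))])).seq (block
    [.set 25 (ld (var 17 + var 24)),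
     .set 26 (ld (var 17 + lit 2 * var 6 + (var 18 - var 24))),
     .set 27 (ld (var 17 + lit 4 * var 6 + var 18)),
     .set 28 (ld (var 17 + var 6 + var 24) + ld (var 17 + lit 3 * var 6 + (var 18 - var 24)) -
       ld (var 17 + lit 5 * var 6 + var 18)),
     .set 29 ((((((var 18).lt (var 24)) ||| (var 25).lt (lit 1)) ||| (var 25 ^^^ var 26)) |||
       (var 26 ^^^ var 27)) ||| var 28),
     .set 14 (var 14 ||| (var 29).lt (lit 1))]))

-- Each test is coded as a word that vanishes exactly on success, so the disjunction of these words
-- vanishes exactly if all tests succeed. The answer bit accumulates over all positions.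
open Classical in
theorem Level.checkStep [NeZero w] (h : D.Level In κ arr a₁ a₂ s) {i : ℕ} (hi : i < D.m)
    (h18 : s.reg 18 = i) {d : ℕ → ℕ → ℕ} (hd : ∀ t i, d t i ≤ 1)
    (hres : ∀ t < D.mu, s.mem (arr + (t + 1) * D.Z + i) = d t i) (hans : s.reg 14 ≤ 1) :
    Runs ω checkStep s (D.mu * 30 + 100) fun s' => (∀ r ≤ 22, r ≠ 14 → s'.reg r = s.reg r) ∧
      s'.drawn = s.drawn ∧ s'.mem = s.mem ∧
      s'.reg 14 = if s.reg 14 = 1 ∨ Accept w (fun j => s.mem (arr + j))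
        (fun j => s.mem (arr + D.m + j)) (fun j => s.mem (arr + 2 * D.m + j))
        (fun j => s.mem (arr + 3 * D.m + j)) (fun j => s.mem (arr + 4 * D.m + j))
        (fun j => s.mem (arr + 5 * D.m + j)) (candidate d D.mu i) i then 1 else 0 := by
  have h6 := D.hmZ
  have hle := h.le_arr
  have hZ := h.Z_le
  have hmQ := D.hmQ
  have hS2 := D.two_le_S
  have hSQ := D.hSQ
  have harr := h.arr_lt
  have hlit : ∀ x ≤ 8, x % 2 ^ w = x := fun x hx => Nat.mod_eq_of_lt (by omega)
  have hmuw : D.mu < 2 ^ w := by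
    have : D.mu < 2 ^ D.mu := Nat.lt_two_pow_self
    have := D.hm
    omega
  apply Runs.of_lt
  intro _ hmemlt
  refine (Runs.seq (B₁ := 5) (R := fun s' => (∀ r ≤ 23, s'.reg r = s.reg r) ∧
    s'.reg 24 = 0 ∧ s'.drawn = s.drawn ∧ s'.mem = s.mem) (B₂ := D.mu * 30 + 90) ?_ ?_).mono
    (by omega) fun _ h => h
  · apply Runs.block _ (by decide)
    apply WP.set 0 (by decide)
    · simp
    exact ⟨fun r hr => State.set_reg_ne _ _ (by omega), by simp, rfl, rfl⟩
  rintro s₁ ⟨hreg1, h24, hdr1, hmem1⟩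
  refine (Runs.seq (B₁ := D.mu * (25 + 5) + 3) (R := fun s' => (∀ r ≤ 22, s'.reg r = s.reg r) ∧
    s'.reg 24 = candidate d D.mu i ∧ s'.drawn = s.drawn ∧ s'.mem = s.mem) (B₂ := 80) ?_ ?_).mono
    (by omega) fun _ h => h
  · refine Runs.forLoop (fun t s' => (∀ r ≤ 22, s'.reg r = s.reg r) ∧
      s'.reg 24 = candidate d t i ∧ s'.drawn = s.drawn ∧ s'.mem = s.mem)
      (by omega) (by omega) (by omega) (by rw [hreg1 5 (by omega), h.consts.r5]) ?_ ?_ ?_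
    · refine ⟨fun r hr => ?_, ?_, hdr1, hmem1⟩
      · rw [State.set_reg_ne _ _ (by omega), hreg1 r (by omega)]
      · rw [State.set_reg_ne _ _ (by omega), h24]; simp [candidate]
    · rintro t ht s' h23 h5 ⟨hreg, h24', hdr, hmem⟩
      have hc := h.consts.congr fun r hr => hreg r (by omega)
      have r17 : s'.reg 17 = arr := by rw [hreg 17 (by omega), h.r17]
      have r18 : s'.reg 18 = i := by rw [hreg 18 (by omega), h18]
      have hZt : (t + 1 + 1) * D.Z ≤ (D.mu + 1) * D.Z := Nat.mul_le_mul_right _ (by omega)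
      rw [Nat.succ_mul] at hZt
      have hsucc : candidate d (t + 1) i = candidate d t i + d t i * 2 ^ t :=
        Finset.sum_range_succ _ _
      have hlt := candidate_lt hd (t + 1) i
      have hpow : 2 ^ (t + 1) ≤ D.m := by
        rw [D.hm]; exact Nat.pow_le_pow_right (by omega) ht
      apply Runs.block _ (by decide)
      apply WP.set (candidate d (t + 1) i) (by decide)
      · simp only [eval_add, eval_var, eval_shl, eval_ld, eval_mul, eval_lit, h24', r17, h23, hc.r7,
          r18, hlit 1 (by omega), hmem]
        rw [Nat.mod_eq_of_lt (show t + 1 < 2 ^ w by omega), Nat.mod_add_mod, Nat.add_mod_mod,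
          Nat.mod_eq_of_lt (show (t + 1) * D.Z < 2 ^ w by omega), Nat.mod_eq_of_lt (show arr + (t + 1) * D.Z + i < 2 ^ w by omega),
          hres t ht, Nat.shiftLeft_eq, hsucc]
        exact Nat.mod_eq_of_lt (by omega)
      refine ⟨by simpa using h23, by simpa using h5, fun r hr => ?_, by simp, hdr, hmem⟩
      rw [State.set_reg_ne _ _ (by omega), State.set_reg_ne _ _ (by omega), hreg r hr]
    · rintro s' - h
      exact h
  rintro s₂ ⟨hreg, h24', hdr, hmem⟩
  have hc := h.consts.congr fun r hr => hreg r (by omega)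
  have r17 : s₂.reg 17 = arr := by rw [hreg 17 (by omega), h.r17]
  have r18 : s₂.reg 18 = i := by rw [hreg 18 (by omega), h18]
  have r14 : s₂.reg 14 = s.reg 14 := hreg 14 (by omega)
  have hjlt : candidate d D.mu i < D.m := by rw [D.hm]; exact candidate_lt hd _ _
  set j := candidate d D.mu i with hj
  apply Runs.block _ (by decide)
  apply WP.set _ (by decide) rfl
  apply WP.set _ (by decide) rfl
  apply WP.set _ (by decide) rfl
  apply WP.set _ (by decide) rfl
  apply WP.set _ (by decide) rfl
  apply WP.set (if s.reg 14 = 1 ∨ Accept w (fun j => s.mem (arr + j))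
        (fun j => s.mem (arr + D.m + j)) (fun j => s.mem (arr + 2 * D.m + j))
        (fun j => s.mem (arr + 3 * D.m + j)) (fun j => s.mem (arr + 4 * D.m + j))
        (fun j => s.mem (arr + 5 * D.m + j)) j i then 1 else 0) (by decide)
  · simp only [eval_add, eval_var, eval_ld, eval_mul, eval_lit, eval_or, eval_xor, eval_lt, eval_sub,
      State.set_reg, State.set_mem, Nat.reduceEqDiff, reduceIte, r17, r18, r14, h24', hc.r6, hmem,
      hlit 1 (by omega), hlit 2 (by omega), hlit 3 (by omega), hlit 4 (by omega),
      hlit 5 (by omega), Nat.mod_add_mod, Nat.add_mod_mod, Nat.lt_one_iff, Nat.or_eq_zero_iff,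
      Nat.xor_eq_zero_iff]
    have key : (((((if i < j then 1 else 0) = 0 ∧
        (if s.mem ((arr + j) % 2 ^ w) = 0 then 1 else 0) = 0) ∧
        s.mem ((arr + j) % 2 ^ w) = s.mem ((arr + 2 * D.m + (2 ^ w - j + i)) % 2 ^ w)) ∧
        s.mem ((arr + 2 * D.m + (2 ^ w - j + i)) % 2 ^ w) =
          s.mem ((arr + 4 * D.m + i) % 2 ^ w)) ∧
        (2 ^ w - s.mem ((arr + 5 * D.m + i) % 2 ^ w) + (s.mem ((arr + D.m + j) % 2 ^ w) +
          s.mem ((arr + 3 * D.m + (2 ^ w - j + i)) % 2 ^ w))) % 2 ^ w = 0) ↔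
        Accept w (fun j => s.mem (arr + j))
        (fun j => s.mem (arr + D.m + j)) (fun j => s.mem (arr + 2 * D.m + j))
        (fun j => s.mem (arr + 3 * D.m + j)) (fun j => s.mem (arr + 4 * D.m + j))
        (fun j => s.mem (arr + 5 * D.m + j)) j i := by
      unfold Accept
      -- If j > i, the address for i - j wraps and arbitrary cells are read, but the first test
      -- already rejects.
      by_cases hij : i < j
      · simp [hij]
      rw [Nat.mod_eq_of_lt (show arr + j < 2 ^ w by omega),
        Nat.mod_eq_of_lt (show arr + D.m + j < 2 ^ w by omega),
        Nat.mod_eq_of_lt (show arr + 4 * D.m + i < 2 ^ w by omega),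
        Nat.mod_eq_of_lt (show arr + 5 * D.m + i < 2 ^ w by omega),
        show arr + 2 * D.m + (2 ^ w - j + i) = arr + 2 * D.m + (i - j) + 2 ^ w by omega,
        show arr + 3 * D.m + (2 ^ w - j + i) = arr + 3 * D.m + (i - j) + 2 ^ w by omega,
        Nat.add_mod_right, Nat.add_mod_right,
        Nat.mod_eq_of_lt (show arr + 2 * D.m + (i - j) < 2 ^ w by omega),
        Nat.mod_eq_of_lt (show arr + 3 * D.m + (i - j) < 2 ^ w by omega)]
      have hv := hmemlt (arr + 5 * D.m + i) (by omega)
      -- A word difference vanishes exactly if the sum of the two values is congruent to the third.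
      have hsub : ∀ v < 2 ^ w, ∀ x, (2 ^ w - v + x) % 2 ^ w = 0 ↔ x % 2 ^ w = v := by
        intro v hv x
        have e : (2 ^ w - v + x) % 2 ^ w = 0 ↔ (2 ^ w - v + x) ≡ (2 ^ w - v + v) [MOD 2 ^ w] := by
          rw [Nat.ModEq, Nat.sub_add_cancel hv.le, Nat.mod_self]
        rw [e]
        constructor
        · intro h1
          have := Nat.ModEq.add_left_cancel' _ h1
          rw [Nat.ModEq, Nat.mod_eq_of_lt hv] at this
          exact this
        · intro h1
          apply Nat.ModEq.add_left
          rw [Nat.ModEq, Nat.mod_eq_of_lt hv, h1]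
      rw [hsub _ hv]
      simp only [hij, if_false, true_and, not_lt.1 hij]
      by_cases h0 : s.mem (arr + j) = 0
      · simp [h0]
      · simp [h0, and_assoc]
    simp only [and_assoc] at key ⊢
    rw [if_congr key rfl rfl]
    by_cases hA : Accept w (fun j => s.mem (arr + j))
        (fun j => s.mem (arr + D.m + j)) (fun j => s.mem (arr + 2 * D.m + j))
        (fun j => s.mem (arr + 3 * D.m + j)) (fun j => s.mem (arr + 4 * D.m + j))
        (fun j => s.mem (arr + 5 * D.m + j)) j i
    · simp only [hA, if_true, or_true]
      rcases Nat.le_one_iff_eq_zero_or_eq_one.1 hans with h0 | h0 <;> simp [h0]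
    · simp only [hA, if_false, or_false]
      rcases Nat.le_one_iff_eq_zero_or_eq_one.1 hans with h0 | h0 <;> simp [h0]
  refine ⟨?_, ?_, ?_, ?_⟩
  · intro r hr hr14
    simp [hr14, show r ≠ 25 by omega, show r ≠ 26 by omega, show r ≠ 27 by omega,
      show r ≠ 28 by omega, show r ≠ 29 by omega, hreg r hr]
  · simp [hdr]
  · simp [hmem]
  · simp

end Dim

/-! ### One sampling level, and the loop over all levels. -/

namespace Dim

variable {w : ℕ} (D : Dim w) {In : ℕ → ℕ} {ω : ℕ → BitVec w} {s : State} {κ arr a₁ a₂ : ℕ}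

/-- The entries of the first table: `p` is a position, `c` a colour and `v` a value. -/
def EntryA (In : ℕ → ℕ) (κ a₁ a₂ : ℕ) (ρ : ℕ → ℕ) (p c v : ℕ) : Prop :=
  ∃ i < D.n, ∃ e < if survives w κ ρ i then D.S else 0,
    p = D.q1 a₁ (In i) + (2 * e + 1) ∧ c = D.q2 a₂ (In i) * D.S + (e + 2) ∧ v = In i

/-- The entries of the second table. -/
def EntryB (In : ℕ → ℕ) (a₁ a₂ : ℕ) (p c v : ℕ) : Prop :=
  ∃ i < D.n, ∃ e < D.S, p = D.q1 a₁ (In (D.n + i)) + 6 * e ∧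
    c = e * D.S + (D.q2 a₂ (In (D.n + i)) + 2) ∧ v = In (D.n + i)

/-- The entries of the third table. -/
def EntryC (In : ℕ → ℕ) (a₁ a₂ : ℕ) (p c v : ℕ) : Prop :=
  ∃ i < D.n, ∃ e < 8 * D.S,
    p = D.posC (D.q1 a₁ (In (2 * D.n + i))) (D.q2 a₂ (In (2 * D.n + i))) e ∧
    c = e / 8 * D.S + (D.beta (D.q2 a₂ (In (2 * D.n + i))) e + 2) ∧ v = In (2 * D.n + i)

-- The largest colour is (S - 1)S + (S + 1) = S² + 1, so `hSS` suffices. The two following bounds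
-- are analogous.
variable {D} in
theorem EntryA.le {ρ : ℕ → ℕ} {p c v : ℕ} (h : D.EntryA In κ a₁ a₂ ρ p c v) : c ≤ D.m := by
  obtain ⟨i, -, e, he, -, rfl, -⟩ := h
  have he' : e < D.S := lt_of_lt_of_le he (by split_ifs <;> omega)
  have h1 := D.hSS
  have h2 := D.q2_lt a₂ (In i)
  have h3 := Nat.mul_le_mul_right D.S (show D.q2 a₂ (In i) + 1 ≤ D.S by omega)
  rw [Nat.succ_mul] at h3
  omega

variable {D} in
theorem EntryB.le {p c v : ℕ} (h : D.EntryB In a₁ a₂ p c v) : c ≤ D.m := by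
  obtain ⟨i, -, e, he, -, rfl, -⟩ := h
  have h1 := D.hSS
  have h2 := D.q2_lt a₂ (In (D.n + i))
  have h3 := Nat.mul_le_mul_right D.S (show e + 1 ≤ D.S by omega)
  rw [Nat.succ_mul] at h3
  omega

variable {D} in
theorem EntryC.le {p c v : ℕ} (h : D.EntryC In a₁ a₂ p c v) : c ≤ D.m := by
  obtain ⟨i, -, e, he, -, rfl, -⟩ := h
  have h1 := D.hSS
  have h2 := D.beta_lt (D.q2 a₂ (In (2 * D.n + i))) e
  have h3 := Nat.mul_le_mul_right D.S (show e / 8 + 1 ≤ D.S by omega)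
  rw [Nat.succ_mul] at h3
  omega

/-- The memory `M` holds the three tables of a level at address `arr`. -/
structure Tables (In : ℕ → ℕ) (κ a₁ a₂ : ℕ) (ρ : ℕ → ℕ) (M : ℕ → ℕ) (arr : ℕ) : Prop where
  fillA : Filled M arr D.m (D.EntryA In κ a₁ a₂ ρ)
  fillB : Filled M (arr + 2 * D.m) D.m (D.EntryB In a₁ a₂)
  fillC : Filled M (arr + 4 * D.m) D.m (D.EntryC In a₁ a₂)

/-- The candidate for position `i` belongs to a solution. -/
def AcceptAt (M : ℕ → ℕ) (arr i : ℕ) : Prop :=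
  Accept w (fun j => M (arr + j)) (fun j => M (arr + D.m + j)) (fun j => M (arr + 2 * D.m + j))
    (fun j => M (arr + 3 * D.m + j)) (fun j => M (arr + 4 * D.m + j))
    (fun j => M (arr + 5 * D.m + j)) (candidate (hit (fun j => M (arr + j))
      (fun j => M (arr + 2 * D.m + j)) (fun j => M (arr + 4 * D.m + j))) D.mu i) i

variable {D}

theorem _root_.WordRAM.Filled.le {M : ℕ → ℕ} {A m B : ℕ} {W : ℕ → ℕ → ℕ → Prop}
    (h : Filled M A m W) (hW : ∀ p c v, W p c v → c ≤ B) {p : ℕ} (hp : p < m) : M (A + p) ≤ B := by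
  rcases h p hp with ⟨h1, -⟩ | h1
  · omega
  · exact hW _ _ _ h1

open Classical in
theorem Level.checkLoop [NeZero w] (h : D.Level In κ arr a₁ a₂ s)
    (hres : ∀ t < D.mu, ∀ i < D.m, s.mem (arr + (t + 1) * D.Z + i) =
      hit (fun j => s.mem (arr + j)) (fun j => s.mem (arr + 2 * D.m + j))
        (fun j => s.mem (arr + 4 * D.m + j)) t i) (hans : s.reg 14 ≤ 1) :
    Runs ω (forLoop 18 6 Dim.checkStep) s (D.m * (D.mu * 30 + 105) + 3) fun s' =>
      (∀ r ≤ 17, r ≠ 14 → s'.reg r = s.reg r) ∧ s'.drawn = s.drawn ∧ s'.mem = s.mem ∧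
      s'.reg 14 = if s.reg 14 = 1 ∨ ∃ i < D.m, D.AcceptAt s.mem arr i then 1 else 0 := by
  refine Runs.forLoop (fun k s' => (∀ r ≤ 17, r ≠ 14 → s'.reg r = s.reg r) ∧
      s'.drawn = s.drawn ∧ s'.mem = s.mem ∧
      s'.reg 14 = if s.reg 14 = 1 ∨ ∃ i < k, D.AcceptAt s.mem arr i then 1 else 0)
    (by omega) (by omega) (by omega) h.consts.r6 ?_ ?_ ?_
  · refine ⟨fun r hr _ => State.set_reg_ne _ _ (by omega), rfl, rfl, ?_⟩
    rw [State.set_reg_ne _ _ (by omega)]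
    rcases Nat.le_one_iff_eq_zero_or_eq_one.1 hans with h0 | h0 <;> simp [h0]
  · rintro i hi s' h18 h6 ⟨hreg, hdr, hmem, h14⟩
    have hL : D.Level In κ arr a₁ a₂ s' := by
      refine ⟨h.consts.congr fun r hr => hreg r (by omega) (by omega), ?_, h.hκ, ?_, ?_, ?_, ?_,
        h.le_arr, h.arr_lt⟩
      · rw [hreg 12 (by omega) (by omega), h.r12]
      · rw [hreg 15 (by omega) (by omega), h.r15]
      · rw [hreg 16 (by omega) (by omega), h.r16]
      · rw [hreg 17 (by omega) (by omega), h.r17]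
      · intro y hy
        rw [hmem, h.input y hy]
    refine (hL.checkStep (ω := ω) hi h18 (d := hit (fun j => s.mem (arr + j))
      (fun j => s.mem (arr + 2 * D.m + j)) (fun j => s.mem (arr + 4 * D.m + j)))
      (fun t i => hit_le_one _ _ _ t i) ?_ ?_).mono le_rfl ?_
    · intro t ht
      rw [hmem]; exact hres t ht i hi
    · rw [h14]; split_ifs <;> omega
    · rintro s'' ⟨hreg', hdr', hmem', h14'⟩
      refine ⟨by rw [hreg' 18 (by omega) (by omega), h18],
        by rw [hreg' 6 (by omega) (by omega), h6], ?_, ?_, ?_, ?_⟩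
      · intro r hr hr14
        rw [State.set_reg_ne _ _ (by omega), hreg' r (by omega) hr14, hreg r hr hr14]
      · rw [State.set_drawn, hdr', hdr]
      · rw [State.set_mem, hmem', hmem]
      · rw [State.set_reg_ne _ _ (by omega), h14', hmem]
        have e : (s'.reg 14 = 1 ↔ s.reg 14 = 1 ∨ ∃ i' < i, D.AcceptAt s.mem arr i') := by
          rw [h14]; split_ifs with hc <;> simp [hc]
        apply if_congr _ rfl rfl
        rw [e, or_assoc]
        apply or_congr_right
        constructor
        · rintro (⟨i', h1, h2⟩ | h2)
          · exact ⟨i', by omega, h2⟩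
          · exact ⟨i, by omega, h2⟩
        · rintro ⟨i', h1, h2⟩
          rcases Nat.lt_succ_iff_lt_or_eq.1 h1 with h' | rfl
          · exact Or.inl ⟨i', h', h2⟩
          · exact Or.inr h2
  · rintro s' - h
    exact h

/-- The code of a level. -/
def levelFrag (P : Program) : Frag :=
  (block [.draw 15, .draw 16, .set 17 (var 13), .set 13 (var 13 + var 7)]).seq
    (fillA.seq (fillB.seq (fillC.seq ((callLoop P).seq (forLoop 18 6 checkStep)))))

/-- The situation at the beginning of a level. -/
structure Start (D : Dim w) (In : ℕ → ℕ) (arr d : ℕ) (s : State) : Prop where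
  consts : D.Consts s
  r13 : s.reg 13 = arr
  r14 : s.reg 14 ≤ 1
  input : ∀ y < 3 * D.n, s.mem y = In y
  zero : ∀ y, arr ≤ y → s.mem y = 0
  drawn : s.drawn = d

/-- A bound for the number of steps of a level. -/
def levelTime (D : Dim w) (P : Program) (T : ℕ) : ℕ :=
  D.n * (D.S * 1000 + 300) + D.mu * (D.m * 130 + 2 * T + P.regBound + 25) + D.m * 105 + 50

-- The memory `M` is only known through `Tables`. The correctness argument can thus forget the
-- machine and work with the entries and the random words.
open Classical in
theorem Start.level [NeZero w] {d : ℕ} (h : D.Start In arr d s) {P : Program} {T : ℕ}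
    (hdet : P.Deterministic) (hP : Solves P D.w' D.m T) (h12 : s.reg 12 = κ) (hκ : κ < D.lam)
    (hle : D.Z ≤ arr) (hlt : arr + (D.mu + 1) * D.Z < 2 ^ w) :
    Runs ω (levelFrag P) s (D.levelTime P T) fun s' =>
      D.Start In (arr + (D.mu + 1) * D.Z) (d + (D.n + 2)) s' ∧ s'.reg 12 = κ ∧
      ∃ M, D.Tables In κ (ω d).toNat (ω (d + 1)).toNat (fun j => (ω (d + 2 + j)).toNat) M arr ∧
        s'.reg 14 = if s.reg 14 = 1 ∨ ∃ i < D.m, D.AcceptAt M arr i then 1 else 0 := by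
  have h6 := D.hmZ
  have hn := D.hnZ
  have hZZ := Nat.mul_le_mul_right D.Z (show 1 ≤ D.mu + 1 by omega)
  rw [one_mul] at hZZ
  have hlevel : D.n * (D.S * 1000 + 300) = D.n * (D.S * 100 + 100) + D.n * (D.S * 100 + 100) +
    D.n * (8 * D.S * 100 + 100) := by ring
  have hcheck : D.mu * (D.m * 130 + 2 * T + P.regBound + 25) + D.m * 105 =
    D.mu * (D.m * 100 + 2 * T + P.regBound + 25) + D.m * (D.mu * 30 + 105) := by ring
  have hltime : D.levelTime P T = 30 + ((D.n * (D.S * 100 + 100) + 3) +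
      ((D.n * (D.S * 100 + 100) + 3) + ((D.n * (8 * D.S * 100 + 100) + 3) +
      ((D.mu * (D.m * 100 + 2 * T + P.regBound + 25) + 3) +
      (D.m * (D.mu * 30 + 105) + 8))))) := by
    rw [levelTime, hlevel]; linarith [hcheck]
  rw [hltime]
  refine Runs.seq (B₁ := 30) (R := fun s' => D.Level In κ arr (ω d).toNat (ω (d + 1)).toNat s' ∧
    s'.reg 13 = arr + D.Z ∧ s'.reg 14 = s.reg 14 ∧ s'.drawn = d + 2 ∧ s'.mem = s.mem) ?_ ?_
  · apply Runs.block _ (by decide)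
    apply WP.draw (by decide)
    apply WP.draw (by decide)
    apply WP.set arr (by decide)
    · simp [h.r13]
    apply WP.set (arr + D.Z) (by decide)
    · simp only [eval_add, eval_var, State.set_reg, State.draw_reg, Nat.reduceEqDiff, reduceIte,
        h.r13, h.consts.r7]
      exact Nat.mod_eq_of_lt (by omega)
    refine ⟨⟨h.consts.congr ?_, ?_, hκ, ?_, ?_, ?_, h.input, hle, hlt⟩, ?_, ?_, ?_, rfl⟩
    · intro r hr
      simp [show r ≠ 15 by omega, show r ≠ 16 by omega, show r ≠ 17 by omega,
        show r ≠ 13 by omega]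
    · simp [h12]
    · simp [h.drawn]
    · simp [h.drawn]
    · simp
    · simp
    · simp
    · simp [h.drawn]
  rintro s₁ ⟨hL1, r13, r14, dr1, mem1⟩
  have hz1 : ∀ y, arr ≤ y → s₁.mem y = 0 := fun y hy => by rw [mem1]; exact h.zero y hy
  refine Runs.seq (hL1.fillA (ω := ω) hz1) ?_
  rintro s₂ ⟨reg2, dr2, mem2, fill2⟩
  have hL2 := hL1.congr reg2 fun y hy => mem2 y (by omega)
  refine Runs.seq (hL2.fillB (ω := ω) fun y hy => by rw [mem2 y (by omega), hz1 y (by omega)]) ?_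
  rintro s₃ ⟨reg3, dr3, mem3, fill3⟩
  have hL3 := hL2.congr reg3 fun y hy => mem3 y (by omega)
  refine Runs.seq (hL3.fillC (ω := ω) fun y hy => by
    rw [mem3 y (by omega), mem2 y (by omega), hz1 y (by omega)]) ?_
  rintro s₄ ⟨reg4, dr4, mem4, fill4⟩
  have hL4 := hL3.congr reg4 fun y hy => mem4 y (by omega)
  have htab : D.Tables In κ (ω d).toNat (ω (d + 1)).toNat (fun j => (ω (d + 2 + j)).toNat)
      s₄.mem arr := by
    refine ⟨fill2.congr ?_ ?_, fill3.congr ?_ fun _ _ _ => Iff.rfl, fill4⟩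
    · intro y h1 h2
      rw [mem4 y (by omega), mem3 y (by omega)]
    · intro p c v
      rw [dr1]; rfl
    · intro y h1 h2
      rw [mem4 y (by omega)]
  have hz4 : ∀ y, arr + D.Z ≤ y → s₄.mem y = 0 := fun y hy => by
    rw [mem4 y (by omega), mem3 y (by omega), mem2 y (by omega), hz1 y (by omega)]
  refine Runs.seq (hL4.callLoop (ω := ω) hdet hP
    (by rw [reg4 13 (by omega), reg3 13 (by omega), reg2 13 (by omega), r13])
    (f := fun j => s₄.mem (arr + j)) (g := fun j => s₄.mem (arr + 2 * D.m + j))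
    (k := fun j => s₄.mem (arr + 4 * D.m + j)) (fun _ _ => rfl) (fun _ _ => rfl) (fun _ _ => rfl)
    (fun j hj => htab.fillA.le (fun _ _ _ h => h.le) hj)
    (fun j hj => htab.fillB.le (fun _ _ _ h => h.le) hj)
    (fun j hj => htab.fillC.le (fun _ _ _ h => h.le) hj) hz4) ?_
  rintro s₅ ⟨reg5, r13', dr5, mem5, zero5, res5⟩
  have hL5 : D.Level In κ arr (ω d).toNat (ω (d + 1)).toNat s₅ := by
    refine ⟨hL4.consts.congr fun r hr => reg5 r (by omega) (by omega), ?_, hκ, ?_, ?_, ?_, ?_,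
      hle, hlt⟩
    · rw [reg5 12 (by omega) (by omega), hL4.r12]
    · rw [reg5 15 (by omega) (by omega), hL4.r15]
    · rw [reg5 16 (by omega) (by omega), hL4.r16]
    · rw [reg5 17 (by omega) (by omega), hL4.r17]
    · intro y hy
      rw [mem5 y (by omega), hL4.input y hy]
  have htab5 : D.Tables In κ (ω d).toNat (ω (d + 1)).toNat (fun j => (ω (d + 2 + j)).toNat)
      s₅.mem arr :=
    ⟨htab.fillA.congr (fun y _ _ => mem5 y (by omega)) fun _ _ _ => Iff.rfl,
      htab.fillB.congr (fun y _ _ => mem5 y (by omega)) fun _ _ _ => Iff.rfl,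
      htab.fillC.congr (fun y _ _ => mem5 y (by omega)) fun _ _ _ => Iff.rfl⟩
  have h14 : s₅.reg 14 = s.reg 14 := by
    rw [reg5 14 (by omega) (by omega), reg4 14 (by omega), reg3 14 (by omega),
      reg2 14 (by omega), r14]
  refine (hL5.checkLoop (ω := ω) ?_ (by rw [h14]; exact h.r14)).mono (by omega) ?_
  · intro t ht i hi
    rw [res5 t ht i hi]
    have e : ∀ j ≤ i, s₅.mem (arr + j) = s₄.mem (arr + j) ∧
        s₅.mem (arr + 2 * D.m + j) = s₄.mem (arr + 2 * D.m + j) ∧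
        s₅.mem (arr + 4 * D.m + j) = s₄.mem (arr + 4 * D.m + j) := fun j hj =>
      ⟨mem5 _ (by omega), mem5 _ (by omega), mem5 _ (by omega)⟩
    unfold hit bitTable
    apply if_congr _ rfl rfl
    constructor
    · rintro ⟨j, l, h1, h2, h3⟩
      refine ⟨j, l, h1, ?_, ?_⟩
      · simpa only [(e j (by omega)).1, (e l (by omega)).2.1] using h2
      · simpa only [(e i (by omega)).2.2, (e l (by omega)).2.1] using h3
    · rintro ⟨j, l, h1, h2, h3⟩
      refine ⟨j, l, h1, ?_, ?_⟩
      · simpa only [(e j (by omega)).1, (e l (by omega)).2.1] using h2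
      · simpa only [(e i (by omega)).2.2, (e l (by omega)).2.1] using h3
  · rintro s₆ ⟨reg6, dr6, mem6, r14'⟩
    refine ⟨⟨hL5.consts.congr fun r hr => reg6 r (by omega) (by omega), ?_, ?_, ?_, ?_, ?_⟩, ?_,
      s₅.mem, htab5, ?_⟩
    · rw [reg6 13 (by omega) (by omega), r13']
    · rw [r14']; split_ifs <;> omega
    · intro y hy
      rw [mem6, hL5.input y hy]
    · intro y hy
      rw [mem6, zero5 y hy]
    · rw [dr6, dr5, dr4, dr3, dr2, dr1]; omega
    · rw [reg6 12 (by omega) (by omega), hL5.r12]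
    · rw [r14', h14]

/-- The main loop over the sampling rates. -/
def mainLoop (P : Program) : Frag := forLoop 12 1 (levelFrag P)

/-- `Yes` must follow from an acceptance whatever the random words are, while `Good κ` is a property
of the words drawn on level κ that forces one. Hence one good level is enough. -/
theorem Start.mainLoop [NeZero w] (h : D.Start In D.Z 0 s) (h14 : s.reg 14 = 0) {P : Program}
    {T : ℕ} (hdet : P.Deterministic) (hP : Solves P D.w' D.m T) {Yes : Prop} {Good : ℕ → Prop}
    (hsound : ∀ κ < D.lam, ∀ a₁ a₂ ρ M arr, D.Tables In κ a₁ a₂ ρ M arr →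
      (∃ i < D.m, D.AcceptAt M arr i) → Yes)
    (hgood : ∀ κ < D.lam, Good κ → ∀ M arr, D.Tables In κ (ω (κ * (D.n + 2))).toNat
      (ω (κ * (D.n + 2) + 1)).toNat (fun j => (ω (κ * (D.n + 2) + 2 + j)).toNat) M arr →
      ∃ i < D.m, D.AcceptAt M arr i) :
    Runs ω (mainLoop P) s (D.lam * (D.levelTime P T + 5) + 3) fun s' =>
      s'.reg 14 ≤ 1 ∧ (s'.reg 14 = 1 → Yes) ∧ ((∃ κ < D.lam, Good κ) → s'.reg 14 = 1) := by
  refine Runs.forLoop (fun k s' => D.Start In ((k * (D.mu + 1) + 1) * D.Z) (k * (D.n + 2)) s' ∧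
      (s'.reg 14 = 1 → Yes) ∧ ((∃ κ < k, Good κ) → s'.reg 14 = 1))
    (by omega) (by omega) (by omega) h.consts.r1 ?_ ?_ ?_
  · refine ⟨⟨h.consts.congr fun r hr => State.set_reg_ne _ _ (by omega), ?_, ?_, h.input, ?_, ?_⟩,
      ?_, by simp⟩
    · simp [h.r13]
    · simp [h14]
    · simpa using h.zero
    · simp [h.drawn]
    · simp [h14]
  · rintro κ hκ s' h12 h1 ⟨hst, hyes, hg⟩
    have hZle : D.Z ≤ (κ * (D.mu + 1) + 1) * D.Z := Nat.le_mul_of_pos_left _ (by omega)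
    have hnext : (κ * (D.mu + 1) + 1) * D.Z + (D.mu + 1) * D.Z =
        ((κ + 1) * (D.mu + 1) + 1) * D.Z := by ring
    have hlt : ((κ + 1) * (D.mu + 1) + 1) * D.Z < 2 ^ w := by
      refine lt_of_le_of_lt (Nat.mul_le_mul_right _ ?_) D.total_lt
      exact Nat.succ_le_succ (Nat.mul_le_mul_right _ hκ)
    refine (hst.level (ω := ω) hdet hP h12 hκ hZle (by rw [hnext]; exact hlt)).mono le_rfl ?_
    rintro s'' ⟨hst', h12', M, htab, h14'⟩
    refine ⟨h12', hst'.consts.r1, ⟨hst'.consts.congr fun r hr => State.set_reg_ne _ _ (by omega),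
      ?_, ?_, hst'.input, ?_, ?_⟩, ?_, ?_⟩
    · rw [State.set_reg_ne _ _ (by omega), hst'.r13, hnext]
    · rw [State.set_reg_ne _ _ (by omega)]; exact hst'.r14
    · rw [← hnext]; exact hst'.zero
    · rw [State.set_drawn, hst'.drawn]; ring
    · rw [State.set_reg_ne _ _ (by omega), h14']
      split_ifs with hc
      · intro _
        rcases hc with hc | hc
        · exact hyes hc
        · exact hsound κ hκ _ _ _ M _ htab hc
      · exact fun h => absurd h (by norm_num)
    · rintro ⟨κ', hκ', hgd⟩
      rw [State.set_reg_ne _ _ (by omega), h14', if_pos]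
      rcases Nat.lt_succ_iff_lt_or_eq.1 hκ' with h' | rfl
      · exact Or.inl (hg ⟨κ', h', hgd⟩)
      · exact Or.inr (hgood κ' hκ hgd M _ htab)
  · rintro s' - ⟨h1, h2, h3⟩
    exact ⟨h1.r14, h2, h3⟩

end Dim

/-! ### The choice of the sizes and the complete program. -/

/-- The number of bits of `n`. -/
def lamOf (n : ℕ) : ℕ := Nat.log 2 n + 1

/-- A third of the number of bits of `n`. -/
def ellOf (n : ℕ) : ℕ := (lamOf n + 2) / 3

/-- The logarithm of the length of the convolution instances. -/
def muOf (n : ℕ) : ℕ := lamOf n + ellOf n + 42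

theorem lt_two_pow_lamOf (n : ℕ) : n < 2 ^ lamOf n := Nat.lt_pow_succ_log_self (by norm_num) n

theorem ellOf_le (n : ℕ) : ellOf n ≤ lamOf n := by unfold ellOf lamOf; omega

theorem muOf_le (n : ℕ) : muOf n + 1 ≤ 45 * lamOf n := by unfold muOf ellOf lamOf; omega

/-- The sizes that the reduction uses for lists of length `n`. -/
def dim (k k' n : ℕ) (hk' : 4 ≤ k') (hk : 45 * k' + 200 ≤ k) : Dim (wordLength k n) where
  n := n
  lam := lamOf n
  S := 2 ^ (ellOf n + 19)
  Q := 2 ^ (lamOf n + ellOf n + 40)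
  mu := muOf n
  m := 2 ^ muOf n
  Z := 2 ^ (k' * (muOf n + 1))
  l1 := lamOf n + ellOf n + 40
  l2 := ellOf n + 19
  w' := k' * (muOf n + 1)
  hS := rfl
  hQ := rfl
  hm := rfl
  hZ := rfl
  one_le_l2 := by omega
  l1_le := by
    have h1 := ellOf_le n
    have h2 : 200 * lamOf n ≤ k * lamOf n := Nat.mul_le_mul_right _ (by omega)
    have h3 : 1 ≤ lamOf n := by unfold lamOf; omega
    change _ ≤ k * lamOf n
    omega
  l2_le := by
    have h1 := ellOf_le n
    have h2 : 200 * lamOf n ≤ k * lamOf n := Nat.mul_le_mul_right _ (by omega)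
    have h3 : 1 ≤ lamOf n := by unfold lamOf; omega
    change _ ≤ k * lamOf n
    omega
  hmQ := by
    rw [show muOf n = (lamOf n + ellOf n + 40) + 2 by unfold muOf; omega, pow_add]; ring
  hSQ := by
    rw [show 16 = 2 ^ 4 by norm_num, ← pow_add]
    exact Nat.pow_le_pow_right (by norm_num) (by omega)
  hSS := by
    have h1 := ellOf_le n
    have h2 : 2 ^ (ellOf n + 19) * 2 ^ (ellOf n + 19) * 2 ≤ 2 ^ muOf n := by
      rw [← pow_add, ← pow_succ]
      exact Nat.pow_le_pow_right (by norm_num) (by unfold muOf; omega)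
    have h3 : 2 ≤ 2 ^ (ellOf n + 19) * 2 ^ (ellOf n + 19) := by
      rw [← pow_add]
      calc 2 = 2 ^ 1 := rfl
        _ ≤ _ := Nat.pow_le_pow_right (by norm_num) (by omega)
    omega
  hmZ := by
    have h1 : 2 ^ muOf n * 2 ^ 3 ≤ 2 ^ (k' * (muOf n + 1)) := by
      rw [← pow_add]
      have := Nat.mul_le_mul_right (muOf n + 1) hk'
      exact Nat.pow_le_pow_right (by norm_num) (by omega)
    omega
  hnZ := by
    have h1 : 2 ^ lamOf n * 2 ^ 2 ≤ 2 ^ (k' * (muOf n + 1)) := by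
      rw [← pow_add]
      have := Nat.mul_le_mul_right (muOf n + 1) hk'
      exact Nat.pow_le_pow_right (by norm_num) (by unfold muOf at *; omega)
    have := lt_two_pow_lamOf n
    omega
  lam_le := by
    change _ ≤ k * lamOf n
    exact Nat.le_mul_of_pos_left _ (by omega)
  total_lt := by
    have h1 : lamOf n < 2 ^ lamOf n := Nat.lt_two_pow_self
    have h2 : muOf n + 1 < 2 ^ (muOf n + 1) := Nat.lt_two_pow_self
    have h3 : lamOf n * (muOf n + 1) + 1 < 2 ^ (lamOf n + (muOf n + 1)) := by
      rw [pow_add]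
      have h4 := Nat.mul_le_mul (Nat.succ_le_of_lt h1) (Nat.succ_le_of_lt h2)
      rw [Nat.succ_mul, Nat.mul_succ] at h4
      have : 1 ≤ lamOf n := by unfold lamOf; omega
      omega
    -- The block address takes at most 45 k' `lamOf n` bits, because `muOf n + 1` is at most 45
    -- `lamOf n`. The number of blocks takes at most 46 `lamOf n` further bits, within the reserve
    -- of 200.
    calc (lamOf n * (muOf n + 1) + 1) * 2 ^ (k' * (muOf n + 1))
        < 2 ^ (lamOf n + (muOf n + 1)) * 2 ^ (k' * (muOf n + 1)) :=
          Nat.mul_lt_mul_of_pos_right h3 (by positivity)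
      _ = 2 ^ (lamOf n + (muOf n + 1) + k' * (muOf n + 1)) := (pow_add _ _ _).symm
      _ ≤ 2 ^ wordLength k n := by
          apply Nat.pow_le_pow_right (by norm_num)
          change _ ≤ k * lamOf n
          have h5 := muOf_le n
          have h6 := Nat.mul_le_mul_left k' h5
          have h7 : (45 * k' + 200) * lamOf n ≤ k * lamOf n := Nat.mul_le_mul_right _ hk
          have h8 : (45 * k' + 200) * lamOf n = k' * (45 * lamOf n) + 200 * lamOf n := by ring
          omega

/-- The code that computes the number of bits of the input length. -/
def lamFrag : Frag :=
  (block [.set 1 (lit 1)]).seq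
    (forLoop 18 0 (block [.set 1 (var 1 + (lit 1 <<< var 1).lt (var 0 + lit 1))]))

/-- The code that computes the sizes. -/
def sizesFrag (k k' : ℕ) : Frag :=
  block
    [.set 2 (lit k * var 1),
     .set 18 ((var 1 + lit 2) / lit 3),
     .set 19 (var 18 + lit 19),
     .set 20 (var 1 + var 18 + lit 40),
     .set 5 (var 20 + lit 2),
     .set 3 (lit 1 <<< var 19),
     .set 4 (lit 1 <<< var 20),
     .set 6 (lit 1 <<< var 5),
     .set 7 (lit 1 <<< (lit k' * (var 5 + lit 1))),
     .set 8 (var 7 - lit 1),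
     .set 9 (var 2 - var 20),
     .set 10 (var 2 - var 19),
     .set 11 (lit 8 * var 3),
     .set 13 (var 7),
     .set 14 (lit 0)]

/-- The counter grows while 2 to its power is at most n. Running n rounds is more than enough and
still linear. The word length is computed from the result, since a program does not know it. -/
theorem Runs.lamFrag {w n : ℕ} [NeZero w] {ω : ℕ → BitVec w} {s : State} (hn : s.reg 0 = n)
    (hw : lamOf n + 2 ≤ w) :
    Runs ω lamFrag s (n * 20 + 10) fun s' => s'.reg 0 = n ∧ s'.reg 1 = lamOf n ∧
      s'.mem = s.mem ∧ s'.drawn = s.drawn := by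
  have hnl := lt_two_pow_lamOf n
  have hpw : 2 ^ (lamOf n + 2) ≤ 2 ^ w := Nat.pow_le_pow_right (by norm_num) hw
  have hll : lamOf n < 2 ^ lamOf n := Nat.lt_two_pow_self
  have hp2 : 2 ^ (lamOf n + 2) = 2 ^ lamOf n * 4 := by rw [pow_add]; norm_num
  have hlit : 1 % 2 ^ w = 1 := Nat.mod_eq_of_lt (by omega)
  refine (Runs.seq (B₁ := 5) (R := fun s' => s'.reg 0 = n ∧ s'.reg 1 = 1 ∧ s'.mem = s.mem ∧
    s'.drawn = s.drawn) (B₂ := n * (15 + 5) + 3) ?_ ?_).mono (by omega) fun _ h => h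
  · apply Runs.block _ (by decide)
    apply WP.set 1 (by decide)
    · simp [hlit]
    exact ⟨by simp [hn], by simp, rfl, rfl⟩
  rintro s₁ ⟨h0, h1, hmem, hdr⟩
  refine Runs.forLoop (fun i s' => s'.reg 0 = n ∧ s'.reg 1 = min (i + 1) (lamOf n) ∧
    s'.mem = s.mem ∧ s'.drawn = s.drawn) (by omega) (by omega) (by omega) h0 ?_ ?_ ?_
  · refine ⟨by simp [h0], ?_, hmem, hdr⟩
    have : 1 ≤ lamOf n := by unfold lamOf; omega
    simp [h1, this]
  · rintro i hi s' h18 h0' ⟨-, h1', hmem', hdr'⟩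
    apply Runs.block _ (by decide)
    apply WP.set (min (i + 1 + 1) (lamOf n)) (by decide)
    · simp only [eval_add, eval_var, eval_lt, eval_shl, eval_lit, hlit, h0', h1', Nat.one_shiftLeft]
      have hle : 2 ^ min (i + 1) (lamOf n) ≤ 2 ^ lamOf n :=
        Nat.pow_le_pow_right (by norm_num) (min_le_right _ _)
      rw [Nat.mod_eq_of_lt (show 2 ^ min (i + 1) (lamOf n) < 2 ^ w by omega),
        Nat.mod_eq_of_lt (show n + 1 < 2 ^ w by omega)]
      have hiff : 2 ^ min (i + 1) (lamOf n) < n + 1 ↔ i + 1 < lamOf n := by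
        rw [Nat.lt_succ_iff, ← Nat.le_log_iff_pow_le (by norm_num) (by omega)]
        unfold lamOf; omega
      rw [if_congr hiff rfl rfl, Nat.mod_eq_of_lt (by split_ifs <;> omega)]
      split_ifs <;> omega
    refine ⟨by simpa using h18, by simpa using h0', by simp [h0'], by simp, hmem', hdr'⟩
  · rintro s' - ⟨h0', h1', hmem', hdr'⟩
    have := hll
    refine ⟨h0', ?_, hmem', hdr'⟩
    rw [h1', min_eq_right]
    unfold lamOf
    have := Nat.log_le_self 2 n
    omega

theorem Runs.sizesFrag_reg {k k' n w : ℕ} (hk' : 4 ≤ k') (hk : 45 * k' + 200 ≤ k) [NeZero w]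
    (hw : w = k * lamOf n) {ω : ℕ → BitVec w} {s : State} (h1 : s.reg 1 = lamOf n) :
    Runs ω (sizesFrag k k') s 100 fun s' =>
      s'.mem = s.mem ∧ s'.drawn = s.drawn ∧ s'.reg 0 = s.reg 0 ∧ s'.reg 1 = s.reg 1 ∧
      s'.reg 2 = w ∧ s'.reg 3 = 2 ^ (ellOf n + 19) ∧ s'.reg 4 = 2 ^ (lamOf n + ellOf n + 40) ∧
      s'.reg 5 = muOf n ∧ s'.reg 6 = 2 ^ muOf n ∧ s'.reg 7 = 2 ^ (k' * (muOf n + 1)) ∧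
      s'.reg 8 = 2 ^ (k' * (muOf n + 1)) - 1 ∧ s'.reg 9 = w - (lamOf n + ellOf n + 40) ∧
      s'.reg 10 = w - (ellOf n + 19) ∧ s'.reg 11 = 8 * 2 ^ (ellOf n + 19) ∧
      s'.reg 13 = 2 ^ (k' * (muOf n + 1)) ∧ s'.reg 14 = 0 := by
  have hlam : 1 ≤ lamOf n := by unfold lamOf; omega
  have hkw : k ≤ w := by rw [hw]; exact Nat.le_mul_of_pos_right _ (by omega)
  have hww : w < 2 ^ w := Nat.lt_two_pow_self
  have hlit : ∀ x ≤ k, x % 2 ^ w = x := fun x hx => Nat.mod_eq_of_lt (by omega)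
  have hell := ellOf_le n
  have hmu := muOf_le n
  have hlw : 200 * lamOf n ≤ w := by rw [hw]; exact Nat.mul_le_mul_right _ (by omega)
  have hmw : k' * (muOf n + 1) + 200 * lamOf n ≤ w := by
    have h6 := Nat.mul_le_mul_left k' hmu
    have h7 : (45 * k' + 200) * lamOf n ≤ k * lamOf n := Nat.mul_le_mul_right _ hk
    have h8 : (45 * k' + 200) * lamOf n = k' * (45 * lamOf n) + 200 * lamOf n := by ring
    omega
  have hpow : ∀ x < w, 2 ^ x % 2 ^ w = 2 ^ x := fun x hx =>
    Nat.mod_eq_of_lt (Nat.pow_lt_pow_right (by norm_num) hx)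
  have hsub : ∀ x < 2 ^ w, ∀ y ≤ x, (2 ^ w - y + x) % 2 ^ w = x - y := fun x hx y hy => by
    rw [show 2 ^ w - y + x = x - y + 2 ^ w by omega, Nat.add_mod_right, Nat.mod_eq_of_lt (by omega)]
  apply Runs.block _ (Nat.le_of_ble_eq_true rfl)
  apply WP.set w (of_decide_eq_true rfl)
  · simp only [eval_mul, eval_lit, eval_var, h1, hlit k le_rfl, ← hw]
    exact Nat.mod_eq_of_lt hww
  apply WP.set (ellOf n) (by decide)
  · simp only [eval_div, eval_add, eval_lit, eval_var, State.set_reg, Nat.reduceEqDiff, reduceIte,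
      h1, hlit 2 (by omega), hlit 3 (by omega)]
    rw [Nat.mod_eq_of_lt (by omega)]; rfl
  apply WP.set (ellOf n + 19) (by decide)
  · simp only [eval_add, eval_lit, eval_var, State.set_reg_self, hlit 19 (by omega)]
    exact Nat.mod_eq_of_lt (by omega)
  apply WP.set (lamOf n + ellOf n + 40) (by decide)
  · simp only [eval_add, eval_lit, eval_var, State.set_reg, Nat.reduceEqDiff, reduceIte, h1,
      hlit 40 (by omega), Nat.mod_add_mod]
    exact Nat.mod_eq_of_lt (by omega)
  apply WP.set (muOf n) (by decide)
  · simp only [eval_add, eval_lit, eval_var, State.set_reg, Nat.reduceEqDiff, reduceIte,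
      hlit 2 (by omega), muOf]
    exact Nat.mod_eq_of_lt (by omega)
  apply WP.set (2 ^ (ellOf n + 19)) (by decide)
  · simp only [eval_shl, eval_lit, eval_var, State.set_reg, Nat.reduceEqDiff, reduceIte,
      hlit 1 (by omega), Nat.one_shiftLeft]
    exact hpow _ (by omega)
  apply WP.set (2 ^ (lamOf n + ellOf n + 40)) (by decide)
  · simp only [eval_shl, eval_lit, eval_var, State.set_reg, Nat.reduceEqDiff, reduceIte,
      hlit 1 (by omega), Nat.one_shiftLeft]
    exact hpow _ (by omega)
  apply WP.set (2 ^ muOf n) (by decide)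
  · simp only [eval_shl, eval_lit, eval_var, State.set_reg, Nat.reduceEqDiff, reduceIte,
      hlit 1 (by omega), Nat.one_shiftLeft]
    exact hpow _ (by omega)
  apply WP.set (2 ^ (k' * (muOf n + 1))) (of_decide_eq_true rfl)
  · simp only [eval_shl, eval_mul, eval_add, eval_lit, eval_var, State.set_reg, Nat.reduceEqDiff,
      reduceIte, hlit 1 (by omega), hlit k' (by omega), Nat.one_shiftLeft, Nat.mul_mod_mod]
    rw [Nat.mod_eq_of_lt (show k' * (muOf n + 1) < 2 ^ w by omega)]
    exact hpow _ (by omega)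
  have hZ1 : 1 ≤ 2 ^ (k' * (muOf n + 1)) := Nat.one_le_two_pow
  have hZw : 2 ^ (k' * (muOf n + 1)) < 2 ^ w := Nat.pow_lt_pow_right (by norm_num) (by omega)
  apply WP.set (2 ^ (k' * (muOf n + 1)) - 1) (by decide)
  · simp only [eval_sub, eval_lit, eval_var, State.set_reg_self, hlit 1 (by omega)]
    exact hsub _ hZw _ hZ1
  apply WP.set (w - (lamOf n + ellOf n + 40)) (by decide)
  · simp only [eval_sub, eval_var, State.set_reg, Nat.reduceEqDiff, reduceIte]
    exact hsub _ hww _ (by omega)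
  apply WP.set (w - (ellOf n + 19)) (by decide)
  · simp only [eval_sub, eval_var, State.set_reg, Nat.reduceEqDiff, reduceIte]
    exact hsub _ hww _ (by omega)
  apply WP.set (8 * 2 ^ (ellOf n + 19)) (by decide)
  · simp only [eval_mul, eval_lit, eval_var, State.set_reg, Nat.reduceEqDiff, reduceIte,
      hlit 8 (by omega)]
    rw [show 8 * 2 ^ (ellOf n + 19) = 2 ^ (ellOf n + 22) by ring]
    exact hpow _ (by omega)
  apply WP.set (2 ^ (k' * (muOf n + 1))) (by decide)
  · simp
  apply WP.set 0 (by decide)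
  · simp
  refine ⟨rfl, rfl, ?_, ?_, ?_, ?_, ?_, ?_, ?_, ?_, ?_, ?_, ?_, ?_, ?_, ?_⟩ <;>
    simp only [State.set_reg, Nat.reduceEqDiff, reduceIte, OfNat.zero_ne_ofNat, OfNat.one_ne_ofNat]

theorem Runs.sizesFrag {k k' n : ℕ} (hk' : 4 ≤ k') (hk : 45 * k' + 200 ≤ k)
    [NeZero (wordLength k n)] {ω : ℕ → BitVec (wordLength k n)} {s : State} (h0 : s.reg 0 = n)
    (h1 : s.reg 1 = lamOf n) (hmem : ∀ y, 3 * n ≤ y → s.mem y = 0) (hdr : s.drawn = 0) :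
    Runs ω (sizesFrag k k') s 100 fun s' =>
      (dim k k' n hk' hk).Start s.mem (dim k k' n hk' hk).Z 0 s' ∧ s'.reg 14 = 0 := by
  refine (Runs.sizesFrag_reg (w := wordLength k n) hk' hk rfl h1).mono le_rfl ?_
  rintro s' ⟨m, d, r0, r1, r2, r3, r4, r5, r6, r7, r8, r9, r10, r11, r13, r14⟩
  refine ⟨⟨⟨r0.trans h0, r1.trans h1, r2, r3, r4, r5, r6, r7, r8, r9, r10, r11⟩, r13,
    r14.le.trans (by omega), fun y _ => by rw [m], fun y hy => ?_, d.trans hdr⟩, r14⟩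
  rw [m]
  exact hmem y ((dim k k' n hk' hk).hnZ.trans hy)

/-- The reduction. -/
def mainFrag (k k' : ℕ) (P : Program) : Frag :=
  lamFrag.seq ((sizesFrag k k').seq ((Dim.mainLoop P).seq (block [.set 0 (var 14)])))

/-- A bound for the number of steps of the reduction. -/
def mainTime {w : ℕ} (D : Dim w) (P : Program) (T : ℕ) : ℕ :=
  D.n * 20 + D.lam * (D.levelTime P T + 5) + 200

/-- The cells of the initial memory as natural numbers. -/
def inputCell (w : ℕ) {n : ℕ} (A B C : Fin n → ℤ) (y : ℕ) : ℕ :=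
  (BitVec.ofInt w ((List.ofFn A ++ List.ofFn B ++ List.ofFn C).getD y 0)).toNat

theorem mainFrag_correct {k k' n : ℕ} (hk' : 4 ≤ k') (hk : 45 * k' + 200 ≤ k) {P : Program} {T : ℕ}
    (hdet : P.Deterministic) (hP : Solves P (dim k k' n hk' hk).w' (dim k k' n hk' hk).m T)
    (A B C : Fin n → ℤ) (ω : ℕ → BitVec (wordLength k n)) {Yes : Prop} {Good : ℕ → Prop}
    (hsound : ∀ κ < lamOf n, ∀ a₁ a₂ ρ M arr,
      (dim k k' n hk' hk).Tables (inputCell (wordLength k n) A B C) κ a₁ a₂ ρ M arr →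
      (∃ i < (dim k k' n hk' hk).m, (dim k k' n hk' hk).AcceptAt M arr i) → Yes)
    (hgood : ∀ κ < lamOf n, Good κ → ∀ M arr,
      (dim k k' n hk' hk).Tables (inputCell (wordLength k n) A B C) κ (ω (κ * (n + 2))).toNat
      (ω (κ * (n + 2) + 1)).toNat (fun j => (ω (κ * (n + 2) + 2 + j)).toNat) M arr →
      ∃ i < (dim k k' n hk' hk).m, (dim k k' n hk' hk).AcceptAt M arr i) {T' : ℕ}
    (hT' : mainTime (dim k k' n hk' hk) P T ≤ T') :
    let σ := run ((mainFrag k k' P).code 0) ω T' (init (wordLength k n) A B C)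
    σ.Halted ((mainFrag k k' P).code 0) ∧ (σ.reg 0 = 0 ∨ σ.reg 0 = 1 ∧ Yes) ∧
      ((∃ κ < lamOf n, Good κ) → σ.reg 0 = 1) := by
  have hlam : 1 ≤ lamOf n := by unfold lamOf; omega
  have hw : wordLength k n = k * lamOf n := rfl
  have hlw : 200 * lamOf n ≤ wordLength k n := by
    rw [hw]; exact Nat.mul_le_mul_right _ (by omega)
  have : NeZero (wordLength k n) := ⟨by omega⟩
  have hnw : n < 2 ^ wordLength k n :=
    (lt_two_pow_lamOf n).trans_le (Nat.pow_le_pow_right (by norm_num) (by omega))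
  let D := dim k k' n hk' hk
  let s₀ : State := ⟨fun r => if r = 0 then n else 0, inputCell (wordLength k n) A B C, 0⟩
  have hrel : Rel s₀ (init (wordLength k n) A B C) := by
    refine ⟨fun r _ => ?_, fun x => rfl, rfl⟩
    by_cases h0 : r = 0
    · simp [init, s₀, h0, Nat.mod_eq_of_lt hnw]
    · simp [init, s₀, h0]
  have hmain : Runs ω (mainFrag k k' P) s₀ (mainTime D P T) fun s' =>
      s'.reg 0 ≤ 1 ∧ (s'.reg 0 = 1 → Yes) ∧ ((∃ κ < lamOf n, Good κ) → s'.reg 0 = 1) := by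
    refine (Runs.seq (Runs.lamFrag (s := s₀) (n := n) rfl (by omega))
      (B₂ := 100 + ((lamOf n * (D.levelTime P T + 5) + 3) + 10)) ?_).mono ?_ fun _ h => h
    · rintro s₁ ⟨h0, h1, hmem1, hdr1⟩
      refine Runs.seq (Runs.sizesFrag hk' hk h0 h1 ?_ hdr1) ?_
      · intro y hy
        rw [hmem1]
        simp only [s₀, inputCell]
        rw [List.getD_eq_default _ _ (by simp; omega)]
        simp
      rintro s₂ ⟨hst, h14⟩
      rw [hmem1] at hst
      refine Runs.seq (hst.mainLoop (ω := ω) h14 hdet hP (Yes := Yes) (Good := Good) hsound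
        hgood) ?_
      rintro s₃ ⟨h1, h2, h3⟩
      apply Runs.block _ (by decide)
      apply WP.set (s₃.reg 14) (by decide)
      · simp
      simp only [WP, State.set_reg_self]
      exact ⟨h1, h2, h3⟩
    · change _ ≤ n * 20 + lamOf n * (D.levelTime P T + 5) + 200
      omega
  obtain ⟨t, ht, s', hrel', hpc, h1, h2, h3⟩ := hmain ((mainFrag k k' P).code 0) 0
    (fun i hi => by rw [Nat.zero_add]) _ rfl hrel
  have hhalt : (run ((mainFrag k k' P).code 0) ω t (init (wordLength k n) A B C)).Halted
      ((mainFrag k k' P).code 0) := by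
    unfold Config.Halted
    rw [hpc, (mainFrag k k' P).length_code]
    omega
  rw [run_of_halted_le hhalt (ht.trans hT')]
  have hreg := hrel'.reg 0 (by omega)
  refine ⟨hhalt, ?_, ?_⟩
  · rcases Nat.le_one_iff_eq_zero_or_eq_one.1 h1 with h | h
    · left; apply BitVec.eq_of_toNat_eq; rw [hreg, h]; simp
    · right
      refine ⟨?_, h2 h⟩
      apply BitVec.eq_of_toNat_eq
      rw [hreg, h]; simp [Nat.pos_of_ne_zero (NeZero.ne (wordLength k n))]
  · intro hg
    apply BitVec.eq_of_toNat_eq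
    rw [hreg, h3 hg]; simp [Nat.pos_of_ne_zero (NeZero.ne (wordLength k n))]

/-! ### Correctness of the candidates -/

/-- The product `a * d` is close to `0` modulo `2 ^ w`. -/
def Near (w a : ℕ) (d : ℤ) (R : ℕ) : Prop := ∃ v : ℤ, |v| < R ∧ (2 ^ w : ℤ) ∣ a * d - v

theorem mulHash_spec (w l a x : ℕ) : ∃ s < 2 ^ (w - l), ∃ k,
    a * x = 2 ^ w * k + (mulHash w (w - l) a x * 2 ^ (w - l) + s) := by
  refine ⟨a * x % 2 ^ w % 2 ^ (w - l), Nat.mod_lt _ (by positivity), a * x / 2 ^ w, ?_⟩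
  rw [mulHash, Nat.shiftRight_eq_div_pow, Nat.div_add_mod', Nat.div_add_mod]

/-- `c` is the carry out of the discarded low parts, and `r` records whether the sum of the two
products wraps modulo `2 ^ w`. -/
theorem mulHash_add {w l : ℕ} (hl : l ≤ w) (a : ℕ) {x y z : ℕ} (h : (x + y) % 2 ^ w = z) :
    ∃ c ≤ 1, ∃ r ≤ 1, mulHash w (w - l) a z + r * 2 ^ l =
      mulHash w (w - l) a x + mulHash w (w - l) a y + c := by
  have hW : 2 ^ w = 2 ^ l * 2 ^ (w - l) := by rw [← pow_add]; congr 1; omega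
  have hL : 0 < 2 ^ (w - l) := by positivity
  have hQ : 0 < 2 ^ l := by positivity
  simp only [mulHash, Nat.shiftRight_eq_div_pow]
  have hz : a * z % 2 ^ w = (a * x % 2 ^ w + a * y % 2 ^ w) % 2 ^ w := by
    rw [← h, ← Nat.add_mod, ← mul_add, Nat.mul_mod, Nat.mod_mod, ← Nat.mul_mod]
  rw [hz]
  have hx := Nat.mod_lt (a * x) (show 0 < 2 ^ w by positivity)
  have hy := Nat.mod_lt (a * y) (show 0 < 2 ^ w by positivity)
  generalize a * x % 2 ^ w = X at *
  generalize a * y % 2 ^ w = Y at *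
  have hsum : ∃ c ≤ 1, (X + Y) / 2 ^ (w - l) = X / 2 ^ (w - l) + Y / 2 ^ (w - l) + c := by
    rw [Nat.add_div hL]
    split_ifs
    exacts [⟨1, le_rfl, rfl⟩, ⟨0, by omega, rfl⟩]
  obtain ⟨c, hc, e⟩ := hsum
  refine ⟨c, hc, ?_⟩
  rcases lt_or_ge (X + Y) (2 ^ w) with hlt | hge
  · exact ⟨0, by omega, by rw [Nat.mod_eq_of_lt hlt, e]; omega⟩
  · refine ⟨1, le_rfl, ?_⟩
    rw [Nat.mod_eq_sub_mod hge, Nat.mod_eq_of_lt (by omega), one_mul, ← Nat.add_mul_div_right _ _ hL,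
      ← hW, Nat.sub_add_cancel hge, e]

/-- The products then differ by δ units of `2 ^ (w - l)`, up to a difference of two low parts, which
is less than one unit. -/
theorem near_of_mulHash_eq {w l : ℕ} (hl : l ≤ w) {a x x' : ℕ} {δ : ℤ} {r : ℤ} {N : ℕ}
    (h : (mulHash w (w - l) a x : ℤ) + r * 2 ^ l = mulHash w (w - l) a x' + δ) (hδ : |δ| < N) :
    Near w a ((x : ℤ) - x') (N * 2 ^ (w - l)) := by
  obtain ⟨s, hs, k, e⟩ := mulHash_spec w l a x
  obtain ⟨s', hs', k', e'⟩ := mulHash_spec w l a x'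
  have hW : (2 : ℤ) ^ w = 2 ^ l * 2 ^ (w - l) := by rw [← pow_add]; congr 1; omega
  refine ⟨δ * 2 ^ (w - l) + (s - s'), ?_, k - k' - r, ?_⟩
  · have h1 : |(s : ℤ) - s'| < 2 ^ (w - l) := by
      have : ((2 ^ (w - l) : ℕ) : ℤ) = 2 ^ (w - l) := by push_cast; rfl
      rw [abs_lt]; omega
    have h2 : |δ| + 1 ≤ N := hδ
    calc |δ * 2 ^ (w - l) + ((s : ℤ) - s')| ≤ |δ| * 2 ^ (w - l) + |(s : ℤ) - s'| := by
          refine (abs_add_le _ _).trans ?_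
          rw [abs_mul, abs_of_pos (show (0 : ℤ) < 2 ^ (w - l) by positivity)]
      _ < |δ| * 2 ^ (w - l) + 2 ^ (w - l) := by omega
      _ = (|δ| + 1) * 2 ^ (w - l) := by ring
      _ ≤ (N : ℤ) * 2 ^ (w - l) := mul_le_mul_of_nonneg_right h2 (by positivity)
      _ = _ := by push_cast; rfl
  · have e1 : (a : ℤ) * x = 2 ^ w * k + (mulHash w (w - l) a x * 2 ^ (w - l) + s) := by
      exact_mod_cast e
    have e2 : (a : ℤ) * x' = 2 ^ w * k' + (mulHash w (w - l) a x' * 2 ^ (w - l) + s') := by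
      exact_mod_cast e'
    rw [mul_sub, e1, e2, hW]
    linear_combination 2 ^ (w - l) * h

/-- Two low parts on each side leave an error of less than two units. -/
theorem near_of_mulHash_add_eq (w l : ℕ) {a x y x' y' : ℕ}
    (h : mulHash w (w - l) a x + mulHash w (w - l) a y =
      mulHash w (w - l) a x' + mulHash w (w - l) a y') :
    Near w a ((x : ℤ) + y - (x' + y')) (2 * 2 ^ (w - l)) := by
  obtain ⟨s, hs, k, e⟩ := mulHash_spec w l a x
  obtain ⟨s', hs', k', e'⟩ := mulHash_spec w l a x'
  obtain ⟨t, ht, j, f⟩ := mulHash_spec w l a y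
  obtain ⟨t', ht', j', f'⟩ := mulHash_spec w l a y'
  refine ⟨(s : ℤ) + t - (s' + t'), ?_, k + j - (k' + j'), ?_⟩
  · rw [abs_lt]; omega
  · zify at e e' f f' h
    linear_combination e + f - e' - f' + 2 ^ (w - l) * h

theorem Near.congr {w a R : ℕ} {d d' : ℤ} (h : Near w a d R) (hd : (2 ^ w : ℤ) ∣ d' - d) :
    Near w a d' R := by
  obtain ⟨v, hv, k, hk⟩ := h
  obtain ⟨k', hk'⟩ := hd
  exact ⟨v, hv, k + a * k', by linear_combination hk + a * hk'⟩

theorem color_inj {S a b a' b' : ℕ} (hb : b < S) (hb' : b' < S)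
    (h : a * S + (b + 2) = a' * S + (b' + 2)) : a = a' ∧ b = b' := by
  have hS : 0 < S := by omega
  have h1 : a * S + b = a' * S + b' := by omega
  have h2 := congrArg (· / S) h1
  have h3 := congrArg (· % S) h1
  simp only [Nat.mul_add_mod_self_right, Nat.mod_eq_of_lt hb, Nat.mod_eq_of_lt hb'] at h3
  subst h3
  exact ⟨Nat.eq_of_mul_eq_mul_right hS (by omega), rfl⟩

namespace Dim

variable {w : ℕ} {D : Dim w} {In : ℕ → ℕ} {κ a₁ a₂ arr : ℕ} {ρ M : ℕ → ℕ}

theorem candidate_eq {d : ℕ → ℕ → ℕ} {mu i p : ℕ} (h : ∀ t < mu, d t i = p / 2 ^ t % 2)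
    (hp : p < 2 ^ mu) : candidate d mu i = p := by
  have key : ∀ k ≤ mu, candidate d k i = p % 2 ^ k := by
    intro k
    induction k with
    | zero => intro _; simp [candidate, Nat.mod_one]
    | succ k ih =>
      intro hk
      have h1 : candidate d (k + 1) i = candidate d k i + d k i * 2 ^ k :=
        Finset.sum_range_succ _ _
      rw [h1, ih (by omega), h k (by omega), Nat.mod_pow_succ, mul_comm (2 ^ k)]
  rw [key mu le_rfl, Nat.mod_eq_of_lt hp]

/-- Equal nonzero colours mean that all three positions are occupied. The values there are copies of
input words, and the last test adds them. -/
theorem Tables.sound (h : D.Tables In κ a₁ a₂ ρ M arr) {i : ℕ} (hi : i < D.m)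
    (hacc : D.AcceptAt M arr i) :
    ∃ x < D.n, ∃ y < D.n, ∃ z < D.n, (In x + In (D.n + y)) % 2 ^ w = In (2 * D.n + z) := by
  obtain ⟨hj, h0, hfg, hgk, hv⟩ := hacc
  revert hj h0 hfg hgk hv
  -- Soundness does not depend on where the candidate comes from.
  generalize candidate _ _ _ = j
  intro hj h0 hfg hgk hv
  rcases h.fillA j (by omega) with ⟨h1, -⟩ | hA
  · exact absurd h1 h0
  rcases h.fillB (i - j) (by omega) with ⟨h1, -⟩ | hB
  · exact absurd (hfg.trans h1) h0
  rcases h.fillC i hi with ⟨h1, -⟩ | hC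
  · exact absurd ((hfg.trans hgk).trans h1) h0
  obtain ⟨x, hx, -, -, -, -, ex⟩ := hA
  obtain ⟨y, hy, -, -, -, -, ey⟩ := hB
  obtain ⟨z, hz, -, -, -, -, ez⟩ := hC
  refine ⟨x, hx, y, hy, z, hz, ?_⟩
  simp only [show arr + 3 * D.m = arr + 2 * D.m + D.m by ring,
    show arr + 5 * D.m = arr + 4 * D.m + D.m by ring] at hv
  rw [← ex, ← ey, ← ez, ← hv]

theorem Filled.eq_of_unique {W : ℕ → ℕ → ℕ → Prop} {A m p c v : ℕ} (h : Filled M A m W) (hp : p < m)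
    (hw : W p c v) (hu : ∀ c' v', W p c' v' → c' = c ∧ v' = v) : M (A + p) = c ∧ M (A + m + p) = v := by
  rcases h p hp with ⟨-, h1⟩ | h1
  · exact absurd hw (h1 c v)
  · exact hu _ _ h1

/-- If the position of a solution is hit by no other entry, and the solution is the only one there,
then it is found. -/
theorem Tables.acceptAt (h : D.Tables In κ a₁ a₂ ρ M arr) {p₀ p₁ c x y z : ℕ} (hc : 2 ≤ c)
    (hp : p₀ + p₁ < D.m) (hxy : (x + y) % 2 ^ w = z)
    (hA : D.EntryA In κ a₁ a₂ ρ p₀ c x) (hB : D.EntryB In a₁ a₂ p₁ c y)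
    (hC : D.EntryC In a₁ a₂ (p₀ + p₁) c z)
    (uA : ∀ c' v, D.EntryA In κ a₁ a₂ ρ p₀ c' v → c' = c ∧ v = x)
    (uB : ∀ c' v, D.EntryB In a₁ a₂ p₁ c' v → c' = c ∧ v = y)
    (uC : ∀ c' v, D.EntryC In a₁ a₂ (p₀ + p₁) c' v → c' = c ∧ v = z)
    (uF : ∀ p p' v v', p + p' = p₀ + p₁ → D.EntryA In κ a₁ a₂ ρ p c v →
      D.EntryB In a₁ a₂ p' c v' → p = p₀) :
    D.AcceptAt M arr (p₀ + p₁) := by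
  obtain ⟨f0, vf0⟩ := Filled.eq_of_unique h.fillA (by omega) hA uA
  obtain ⟨g0, vg0⟩ := Filled.eq_of_unique h.fillB (by omega) hB uB
  obtain ⟨k0, vk0⟩ := Filled.eq_of_unique h.fillC hp hC uC
  -- If bit t of p₀ is set, then p₀ itself causes a hit. If it is not, any hit would come from
  -- another first-table position of the same colour, which `uF` excludes.
  have hcand : candidate (hit (fun j => M (arr + j)) (fun j => M (arr + 2 * D.m + j))
      (fun j => M (arr + 4 * D.m + j))) D.mu (p₀ + p₁) = p₀ := by
    apply candidate_eq _ (by rw [← D.hm]; omega)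
    intro t ht
    have hnz : noZero (M (arr + 4 * D.m + (p₀ + p₁))) = c := by
      rw [k0, noZero, if_neg (by omega)]
    rcases Nat.mod_two_eq_zero_or_one (p₀ / 2 ^ t) with hb | hb
    · rw [hb, hit, if_neg]
      rintro ⟨j, l, hjl, e1, e2⟩
      simp only [hnz] at e2
      rw [bitTable, e2] at e1
      rcases Nat.mod_two_eq_zero_or_one (j / 2 ^ t) with hb' | hb'
      · rw [hb', mul_zero] at e1; omega
      rw [hb', mul_one] at e1
      rcases h.fillA j (by omega) with ⟨h1, -⟩ | hA'
      · omega
      rcases h.fillB l (by omega) with ⟨h1, -⟩ | hB'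
      · omega
      rw [e1] at hA'
      rw [e2] at hB'
      have := uF _ _ _ _ hjl hA' hB'
      subst this
      omega
    · rw [hb, hit, if_pos]
      refine ⟨p₀, p₁, rfl, ?_, ?_⟩
      · simp only [bitTable, hb, mul_one, f0, g0]
      · simp only [hnz, g0]
  unfold AcceptAt
  rw [hcand]
  refine ⟨Nat.le_add_right _ _, ?_, ?_, ?_, ?_⟩
  all_goals simp only [Nat.add_sub_cancel_left]
  · rw [f0]; omega
  · rw [f0, g0]
  · rw [g0, k0]
  · rw [show arr + 3 * D.m + p₁ = arr + 2 * D.m + D.m + p₁ by ring,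
      show arr + 5 * D.m = arr + 4 * D.m + D.m by ring, vf0, vk0, vg0, hxy]

/-- Copies of the same z must not overwrite each other. Q ≥ 16S recovers the wraparound bit and
parity the carry of `q1`, so β + 3α is determined. Modulo S, β + α + c₂ is known as well, and
subtracting leaves 2α - c₂. The weight 3 is needed: with weight 1 the two quantities would not
separate α from β. -/
theorem posC_inj {p q e e' : ℕ} (he : e < 8 * D.S) (he' : e' < 8 * D.S)
    (h : D.posC p q e = D.posC p q e') :
    e / 8 = e' / 8 ∧ D.beta q e = D.beta q e' := by
  have hb := D.beta_lt q e
  have hb' := D.beta_lt q e'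
  have hSQ := D.hSQ
  have h2 := D.two_le_S
  have hr : e / 2 % 2 = e' / 2 % 2 := by
    unfold posC at h
    rcases Nat.mod_two_eq_zero_or_one (e / 2) with h1 | h1 <;>
      rcases Nat.mod_two_eq_zero_or_one (e' / 2) with h3 | h3 <;> simp only [h1, h3] at h ⊢ <;> omega
  have hsum : D.beta q e + 3 * (e / 8) = D.beta q e' + 3 * (e' / 8) := by
    unfold posC at h
    rw [hr] at h
    omega
  have key : ∀ e, e < 8 * D.S → ∃ k : ℤ, (D.beta q e : ℤ) + (e / 8 : ℕ) + (e / 4 % 2 : ℕ) =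
      q + D.S * k := by
    intro e he
    have := Nat.div_add_mod (q + 2 * D.S - e / 8 - e / 4 % 2) D.S
    refine ⟨2 - ((q + 2 * D.S - e / 8 - e / 4 % 2) / D.S : ℕ), ?_⟩
    unfold beta
    have h3 : (((q + 2 * D.S - e / 8 - e / 4 % 2 : ℕ)) : ℤ) =
      q + 2 * D.S - (e / 8 : ℕ) - (e / 4 % 2 : ℕ) := by omega
    zify at this
    rw [mul_sub]
    push_cast at *
    linear_combination this + h3
  obtain ⟨k, hk⟩ := key e he
  obtain ⟨k', hk'⟩ := key e' he'
  -- Equality of β + 3α makes two values of α differ by less than S/3. The sums β + α + c₂ then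
  -- differ by less than S, so they agree exactly and not only modulo S.
  have ht : k - k' = 0 := by
    by_contra hne
    have h5 : (D.S : ℤ) * (k - k') = (D.beta q e : ℤ) + (e / 8 : ℕ) + (e / 4 % 2 : ℕ) -
      ((D.beta q e' : ℤ) + (e' / 8 : ℕ) + (e' / 4 % 2 : ℕ)) := by rw [hk, hk']; ring
    rcases lt_or_gt_of_ne hne with h6 | h6
    · have : (D.S : ℤ) * (k - k') ≤ D.S * (-1) := mul_le_mul_of_nonneg_left (by omega) (by omega)
      omega
    · have : (D.S : ℤ) * 1 ≤ D.S * (k - k') := mul_le_mul_of_nonneg_left (by omega) (by omega)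
      omega
  rw [show k = k' by omega] at hk
  constructor <;> omega

/-- The conditions under which a level finds a given solution. -/
structure Clear (D : Dim w) (In : ℕ → ℕ) (κ a₁ a₂ : ℕ) (ρ : ℕ → ℕ) (x y z : ℕ) : Prop where
  alive : survives w κ ρ x
  -- Shifts of two copies in any table differ by less than 8S. A different value that collides in
  -- position therefore has a `q1` value within 8S, modulo Q for the third list.
  sepA : ∀ i < D.n, In i ≠ In x → ¬ Near w a₁ ((In i : ℤ) - In x) (8 * D.S * 2 ^ (w - D.l1))
  sepB : ∀ i < D.n, In (D.n + i) ≠ In (D.n + y) →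
    ¬ Near w a₁ ((In (D.n + i) : ℤ) - In (D.n + y)) (8 * D.S * 2 ^ (w - D.l1))
  sepC : ∀ i < D.n, In (2 * D.n + i) ≠ In (2 * D.n + z) →
    ¬ Near w a₁ ((In (2 * D.n + i) : ℤ) - In (2 * D.n + z)) (8 * D.S * 2 ^ (w - D.l1))
  noFalse : ∀ i < D.n, ∀ j < D.n, D.q2 a₂ (In i) = D.q2 a₂ (In x) →
    D.q2 a₂ (In (D.n + j)) = D.q2 a₂ (In (D.n + y)) →
    (In i + In (D.n + j)) % 2 ^ w ≠ In (2 * D.n + z) →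
    ¬ Near w a₁ ((In i : ℤ) + In (D.n + j) - (In x + In (D.n + y))) (2 * 2 ^ (w - D.l1))
  -- Other true pairs for the same z land at the same position when they share the colour, whatever
  -- `q1` is. Only sampling and `q2` can exclude them.
  noTrue : ∀ i < D.n, survives w κ ρ i → In i ≠ In x → D.q2 a₂ (In i) = D.q2 a₂ (In x) →
    ∀ j < D.n, (In i + In (D.n + j)) % 2 ^ w ≠ In (2 * D.n + z)

/-- The relevant copies are number β of x, number α of y, and the copy of z that guesses α and the
carries correctly. Equal values give identical entries, so repetitions in the lists do no harm. -/
theorem Clear.exists_acceptAt {x y z : ℕ} (hx : x < D.n) (hy : y < D.n) (hz : z < D.n)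
    (hcl : D.Clear In κ a₁ a₂ ρ x y z) (h : D.Tables In κ a₁ a₂ ρ M arr)
    (hxyz : (In x + In (D.n + y)) % 2 ^ w = In (2 * D.n + z)) :
    ∃ i < D.m, D.AcceptAt M arr i := by
  have hSQ := D.hSQ
  have hmQ := D.hmQ
  have h2S := D.two_le_S
  set α := D.q2 a₂ (In x) with hα
  set β := D.q2 a₂ (In (D.n + y)) with hβ
  have hαS : α < D.S := D.q2_lt _ _
  have hβS : β < D.S := D.q2_lt _ _
  have hq1x := D.q1_lt a₁ (In x)
  have hq1y := D.q1_lt a₁ (In (D.n + y))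
  obtain ⟨c1, hc1, r1, hr1, e1⟩ := mulHash_add D.l1_le a₁ hxyz
  obtain ⟨c2, hc2, r2, hr2, e2⟩ := mulHash_add D.l2_le a₂ hxyz
  rw [← D.hQ] at e1
  rw [← D.hS] at e2
  change D.q1 a₁ _ + _ = D.q1 a₁ _ + D.q1 a₁ _ + _ at e1
  change D.q2 a₂ _ + _ = D.q2 a₂ _ + D.q2 a₂ _ + _ at e2
  rw [← hα, ← hβ] at e2
  -- This is the right guess, encoded as in the code that fills the third table.
  obtain ⟨e, he, he8, he4, he2, he1⟩ : ∃ e < 8 * D.S, e / 8 = α ∧ e / 4 % 2 = c2 ∧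
      e / 2 % 2 = r1 ∧ e % 2 = c1 := ⟨8 * α + 4 * c2 + 2 * r1 + c1, by omega, by omega, by omega,
      by omega, by omega⟩
  have hq2z := D.q2_lt a₂ (In (2 * D.n + z))
  have hbeta : D.beta (D.q2 a₂ (In (2 * D.n + z))) e = β := by
    unfold beta
    rw [he8, he4]
    rcases Nat.le_one_iff_eq_zero_or_eq_one.1 hr2 with h0 | h0 <;> rw [h0] at e2
    · rw [show D.q2 a₂ (In (2 * D.n + z)) + 2 * D.S - α - c2 = β + 2 * D.S by omega,
        Nat.add_mul_mod_self_right, Nat.mod_eq_of_lt hβS]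
    · rw [show D.q2 a₂ (In (2 * D.n + z)) + 2 * D.S - α - c2 = β + D.S by omega,
        Nat.add_mod_right, Nat.mod_eq_of_lt hβS]
  have hpos : D.posC (D.q1 a₁ (In (2 * D.n + z))) (D.q2 a₂ (In (2 * D.n + z))) e =
      (D.q1 a₁ (In x) + (2 * β + 1)) + (D.q1 a₁ (In (D.n + y)) + 6 * α) := by
    unfold posC
    rw [hbeta, he8, he2, he1]
    omega
  refine ⟨_, ?_, h.acceptAt (p₀ := D.q1 a₁ (In x) + (2 * β + 1))
    (p₁ := D.q1 a₁ (In (D.n + y)) + 6 * α) (c := α * D.S + (β + 2)) (by omega) ?_ hxyz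
    ⟨x, hx, β, by rwa [if_pos hcl.alive], rfl, rfl, rfl⟩ ⟨y, hy, α, hαS, rfl, rfl, rfl⟩
    ⟨z, hz, e, he, hpos.symm, by rw [he8, hbeta], rfl⟩ ?_ ?_ ?_ ?_⟩
  · omega
  · omega
  · rintro c v ⟨i, hi, b, hb, hp, rfl, rfl⟩
    have hb' : b < D.S := lt_of_lt_of_le hb (by split_ifs <;> omega)
    by_cases hne : In i = In x
    · rw [hne] at hp ⊢
      have : b = β := by omega
      exact ⟨by rw [this, hα], rfl⟩
    · refine absurd (near_of_mulHash_eq D.l1_le (r := 0) (δ := 2 * β - 2 * b) (N := 8 * D.S) ?_ ?_)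
        (hcl.sepA i hi hne)
      · change (D.q1 a₁ (In i) : ℤ) + _ = D.q1 a₁ (In x) + _
        omega
      · rw [abs_lt]; omega
  · rintro c v ⟨i, hi, b, hb, hp, rfl, rfl⟩
    by_cases hne : In (D.n + i) = In (D.n + y)
    · rw [hne] at hp ⊢
      have : b = α := by omega
      exact ⟨by rw [this, hβ], rfl⟩
    · refine absurd (near_of_mulHash_eq D.l1_le (r := 0) (δ := 6 * α - 6 * b) (N := 8 * D.S) ?_ ?_)
        (hcl.sepB i hi hne)
      · change (D.q1 a₁ (In (D.n + i)) : ℤ) + _ = D.q1 a₁ (In (D.n + y)) + _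
        omega
      · rw [abs_lt]; omega
  · rintro c v ⟨i, hi, b, hb, hp, rfl, rfl⟩
    by_cases hne : In (2 * D.n + i) = In (2 * D.n + z)
    · rw [hne] at hp ⊢
      obtain ⟨h3, h4⟩ := posC_inj hb he (hp.symm.trans hpos.symm)
      rw [h3, h4, he8, hbeta]
      exact ⟨rfl, rfl⟩
    · rw [← hpos] at hp
      have h5 := D.beta_lt (D.q2 a₂ (In (2 * D.n + i))) b
      unfold posC at hp
      rw [hbeta, he8] at hp
      refine absurd (near_of_mulHash_eq D.l1_le (r := (b / 2 % 2 : ℕ) - (e / 2 % 2 : ℕ))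
        (δ := 2 * (β + 3 * α) - (e % 2 : ℕ) -
          (2 * (D.beta (D.q2 a₂ (In (2 * D.n + i))) b + 3 * (b / 8 : ℕ)) - (b % 2 : ℕ)))
        (N := 8 * D.S) ?_ ?_) (hcl.sepC i hi hne)
      · change (D.q1 a₁ (In (2 * D.n + i)) : ℤ) + _ = D.q1 a₁ (In (2 * D.n + z)) + _
        have hQ : ((2 : ℤ) ^ D.l1) = D.Q := by rw [D.hQ]; push_cast; rfl
        rw [hQ, sub_mul]
        generalize hA : b / 2 % 2 = A at *
        generalize hE : e / 2 % 2 = E at *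
        have hp' : (D.q1 a₁ (In (2 * D.n + z)) : ℤ) + E * D.Q + 2 * (β + 3 * α) + 1 - (e % 2 : ℕ) =
            D.q1 a₁ (In (2 * D.n + i)) + A * D.Q +
            2 * (D.beta (D.q2 a₂ (In (2 * D.n + i))) b + 3 * (b / 8 : ℕ)) + 1 - (b % 2 : ℕ) := by
          have e5 : e % 2 < 2 := Nat.mod_lt _ (by norm_num)
          have e6 : b % 2 < 2 := Nat.mod_lt _ (by norm_num)
          omega
        linear_combination -hp'
      · rw [abs_lt]; omega
  · rintro p p' v v' hpp ⟨i, hi, b, hb, rfl, hc, rfl⟩ ⟨j, hj, b', hb', rfl, hc', rfl⟩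
    have hbS : b < D.S := lt_of_lt_of_le hb (by split_ifs <;> omega)
    have hsurv : survives w κ ρ i := by
      by_contra hn
      rw [if_neg hn] at hb; omega
    obtain ⟨h3, h4⟩ := color_inj hβS hbS hc
    obtain ⟨h5, h6⟩ := color_inj hβS (D.q2_lt _ _) hc'
    subst h4 h5
    by_cases hne : In i = In x
    · rw [hne]
    exfalso
    -- A competing pair of the same colour is either another solution for z or a coincidence of
    -- positions.
    by_cases hs : (In i + In (D.n + j)) % 2 ^ w = In (2 * D.n + z)
    · exact hcl.noTrue i hi hsurv hne h3.symm j hj hs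
    · refine hcl.noFalse i hi j hj h3.symm h6.symm hs (near_of_mulHash_add_eq _ _ ?_)
      change D.q1 a₁ _ + D.q1 a₁ _ = D.q1 a₁ _ + D.q1 a₁ _
      omega

end Dim

/-! ### Finite probability -/

section Pr

variable {Ω : Type*} [Fintype Ω]

open Classical in
/-- The probability of an event for the uniform distribution on a finite type. -/
noncomputable def pr (E : Ω → Prop) : ℝ := (∑ x, if E x then 1 else 0) / Fintype.card Ω

open Classical in
theorem pr_eq_card (E : Ω → Prop) :
    pr E = (Nat.card {x // E x} : ℝ) / Nat.card Ω := by
  rw [pr, Nat.card_eq_fintype_card, Nat.card_eq_fintype_card, Fintype.card_subtype,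
    Finset.sum_boole]

theorem pr_eq_filter (E : Ω → Prop) [DecidablePred E] :
    pr E = ((Finset.univ.filter E).card : ℝ) / Fintype.card Ω := by
  rw [pr, ← Finset.sum_boole]
  congr! 3

theorem pr_mono {E F : Ω → Prop} (h : ∀ x, E x → F x) : pr E ≤ pr F := by
  classical
  unfold pr
  gcongr with x
  by_cases hE : E x
  · simp [hE, h x hE]
  · rw [if_neg hE]; split_ifs <;> norm_num

theorem pr_le_one (E : Ω → Prop) : pr E ≤ 1 := by
  classical
  refine div_le_one_of_le₀ ?_ (Nat.cast_nonneg _)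
  calc _ ≤ ∑ _x : Ω, (1 : ℝ) := Finset.sum_le_sum fun x _ => by split_ifs <;> norm_num
    _ = _ := by simp

theorem pr_or_le (E F : Ω → Prop) : pr (fun x => E x ∨ F x) ≤ pr E + pr F := by
  classical
  unfold pr
  rw [← add_div, ← Finset.sum_add_distrib]
  gcongr with x
  by_cases hE : E x <;> by_cases hF : F x <;> simp [hE, hF]

theorem pr_not [Nonempty Ω] (E : Ω → Prop) : pr (fun x => ¬ E x) = 1 - pr E := by
  classical
  have hc : (Fintype.card Ω : ℝ) ≠ 0 := Nat.cast_ne_zero.2 Fintype.card_ne_zero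
  unfold pr
  rw [eq_sub_iff_add_eq, ← add_div, ← Finset.sum_add_distrib, div_eq_one_iff_eq hc]
  calc _ = ∑ _x : Ω, (1 : ℝ) := Finset.sum_congr rfl fun x _ => by by_cases hE : E x <;> simp [hE]
    _ = _ := by simp

theorem pr_eq_one [Nonempty Ω] {E : Ω → Prop} (h : ∀ x, E x) : pr E = 1 := by
  classical
  rw [pr_eq_filter, Finset.filter_true_of_mem fun x _ => h x, Finset.card_univ,
    div_self (Nat.cast_ne_zero.2 Fintype.card_ne_zero)]

theorem pr_exists_le {ι : Type*} (s : Finset ι) (E : ι → Ω → Prop) :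
    pr (fun x => ∃ i ∈ s, E i x) ≤ ∑ i ∈ s, pr (E i) := by
  classical
  induction s using Finset.induction_on with
  | empty => simp [pr]
  | insert a s ha ih =>
    rw [Finset.sum_insert ha]
    refine (pr_mono (F := fun x => E a x ∨ ∃ i ∈ s, E i x) ?_).trans
      ((pr_or_le _ _).trans (by linarith))
    rintro x ⟨i, hi, h⟩
    rcases Finset.mem_insert.1 hi with rfl | hi
    exacts [Or.inl h, Or.inr ⟨i, hi, h⟩]

theorem pr_exists_le_mul {ι : Type*} (s : Finset ι) (E : ι → Ω → Prop) {δ : ℝ}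
    (h : ∀ i ∈ s, pr (E i) ≤ δ) : pr (fun x => ∃ i ∈ s, E i x) ≤ s.card * δ := by
  refine (pr_exists_le s E).trans ((Finset.sum_le_sum h).trans ?_)
  simp

/-- Markov's inequality for the number of events that happen. -/
theorem pr_card_ge_le {ι : Type*} (s : Finset ι) (E : ι → Ω → Prop)
    [∀ i x, Decidable (E i x)] {δ : ℝ} {K : ℕ} (hK : 0 < K)
    (h : ∀ i ∈ s, pr (E i) ≤ δ) :
    pr (fun x => K ≤ (s.filter fun i => E i x).card) ≤ s.card * δ / K := by
  have hK' : (0 : ℝ) < K := Nat.cast_pos.2 hK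
  rw [le_div_iff₀ hK']
  have h1 : pr (fun x => K ≤ (s.filter fun i => E i x).card) * K ≤ ∑ i ∈ s, pr (E i) := by
    simp only [pr_eq_filter, ← Finset.sum_boole]
    rw [← Finset.sum_div, div_mul_eq_mul_div, Finset.sum_comm, Finset.sum_mul]
    gcongr with x
    rw [Finset.sum_boole, ite_mul, one_mul, zero_mul]
    split_ifs with hx
    · exact_mod_cast hx
    · positivity
  refine h1.trans ((Finset.sum_le_sum h).trans ?_)
  simp

/-- Resampling one coordinate. -/
theorem pr_and_le {ι V : Type*} [Fintype ι] [Fintype V] [Nonempty V] [DecidableEq ι] (c : ι)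
    (E F : (ι → V) → Prop) {δ : ℝ} (hE : ∀ ω a, E (Function.update ω c a) ↔ E ω)
    (hF : ∀ ω, E ω → pr (fun a => F (Function.update ω c a)) ≤ δ) :
    pr (fun ω => E ω ∧ F ω) ≤ δ * pr E := by
  classical
  have hV : (0 : ℝ) < Fintype.card V := Nat.cast_pos.2 Fintype.card_pos
  -- Exchanging coordinate `c` with an independent sample is an involution, so resampling preserves
  -- the uniform distribution.
  let e : (ι → V) × V → (ι → V) × V := fun p => (Function.update p.1 c p.2, p.1 c)
  have he : Function.Involutive e := fun p => by
    ext <;> simp [e]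
  have hsum : ∀ g : (ι → V) → ℝ,
      ∑ ω, ∑ a, g (Function.update ω c a) = Fintype.card V * ∑ ω, g ω := by
    intro g
    rw [← Fintype.sum_prod_type' (f := fun ω a => g (Function.update ω c a)),
      Fintype.sum_equiv (he.toPerm e) (fun p : (ι → V) × V => g (Function.update p.1 c p.2))
        (fun p => g p.1) (fun p => rfl), Fintype.sum_prod_type, Finset.mul_sum]
    simp
  have key : ∑ ω : ι → V, (if E ω ∧ F ω then (1 : ℝ) else 0) ≤ δ * ∑ ω, if E ω then 1 else 0 := by
    rw [← mul_le_mul_iff_right₀ hV, ← hsum, ← mul_assoc, Finset.mul_sum]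
    refine Finset.sum_le_sum fun ω _ => ?_
    simp only [hE]
    by_cases hEω : E ω
    · have := hF ω hEω
      rw [pr, div_le_iff₀ hV] at this
      simp only [hEω, true_and, if_true, mul_one]
      linarith
    · simp [hEω]
  rw [pr_eq_filter fun ω => E ω ∧ F ω, pr_eq_filter E, ← mul_div_assoc, ← Finset.sum_boole,
    ← Finset.sum_boole]
  exact div_le_div_of_nonneg_right key (Nat.cast_nonneg _)

end Pr

/-! ### Uniformly random words as multipliers and as sampling words. -/

instance fintypeBitVec (w : ℕ) : Fintype (BitVec w) := Fintype.ofEquiv _ BitVec.equivFin.toEquiv.symm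

theorem card_bitVec (w : ℕ) : Fintype.card (BitVec w) = 2 ^ w := by
  rw [Fintype.card_congr BitVec.equivFin.toEquiv, Fintype.card_fin]

theorem pr_bitVec_le {w N : ℕ} (E : ℕ → Prop) (s : Finset ℕ) (hs : ∀ a < 2 ^ w, E a → a ∈ s)
    (hN : s.card ≤ N) : pr (fun a : BitVec w => E a.toNat) ≤ N / 2 ^ w := by
  classical
  rw [pr, card_bitVec, Finset.sum_boole]
  push_cast
  gcongr
  refine le_trans ?_ hN
  refine Finset.card_le_card_of_injOn BitVec.toNat ?_ fun x _ y _ h => BitVec.eq_of_toNat_eq h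
  intro a ha
  exact hs _ a.isLt (by simpa using ha)

/-- Any two such multipliers differ by at most 2R/d, so all of them lie in a short interval that
starts at the smallest one. -/
theorem card_filter_close_le (W d R k N : ℕ) (hd : 0 < d) :
    ((Finset.range N).filter fun a : ℕ => |(a : ℤ) * d - k * W| < R).card ≤ 2 * R / d + 1 := by
  set s := (Finset.range N).filter fun a : ℕ => |(a : ℤ) * d - k * W| < R with hs
  rcases s.eq_empty_or_nonempty with h0 | h0
  · rw [h0]; simp
  have hmem : ∀ a ∈ s, |(a : ℤ) * d - k * W| < R := fun a ha => (Finset.mem_filter.1 ha).2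
  have hsub : s ⊆ Finset.Icc (s.min' h0) (s.min' h0 + 2 * R / d) := by
    intro a ha
    have hle := s.min'_le a ha
    rw [Finset.mem_Icc]
    refine ⟨hle, ?_⟩
    have h1 := abs_lt.1 (hmem a ha)
    have h2 := abs_lt.1 (hmem _ (s.min'_mem h0))
    have h3 : (a - s.min' h0) * d ≤ 2 * R := by
      zify [hle]
      nlinarith
    have := (Nat.le_div_iff_mul_le hd).2 h3
    omega
  refine (Finset.card_le_card hsub).trans ?_
  rw [Nat.card_Icc]
  generalize 2 * R / d = q
  omega

/-- The product a·d can be close to the multiples k·2^w with 0 ≤ k ≤ d, and each admits at most 2R/d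
+ 1 multipliers. Altogether (d + 1)(2R/d + 1) ≤ 6R, as d ≤ R. The smallness of d replaces the usual
requirement of an odd multiplier. -/
theorem pr_near_le_of_pos {w R d : ℕ} (hd : 0 < d) (hdR : d ≤ R) (hR : R ≤ 2 ^ w) :
    pr (fun a : BitVec w => Near w a.toNat d R) ≤ 6 * R / 2 ^ w := by
  have h := pr_bitVec_le (w := w) (N := 6 * R) (fun a => Near w a d R)
    ((Finset.range (d + 1)).biUnion fun k =>
      (Finset.range (2 ^ w)).filter fun a : ℕ => |(a : ℤ) * d - k * (2 ^ w : ℕ)| < R) ?_ ?_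
  · push_cast at h; exact h
  · rintro a ha ⟨v, hv, k, hk⟩
    have hW : (0 : ℤ) < 2 ^ w := by positivity
    have hR' : (R : ℤ) ≤ 2 ^ w := by exact_mod_cast hR
    have ha' : (a : ℤ) < 2 ^ w := by exact_mod_cast ha
    have hv' := abs_lt.1 hv
    have h0 : 0 ≤ k := by
      by_contra hneg
      have : (2 : ℤ) ^ w * k ≤ 2 ^ w * (-1) := mul_le_mul_of_nonneg_left (by omega) hW.le
      have : (0 : ℤ) ≤ a * d := by positivity
      linarith
    have h1 : k ≤ d := by
      by_contra hneg
      have h2 : (2 : ℤ) ^ w * (d + 1) ≤ 2 ^ w * k := mul_le_mul_of_nonneg_left (by omega) hW.le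
      have h3 : (a : ℤ) * d ≤ 2 ^ w * d := mul_le_mul_of_nonneg_right ha'.le (by positivity)
      linarith
    obtain ⟨k, rfl⟩ := Int.eq_ofNat_of_zero_le h0
    refine Finset.mem_biUnion.2 ⟨k, Finset.mem_range.2 (by omega), Finset.mem_filter.2
      ⟨Finset.mem_range.2 ha, ?_⟩⟩
    have e : (a : ℤ) * d - k * (2 ^ w : ℕ) = v := by push_cast; linarith
    rw [e]; exact hv
  · refine (Finset.card_biUnion_le_card_mul _ _ (2 * R / d + 1) fun k _ =>
      card_filter_close_le _ _ _ _ _ hd).trans ?_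
    rw [Finset.card_range]
    have h1 := Nat.div_mul_le_self (2 * R) d
    have h2 := Nat.div_le_self (2 * R) d
    nlinarith

theorem Near.neg {w a R : ℕ} {d : ℤ} (h : Near w a d R) : Near w a (-d) R := by
  obtain ⟨v, hv, k, hk⟩ := h
  exact ⟨-v, by rwa [abs_neg], -k, by linear_combination -hk⟩

theorem pr_near_le {w R : ℕ} {d : ℤ} (hd : d ≠ 0) (hdR : |d| ≤ R) (hR : R ≤ 2 ^ w) :
    pr (fun a : BitVec w => Near w a.toNat d R) ≤ 6 * R / 2 ^ w := by
  have hpos : 0 < d.natAbs := Int.natAbs_pos.2 hd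
  have hle : d.natAbs ≤ R := by zify; exact hdR
  refine le_trans (pr_mono fun a h => ?_) (pr_near_le_of_pos hpos hle hR)
  rcases Int.natAbs_eq d with e | e
  · rwa [← e]
  · have := h.neg
    rwa [e, neg_neg] at this

theorem pr_survives (w κ : ℕ) (hκ : κ ≤ w) :
    pr (fun a : BitVec w => a.toNat >>> (w - κ) = 0) = 1 / 2 ^ κ := by
  classical
  have h1 : (Finset.univ.filter fun a : BitVec w => a.toNat >>> (w - κ) = 0).card =
      2 ^ (w - κ) := by
    rw [← Finset.card_range (2 ^ (w - κ))]
    refine Finset.card_bij (fun a _ => a.toNat) ?_ (fun x _ y _ h => BitVec.eq_of_toNat_eq h) ?_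
    · intro a ha
      simp only [Finset.mem_filter, Finset.mem_univ, true_and, Nat.shiftRight_eq_div_pow,
        Nat.div_eq_zero_iff] at ha
      rcases ha with ha | ha
      · exact absurd ha (by positivity)
      · exact Finset.mem_range.2 ha
    · intro b hb
      rw [Finset.mem_range] at hb
      have hbw : b < 2 ^ w := hb.trans_le (Nat.pow_le_pow_right (by norm_num) (by omega))
      refine ⟨BitVec.ofNat w b, ?_, ?_⟩
      · simp only [Finset.mem_filter, Finset.mem_univ, true_and, Nat.shiftRight_eq_div_pow,
          Nat.div_eq_zero_iff, BitVec.toNat_ofNat, Nat.mod_eq_of_lt hbw]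
        exact Or.inr hb
      · simp [Nat.mod_eq_of_lt hbw]
  rw [pr_eq_filter, card_bitVec, h1]
  push_cast
  rw [div_eq_div_iff (by positivity) (by positivity), ← pow_add, one_mul, Nat.sub_add_cancel hκ]

/-! ### Collision probabilities for the two hash functions. -/

namespace Dim

variable {w : ℕ} {D : Dim w} {In : ℕ → ℕ} {val : ℕ → ℤ}

/-- The words `In y` represent the small integers `val y`. -/
structure Small (D : Dim w) (In : ℕ → ℕ) (val : ℕ → ℤ) : Prop where
  lt : ∀ y < 3 * D.n, In y < 2 ^ w
  dvd : ∀ y < 3 * D.n, (2 ^ w : ℤ) ∣ In y - val y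
  -- The factor 4 allows for differences of two sums, which involve four values.
  abs_le : ∀ y < 3 * D.n, 4 * |val y| ≤ 2 ^ (w - D.l1)

theorem l2_le_l1 (D : Dim w) : D.l2 ≤ D.l1 := by
  have h := D.hSQ
  rw [D.hS, D.hQ] at h
  exact (Nat.pow_le_pow_iff_right (by norm_num : 1 < 2)).1 (by omega)

theorem shift_mul_Q (D : Dim w) : (2 : ℝ) ^ (w - D.l1) * D.Q = 2 ^ w := by
  rw [D.hQ]; push_cast; rw [← pow_add, Nat.sub_add_cancel D.l1_le]

theorem shift_mul_S (D : Dim w) : (2 : ℝ) ^ (w - D.l2) * D.S = 2 ^ w := by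
  rw [D.hS]; push_cast; rw [← pow_add, Nat.sub_add_cancel D.l2_le]

theorem S_pos (D : Dim w) : (0 : ℝ) < D.S := by have := D.two_le_S; positivity

theorem Q_pos (D : Dim w) : (0 : ℝ) < D.Q := by
  have h1 := D.two_le_S
  have h2 := D.hSQ
  exact Nat.cast_pos.2 (by omega)

/-- Words in two's complement need not be small as numbers. Modulo `2 ^ w` the difference is that of
the represented integers, which is small and nonzero, so `pr_near_le` applies. -/
theorem Small.pr_near_pair_le (h : D.Small In val) {i j x y R : ℕ} (hi : i < 3 * D.n)
    (hj : j < 3 * D.n) (hx : x < 3 * D.n) (hy : y < 3 * D.n)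
    (hne : (In i + In j) % 2 ^ w ≠ (In x + In y) % 2 ^ w) (hR : 2 ^ (w - D.l1) ≤ R)
    (hR' : R ≤ 2 ^ w) :
    pr (fun a : BitVec w => Near w a.toNat ((In i : ℤ) + In j - (In x + In y)) R) ≤
      6 * R / 2 ^ w := by
  have hd : (2 ^ w : ℤ) ∣ (val i + val j - (val x + val y)) - (In i + In j - (In x + In y)) := by
    obtain ⟨a, ha⟩ := h.dvd i hi
    obtain ⟨b, hb⟩ := h.dvd j hj
    obtain ⟨c, hc⟩ := h.dvd x hx
    obtain ⟨d, hd⟩ := h.dvd y hy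
    exact ⟨c + d - a - b, by linear_combination hc + hd - ha - hb⟩
  refine (pr_mono fun a ha => ha.congr hd).trans (pr_near_le ?_ ?_ hR')
  · intro h0
    rw [h0, zero_sub, dvd_neg] at hd
    apply hne
    have : ((In x + In y : ℕ) : ℤ) ≡ ((In i + In j : ℕ) : ℤ) [ZMOD ((2 ^ w : ℕ) : ℤ)] := by
      rw [Int.modEq_iff_dvd]
      push_cast
      exact hd
    exact ((Int.natCast_modEq_iff.1 this).symm : _)
  · have e1 := h.abs_le i hi
    have e2 := h.abs_le j hj
    have e3 := h.abs_le x hx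
    have e4 := h.abs_le y hy
    have hR2 : (2 : ℤ) ^ (w - D.l1) ≤ R := by exact_mod_cast hR
    have := abs_sub (val i + val j) (val x + val y)
    have := abs_add_le (val i) (val j)
    have := abs_add_le (val x) (val y)
    linarith

theorem Small.pr_near_le (h : D.Small In val) {i x R : ℕ} (hi : i < 3 * D.n) (hx : x < 3 * D.n)
    (hne : In i ≠ In x) (hR : 2 ^ (w - D.l1) ≤ R) (hR' : R ≤ 2 ^ w) :
    pr (fun a : BitVec w => Near w a.toNat ((In i : ℤ) - In x) R) ≤ 6 * R / 2 ^ w := by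
  have h1 := h.pr_near_pair_le (i := i) (j := x) (x := x) (y := x) hi hx hx hx ?_ hR hR'
  · refine le_trans (pr_mono fun a ha => ?_) h1
    rwa [add_sub_add_right_eq_sub]
  · intro h2
    apply hne
    have h3 : In i ≡ In x [MOD 2 ^ w] := Nat.ModEq.add_right_cancel' (In x) h2
    exact Nat.ModEq.eq_of_lt_of_lt h3 (h.lt i hi) (h.lt x hx)

theorem Small.pr_q2_le (h : D.Small In val) {i x : ℕ} (hi : i < 3 * D.n) (hx : x < 3 * D.n)
    (hne : In i ≠ In x) :
    pr (fun a : BitVec w => D.q2 a.toNat (In i) = D.q2 a.toNat (In x)) ≤ 6 / D.S := by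
  have h1 := h.pr_near_le hi hx hne (R := 2 ^ (w - D.l2))
    (Nat.pow_le_pow_right (by norm_num) (Nat.sub_le_sub_left D.l2_le_l1 _))
    (Nat.pow_le_pow_right (by norm_num) (Nat.sub_le _ _))
  refine (pr_mono fun a ha => ?_).trans (h1.trans (le_of_eq ?_))
  · have := near_of_mulHash_eq D.l2_le (a := a.toNat) (x := In i) (x' := In x) (r := 0) (δ := 0)
      (N := 1) (by rw [zero_mul, add_zero, add_zero]; exact congrArg Nat.cast ha) (by norm_num)
    rwa [one_mul] at this
  · have := D.S_pos
    rw [← D.shift_mul_S]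
    push_cast
    field_simp

theorem Small.pr_exists_near_le (h : D.Small In val) {o x : ℕ} (ho : o + D.n ≤ 3 * D.n)
    (hx : x < 3 * D.n) :
    pr (fun a : BitVec w => ∃ i ∈ Finset.range D.n, In (o + i) ≠ In x ∧
      Near w a.toNat ((In (o + i) : ℤ) - In x) (8 * D.S * 2 ^ (w - D.l1))) ≤
      D.n * (48 * D.S / D.Q) := by
  have hSQ := D.hSQ
  have h2 := D.two_le_S
  refine (pr_exists_le_mul _ _ (δ := 48 * D.S / D.Q) fun i hi => ?_).trans (by simp)
  have hi' := Finset.mem_range.1 hi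
  by_cases hne : In (o + i) = In x
  · refine le_trans (pr_mono (F := fun _ => False) fun a ha => ha.1 hne) ?_
    have := D.S_pos
    have := D.Q_pos
    simp only [pr, if_false, Finset.sum_const_zero, zero_div]
    positivity
  · refine (pr_mono fun a ha => ha.2).trans ((h.pr_near_le (by omega) hx hne ?_ ?_).trans
      (le_of_eq ?_))
    · exact Nat.le_mul_of_pos_left _ (by omega)
    · calc 8 * D.S * 2 ^ (w - D.l1) ≤ D.Q * 2 ^ (w - D.l1) := Nat.mul_le_mul_right _ (by omega)
        _ = 2 ^ w := by rw [D.hQ, ← pow_add]; congr 1; have := D.l1_le; omega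
    · have := D.Q_pos
      rw [← D.shift_mul_Q]
      push_cast
      field_simp
      ring

/-- The values in a block of the input that have the same hash value as `In x`. -/
def bucket (D : Dim w) (In : ℕ → ℕ) (o a x : ℕ) : Finset ℕ :=
  (((Finset.range D.n).image fun i => In (o + i)).erase (In x)).filter fun v =>
    D.q2 a v = D.q2 a (In x)

/-- At most n values each share the colour with probability at most 6/S; Markov's inequality does
the rest. -/
theorem Small.pr_bucket_le (h : D.Small In val) {o x H : ℕ} (ho : o + D.n ≤ 3 * D.n)
    (hx : x < 3 * D.n) (hH : 0 < H) :
    pr (fun a : BitVec w => H ≤ (D.bucket In o a.toNat x).card) ≤ D.n * (6 / D.S) / H := by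
  have hS := D.S_pos
  refine le_trans (le_trans (le_of_eq ?_) (pr_card_ge_le (Ω := BitVec w)
    (((Finset.range D.n).image fun i => In (o + i)).erase (In x))
    (fun v a => D.q2 a.toNat v = D.q2 a.toNat (In x)) (δ := 6 / D.S) hH ?_)) ?_
  · congr! 4
  · intro v hv
    obtain ⟨hne, hv⟩ := Finset.mem_erase.1 hv
    obtain ⟨i, hi, rfl⟩ := Finset.mem_image.1 hv
    have := Finset.mem_range.1 hi
    exact h.pr_q2_le (by omega) hx hne
  · gcongr
    refine (Finset.card_erase_le).trans (Finset.card_image_le.trans ?_)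
    simp

/-- The colour multiplier is fixed and only the position multiplier is random. The union bound runs
over pairs of values: each bucket together with its reference value has at most H elements. -/
theorem Small.pr_noFalse_le (h : D.Small In val) {x y a₂ H : ℕ} (hx : x < D.n) (hy : y < D.n)
    (hA : (D.bucket In 0 a₂ x).card < H) (hB : (D.bucket In D.n a₂ (D.n + y)).card < H) :
    pr (fun a : BitVec w => ∃ i < D.n, ∃ j < D.n, D.q2 a₂ (In i) = D.q2 a₂ (In x) ∧
      D.q2 a₂ (In (D.n + j)) = D.q2 a₂ (In (D.n + y)) ∧
      (In i + In (D.n + j)) % 2 ^ w ≠ (In x + In (D.n + y)) % 2 ^ w ∧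
      Near w a.toNat ((In i : ℤ) + In (D.n + j) - (In x + In (D.n + y))) (2 * 2 ^ (w - D.l1))) ≤
      H * H * (12 / D.Q) := by
  have hSQ := D.hSQ
  have h2 := D.two_le_S
  have hQ := D.Q_pos
  set s := insert (In x) (D.bucket In 0 a₂ x) ×ˢ
    insert (In (D.n + y)) (D.bucket In D.n a₂ (D.n + y)) with hs
  have hcard : s.card ≤ H * H := by
    rw [hs, Finset.card_product]
    exact Nat.mul_le_mul ((Finset.card_insert_le _ _).trans hA) ((Finset.card_insert_le _ _).trans hB)
  refine (pr_mono (F := fun a : BitVec w => ∃ p ∈ s, (∃ i < D.n, ∃ j < D.n, p.1 = In i ∧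
    p.2 = In (D.n + j)) ∧ (p.1 + p.2) % 2 ^ w ≠ (In x + In (D.n + y)) % 2 ^ w ∧
    Near w a.toNat ((p.1 : ℤ) + p.2 - (In x + In (D.n + y))) (2 * 2 ^ (w - D.l1))) ?_).trans
    ((pr_exists_le_mul s _ (δ := 12 / D.Q) ?_).trans ?_)
  · rintro a ⟨i, hi, j, hj, h3, h4, h5, h6⟩
    refine ⟨(In i, In (D.n + j)), ?_, ⟨i, hi, j, hj, rfl, rfl⟩, h5, h6⟩
    rw [hs, Finset.mem_product]
    constructor
    · rw [Finset.mem_insert, or_iff_not_imp_left]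
      intro hne
      exact Finset.mem_filter.2 ⟨Finset.mem_erase.2 ⟨hne, Finset.mem_image.2
        ⟨i, Finset.mem_range.2 hi, by rw [zero_add]⟩⟩, h3⟩
    · rw [Finset.mem_insert, or_iff_not_imp_left]
      intro hne
      exact Finset.mem_filter.2 ⟨Finset.mem_erase.2 ⟨hne, Finset.mem_image.2
        ⟨j, Finset.mem_range.2 hj, rfl⟩⟩, h4⟩
  · rintro ⟨v, v'⟩ -
    by_cases hc : (∃ i < D.n, ∃ j < D.n, v = In i ∧ v' = In (D.n + j)) ∧
        (v + v') % 2 ^ w ≠ (In x + In (D.n + y)) % 2 ^ w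
    · obtain ⟨⟨i, hi, j, hj, rfl, rfl⟩, hne⟩ := hc
      refine (pr_mono fun a ha => ha.2.2).trans ((h.pr_near_pair_le (by omega) (by omega)
        (by omega) (by omega) hne (by omega) ?_).trans (le_of_eq ?_))
      · calc 2 * 2 ^ (w - D.l1) ≤ D.Q * 2 ^ (w - D.l1) := Nat.mul_le_mul_right _ (by omega)
          _ = 2 ^ w := by rw [D.hQ, ← pow_add]; congr 1; have := D.l1_le; omega
      · rw [← D.shift_mul_Q]
        push_cast
        field_simp
        ring
    · refine le_trans (pr_mono (F := fun _ => False) fun a ha => hc ⟨ha.1, ha.2.1⟩) ?_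
      simp only [pr, if_false, Finset.sum_const_zero, zero_div]
      positivity
  · refine mul_le_mul_of_nonneg_right ?_ (by positivity)
    exact_mod_cast hcard

theorem Small.pr_noTrue_le (h : D.Small In val) {x K : ℕ} (hx : x < D.n) (J : Finset ℕ)
    (hJ : J ⊆ Finset.range D.n) (hK : J.card ≤ K) :
    pr (fun a : BitVec w => ∃ i ∈ J, In i ≠ In x ∧ D.q2 a.toNat (In i) = D.q2 a.toNat (In x)) ≤
      K * (6 / D.S) := by
  have hS := D.S_pos
  refine (pr_exists_le_mul J _ (δ := 6 / D.S) fun i hi => ?_).trans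
    (mul_le_mul_of_nonneg_right (by exact_mod_cast hK) (by positivity))
  have hi' := Finset.mem_range.1 (hJ hi)
  by_cases hne : In i = In x
  · refine le_trans (pr_mono (F := fun _ => False) fun a ha => ha.1 hne) ?_
    simp only [pr, if_false, Finset.sum_const_zero, zero_div]
    positivity
  · exact (pr_mono fun a ha => ha.2).trans (h.pr_q2_le (by omega) (by omega) hne)

end Dim

/-! ### Random words on the tape -/

theorem tape_update_self {w T : ℕ} (ω : Fin T → BitVec w) (i : Fin T) (a : BitVec w) :
    tape (Function.update ω i a) i = a := by
  simp [tape]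

theorem tape_update_ne {w T : ℕ} (ω : Fin T → BitVec w) (i : Fin T) (a : BitVec w) {j : ℕ}
    (h : j ≠ i) : tape (Function.update ω i a) j = tape ω j := by
  unfold tape
  split_ifs with hj
  · rw [Function.update_of_ne]
    intro h'
    exact h (by rw [← h'])
  · rfl

theorem pr_tape_survives {w T c κ : ℕ} (hκ : κ ≤ w) (hc : c < T) :
    pr (fun ω : Fin T → BitVec w => (tape ω c).toNat >>> (w - κ) = 0) ≤ 1 / 2 ^ κ := by
  have h := pr_and_le (V := BitVec w) (⟨c, hc⟩ : Fin T) (fun _ => True)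
    (fun ω => (tape ω c).toNat >>> (w - κ) = 0) (δ := 1 / 2 ^ κ) (fun _ _ => Iff.rfl) ?_
  · simp only [true_and] at h
    exact h.trans (mul_le_of_le_one_right (by positivity) (pr_le_one _))
  · intro ω _
    have e : ∀ a, tape (Function.update ω ⟨c, hc⟩ a) c = a := fun a =>
      tape_update_self ω ⟨c, hc⟩ a
    simp only [e]
    exact (pr_survives w κ hκ).le

/-- Independence of the sampling words is used one word at a time, through `pr_and_le`. -/
theorem pr_tape_no_survivor {w T κ b : ℕ} (hκ : κ ≤ w) (I : Finset ℕ) (hI : ∀ i ∈ I, b + i < T) :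
    pr (fun ω : Fin T → BitVec w => ∀ i ∈ I, (tape ω (b + i)).toNat >>> (w - κ) ≠ 0) ≤
      (1 - 1 / 2 ^ κ) ^ I.card := by
  classical
  have hq : (1 : ℝ) / 2 ^ κ ≤ 1 := by
    rw [div_le_one (by positivity)]; exact one_le_pow₀ (by norm_num)
  induction I using Finset.induction_on with
  | empty => simpa using pr_le_one _
  | insert c I hcI ih =>
    have hc := hI c (Finset.mem_insert_self _ _)
    have ih := ih fun i hi => hI i (Finset.mem_insert_of_mem hi)
    rw [Finset.card_insert_of_notMem hcI, pow_succ']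
    refine le_trans (le_trans (pr_mono ?_) (pr_and_le (V := BitVec w) (⟨b + c, hc⟩ : Fin T)
      (fun ω => ∀ i ∈ I, (tape ω (b + i)).toNat >>> (w - κ) ≠ 0)
      (fun ω => ¬ (tape ω (b + c)).toNat >>> (w - κ) = 0) (δ := 1 - 1 / 2 ^ κ) ?_ ?_))
      (mul_le_mul_of_nonneg_left ih (by linarith))
    · intro ω h
      exact ⟨fun i hi => h i (Finset.mem_insert_of_mem hi), h c (Finset.mem_insert_self _ _)⟩
    · intro ω a
      refine forall₂_congr fun i hi => ?_
      rw [tape_update_ne]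
      intro h
      have : i = c := by simpa using h
      exact hcI (this ▸ hi)
    · intro ω _
      have e : ∀ a, tape (Function.update ω ⟨b + c, hc⟩ a) (b + c) = a := fun a =>
        tape_update_self ω ⟨b + c, hc⟩ a
      simp only [e]
      rw [pr_not, pr_survives w κ hκ]

namespace Dim

variable {w : ℕ} {D : Dim w} {In : ℕ → ℕ} {val : ℕ → ℤ}

/-- The randomness is exposed in the order sampling words, colour multiplier, position multiplier,
and every bad event is bounded given what was exposed before. The solution to be found depends on
the sample only, so it is fixed when the multipliers are drawn. -/
theorem Small.pr_clear_ge (h : D.Small In val) {T b κ z K H : ℕ} (hκ : κ ≤ w)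
    (hT : b + (D.n + 2) ≤ T) (hz : z < D.n) (I : Finset ℕ)
    (hI : ∀ i, i ∈ I ↔ i < D.n ∧ ∃ j < D.n, (In i + In (D.n + j)) % 2 ^ w = In (2 * D.n + z))
    (hne : I.Nonempty) (hH : 0 < H) :
    1 - ((1 - 1 / 2 ^ κ : ℝ) ^ I.card + (I.card * (1 / 2 ^ κ) / (K + 1 : ℕ) +
      ((K * (6 / D.S) + (D.n * (6 / D.S) / H + D.n * (6 / D.S) / H)) +
      (D.n * (48 * D.S / D.Q) + (D.n * (48 * D.S / D.Q) + (D.n * (48 * D.S / D.Q) +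
      H * H * (12 / D.Q))))))) ≤
    pr (fun ω : Fin T → BitVec w => ∃ x < D.n, ∃ y < D.n,
      (In x + In (D.n + y)) % 2 ^ w = In (2 * D.n + z) ∧
      D.Clear In κ (tape ω b).toNat (tape ω (b + 1)).toNat
        (fun j => (tape ω (b + 2 + j)).toNat) x y z) := by
  classical
  have hsel : ∀ i, ∃ j, i ∈ I → j < D.n ∧ (In i + In (D.n + j)) % 2 ^ w = In (2 * D.n + z) := by
    intro i
    by_cases hi : i ∈ I
    · obtain ⟨j, hj⟩ := ((hI i).1 hi).2
      exact ⟨j, fun _ => hj⟩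
    · exact ⟨0, fun h => absurd h hi⟩
  choose f hf using hsel
  -- The pick is total: without survivors it is an arbitrary element of `I`, a case counted as
  -- failure in `N`.
  have hpick : ∀ ρ : ℕ → ℕ, ∃ x ∈ I, (∃ i ∈ I, survives w κ ρ i) → survives w κ ρ x := by
    intro ρ
    by_cases hs : ∃ i ∈ I, survives w κ ρ i
    · obtain ⟨i, hi, hs⟩ := hs
      exact ⟨i, hi, fun _ => hs⟩
    · obtain ⟨i, hi⟩ := hne
      exact ⟨i, hi, fun h => absurd h hs⟩
  choose g hgI hgs using hpick
  have hgn : ∀ ρ, g ρ < D.n := fun ρ => ((hI _).1 (hgI ρ)).1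
  have hfn : ∀ ρ, f (g ρ) < D.n := fun ρ => (hf _ (hgI ρ)).1
  let ρ : (Fin T → BitVec w) → ℕ → ℕ := fun ω j => (tape ω (b + 2 + j)).toNat
  let a₁ : (Fin T → BitVec w) → ℕ := fun ω => (tape ω b).toNat
  let a₂ : (Fin T → BitVec w) → ℕ := fun ω => (tape ω (b + 1)).toNat
  let N : (ℕ → ℕ) → Prop := fun r => ∀ i ∈ I, ¬ survives w κ r i
  let L : (ℕ → ℕ) → Prop := fun r => K + 1 ≤ (I.filter fun i => survives w κ r i).card
  let F₂ : (ℕ → ℕ) → ℕ → Prop := fun r a =>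
    (∃ i ∈ I.filter (fun i => survives w κ r i), In i ≠ In (g r) ∧
      D.q2 a (In i) = D.q2 a (In (g r))) ∨
    (H ≤ (D.bucket In 0 a (g r)).card ∨ H ≤ (D.bucket In D.n a (D.n + f (g r))).card)
  let F₁ : (ℕ → ℕ) → ℕ → ℕ → Prop := fun r a a' =>
    (∃ i ∈ Finset.range D.n, In (0 + i) ≠ In (g r) ∧
      Near w a' ((In (0 + i) : ℤ) - In (g r)) (8 * D.S * 2 ^ (w - D.l1))) ∨
    ((∃ i ∈ Finset.range D.n, In (D.n + i) ≠ In (D.n + f (g r)) ∧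
      Near w a' ((In (D.n + i) : ℤ) - In (D.n + f (g r))) (8 * D.S * 2 ^ (w - D.l1))) ∨
    ((∃ i ∈ Finset.range D.n, In (2 * D.n + i) ≠ In (2 * D.n + z) ∧
      Near w a' ((In (2 * D.n + i) : ℤ) - In (2 * D.n + z)) (8 * D.S * 2 ^ (w - D.l1))) ∨
    (∃ i < D.n, ∃ j < D.n, D.q2 a (In i) = D.q2 a (In (g r)) ∧
      D.q2 a (In (D.n + j)) = D.q2 a (In (D.n + f (g r))) ∧
      (In i + In (D.n + j)) % 2 ^ w ≠ (In (g r) + In (D.n + f (g r))) % 2 ^ w ∧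
      Near w a' ((In i : ℤ) + In (D.n + j) - (In (g r) + In (D.n + f (g r))))
        (2 * 2 ^ (w - D.l1)))))
  have hρ1 : ∀ ω (i : Fin T) a, (i : ℕ) < b + 2 → ρ (Function.update ω i a) = ρ ω := by
    intro ω i a hi
    funext j
    simp only [ρ]
    rw [tape_update_ne _ _ _ (by omega)]
  have hb0 : b < T := by omega
  have hb1 : b + 1 < T := by omega
  have p0 : pr (fun ω => N (ρ ω)) ≤ (1 - 1 / 2 ^ κ : ℝ) ^ I.card :=
    pr_tape_no_survivor hκ I fun i hi => by have := ((hI i).1 hi).1; omega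
  have pL : pr (fun ω => L (ρ ω)) ≤ I.card * (1 / 2 ^ κ) / (K + 1 : ℕ) := by
    refine pr_card_ge_le I (fun i (ω : Fin T → BitVec w) => survives w κ (ρ ω) i)
      (Nat.succ_pos K) fun i hi => pr_tape_survives hκ ?_
    have := ((hI i).1 hi).1
    omega
  have p2 : pr (fun ω => ¬ L (ρ ω) ∧ F₂ (ρ ω) (a₂ ω)) ≤
      K * (6 / D.S) + (D.n * (6 / D.S) / H + D.n * (6 / D.S) / H) := by
    refine (pr_and_le (V := BitVec w) (⟨b + 1, hb1⟩ : Fin T) _ _ ?_ ?_).trans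
      (mul_le_of_le_one_right ?_ (pr_le_one _))
    · intro ω a
      rw [hρ1 _ _ _ (by simp)]
    · intro ω hL
      have e : ∀ a, a₂ (Function.update ω ⟨b + 1, hb1⟩ a) = a.toNat := fun a =>
        congrArg BitVec.toNat (tape_update_self ω ⟨b + 1, hb1⟩ a)
      simp only [e, hρ1 ω ⟨b + 1, hb1⟩ _ (show b + 1 < b + 2 by omega)]
      refine (pr_or_le _ _).trans (add_le_add ?_ ((pr_or_le _ _).trans (add_le_add ?_ ?_)))
      · refine h.pr_noTrue_le (hgn _) _ ?_ (by simp only [L] at hL; omega)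
        intro i hi
        exact Finset.mem_range.2 ((hI i).1 (Finset.mem_filter.1 hi).1).1
      · exact h.pr_bucket_le (by omega) (by have := hgn (ρ ω); omega) hH
      · exact h.pr_bucket_le (by omega) (by have := hfn (ρ ω); omega) hH
    · have := D.S_pos
      positivity
  have p1 : pr (fun ω => ¬ F₂ (ρ ω) (a₂ ω) ∧ F₁ (ρ ω) (a₂ ω) (a₁ ω)) ≤
      D.n * (48 * D.S / D.Q) + (D.n * (48 * D.S / D.Q) + (D.n * (48 * D.S / D.Q) +
      H * H * (12 / D.Q))) := by
    have e2 : ∀ ω a, a₂ (Function.update ω ⟨b, hb0⟩ a) = a₂ ω := fun ω a =>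
      congrArg BitVec.toNat (tape_update_ne ω ⟨b, hb0⟩ a (by simp))
    refine (pr_and_le (V := BitVec w) (⟨b, hb0⟩ : Fin T) _ _ ?_ ?_).trans
      (mul_le_of_le_one_right ?_ (pr_le_one _))
    · intro ω a
      rw [hρ1 _ _ _ (by simp), e2]
    · intro ω hF
      have e : ∀ a, a₁ (Function.update ω ⟨b, hb0⟩ a) = a.toNat := fun a =>
        congrArg BitVec.toNat (tape_update_self ω ⟨b, hb0⟩ a)
      simp only [e, e2, hρ1 ω ⟨b, hb0⟩ _ (show b < b + 2 by omega)]
      have hg := hgn (ρ ω)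
      have hfg := hfn (ρ ω)
      refine (pr_or_le _ _).trans (add_le_add (h.pr_exists_near_le (by omega) (by omega))
        ((pr_or_le _ _).trans (add_le_add (h.pr_exists_near_le (by omega) (by omega))
        ((pr_or_le _ _).trans (add_le_add (h.pr_exists_near_le (by omega) (by omega))
        (h.pr_noFalse_le hg hfg ?_ ?_))))))
      · by_contra hc
        exact hF (Or.inr (Or.inl (not_lt.1 hc)))
      · by_contra hc
        exact hF (Or.inr (Or.inr (not_lt.1 hc)))
    · have := D.S_pos
      have := D.Q_pos
      positivity
  -- Beyond the two sampling failures, each multiplier's bad event is counted only where the event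
  -- needed for its bound has not failed.
  have hbad := (pr_or_le (fun ω => N (ρ ω)) fun ω => L (ρ ω) ∨
    (¬ L (ρ ω) ∧ F₂ (ρ ω) (a₂ ω)) ∨ (¬ F₂ (ρ ω) (a₂ ω) ∧ F₁ (ρ ω) (a₂ ω) (a₁ ω))).trans
    (add_le_add p0 ((pr_or_le _ _).trans (add_le_add pL ((pr_or_le _ _).trans (add_le_add p2 p1)))))
  refine (sub_le_sub_left hbad 1).trans ?_
  rw [← pr_not]
  apply pr_mono
  intro ω hω
  push Not at hω
  obtain ⟨hN, hL, h2, h1⟩ := hω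
  have hL' : ¬ L (ρ ω) := hL
  have hF₂ : ¬ F₂ (ρ ω) (a₂ ω) := h2 hL'
  have hF₁ : ¬ F₁ (ρ ω) (a₂ ω) (a₁ ω) := h1 hF₂
  have hsum := (hf _ (hgI (ρ ω))).2
  refine ⟨g (ρ ω), hgn _, f (g (ρ ω)), hfn _, hsum, ?_⟩
  have hs : ∃ i ∈ I, survives w κ (ρ ω) i := by
    by_contra hc
    exact hN fun i hi hs => hc ⟨i, hi, hs⟩
  refine ⟨hgs _ hs, ?_, ?_, ?_, ?_, ?_⟩
  · intro i hi hne hnear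
    exact hF₁ (Or.inl ⟨i, Finset.mem_range.2 hi, by rwa [zero_add], by rwa [zero_add]⟩)
  · intro i hi hne hnear
    exact hF₁ (Or.inr (Or.inl ⟨i, Finset.mem_range.2 hi, hne, hnear⟩))
  · intro i hi hne hnear
    exact hF₁ (Or.inr (Or.inr (Or.inl ⟨i, Finset.mem_range.2 hi, hne, hnear⟩)))
  · intro i hi j hj h3 h4 h5 hnear
    exact hF₁ (Or.inr (Or.inr (Or.inr ⟨i, hi, j, hj, h3, h4, by rwa [hsum], hnear⟩)))
  · intro i hi hsi hne hq j hj hij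
    exact hF₂ (Or.inl ⟨i, Finset.mem_filter.2 ⟨(hI i).2 ⟨hi, j, hj, hij⟩, hsi⟩, hne, hq⟩)

end Dim

/-! ### The sampling rate and the total failure probability. -/

/-- By Bernoulli 1 + rq ≤ (1 + q)^r, and (1 - q)(1 + q) ≤ 1. -/
theorem one_sub_pow_le {q : ℝ} (h0 : 0 ≤ q) (h1 : q ≤ 1) (r : ℕ) :
    (1 - q) ^ r ≤ 1 / (1 + r * q) := by
  rw [le_div_iff₀ (by positivity)]
  have hb := one_add_mul_le_pow (a := q) (by linarith) r
  calc (1 - q) ^ r * (1 + r * q) ≤ (1 - q) ^ r * (1 + q) ^ r :=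
        mul_le_mul_of_nonneg_left hb (pow_nonneg (by linarith) r)
    _ = ((1 - q) * (1 + q)) ^ r := (mul_pow _ _ _).symm
    _ ≤ 1 := pow_le_one₀ (by nlinarith) (by nlinarith)

/-- A sampling rate for which a set of size `r` has some survivors, but not many. -/
theorem exists_sampling_rate {r : ℕ} (hr : 0 < r) : ∃ κ ≤ Nat.log 2 r,
    (1 - 1 / 2 ^ κ : ℝ) ^ r ≤ 1 / 33 ∧ r * (1 / 2 ^ κ : ℝ) ≤ 64 := by
  have h1 : r < 2 ^ (Nat.log 2 r + 1) := Nat.lt_pow_succ_log_self (by norm_num) r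
  have h2 : 2 ^ Nat.log 2 r ≤ r := Nat.pow_log_le_self 2 hr.ne'
  -- This leaves between 32 and 64 survivors in expectation. If r is small, the subtraction
  -- truncates to rate 1 and everything survives.
  refine ⟨Nat.log 2 r - 5, Nat.sub_le _ _, ?_, ?_⟩
  · rcases le_or_gt (Nat.log 2 r) 5 with h5 | h5
    · rw [Nat.sub_eq_zero_of_le h5, pow_zero, div_one, sub_self, zero_pow hr.ne']
      norm_num
    · have h3 : (2 : ℝ) ^ (Nat.log 2 r - 5) * 32 ≤ r := by
        have : 2 ^ (Nat.log 2 r - 5) * 2 ^ 5 ≤ r := by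
          rw [← pow_add, Nat.sub_add_cancel h5.le]; exact h2
        exact_mod_cast this
      refine (one_sub_pow_le (by positivity) ?_ r).trans ?_
      · rw [div_le_one (by positivity)]; exact one_le_pow₀ (by norm_num)
      · apply one_div_le_one_div_of_le (by norm_num)
        have : 32 ≤ (r : ℝ) * (1 / 2 ^ (Nat.log 2 r - 5)) := by
          rw [mul_one_div, le_div_iff₀ (by positivity)]; linarith
        linarith
  · have h3 : (r : ℝ) ≤ 2 ^ (Nat.log 2 r - 5) * 64 := by
      have : r ≤ 2 ^ (Nat.log 2 r - 5) * 2 ^ 6 := by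
        rw [← pow_add]
        exact h1.le.trans (Nat.pow_le_pow_right (by norm_num) (by omega))
      exact_mod_cast this
    rw [mul_one_div, div_le_iff₀ (by positivity)]
    linarith

/-- With x = 2^ell and y = 2^(lam - ell), S, Q and H are x, x²y and y up to constants, and N ≤ xy.
The powers of two in S and Q make every term small; only the false triples need y ≤ x², which is
`hlam`. -/
theorem failure_le {lam ell K : ℕ} {N r S Q H q : ℝ} (hell : ell ≤ lam) (hlam : lam ≤ 3 * ell)
    (hN0 : 0 ≤ N) (hN : N ≤ 2 ^ lam) (hS : S = 2 ^ (ell + 19)) (hQ : Q = 2 ^ (lam + ell + 40))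
    (hH : H = 2 ^ (lam - ell)) (hK : K = 2 ^ 11) (hq : q ≤ 1 / 33) (hr : r ≤ 64) :
    q + (r / (K + 1 : ℕ) +
      ((K * (6 / S) + (N * (6 / S) / H + N * (6 / S) / H)) +
      (N * (48 * S / Q) + (N * (48 * S / Q) + (N * (48 * S / Q) +
      H * H * (12 / Q)))))) ≤ 1 / 3 := by
  obtain ⟨c, rfl⟩ := Nat.exists_eq_add_of_le hell
  have hxp : (1 : ℝ) ≤ 2 ^ ell := one_le_pow₀ (by norm_num)
  have hyp : (1 : ℝ) ≤ 2 ^ c := one_le_pow₀ (by norm_num)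
  have hyx : (2 : ℝ) ^ c ≤ 2 ^ ell * 2 ^ ell := by
    rw [← pow_add]; exact pow_le_pow_right₀ (by norm_num) (by omega)
  rw [show ell + c - ell = c by omega] at hH
  rw [pow_add] at hS hN
  rw [pow_add, pow_add, pow_add] at hQ
  generalize (2 : ℝ) ^ ell = x at *
  generalize (2 : ℝ) ^ c = y at *
  have hxpos : 0 < x := by linarith
  have hypos : 0 < y := by linarith
  subst hK
  have e1 : r / ((2 ^ 11 + 1 : ℕ) : ℝ) ≤ 1 / 32 := by
    rw [div_le_iff₀ (by positivity)]; push_cast; linarith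
  have e2 : ((2 ^ 11 : ℕ) : ℝ) * (6 / S) ≤ 6 / 256 := by
    rw [hS, mul_div_assoc', div_le_iff₀ (by positivity)]; push_cast; nlinarith
  have e3 : N * (6 / S) / H ≤ 1 / 1024 := by
    rw [hS, hH, mul_div_assoc', div_div, div_le_iff₀ (by positivity)]
    nlinarith [mul_pos hxpos hypos]
  have e4 : N * (48 * S / Q) ≤ 1 / 1024 := by
    rw [hS, hQ, mul_div_assoc', div_le_iff₀ (by positivity)]
    have := mul_le_mul_of_nonneg_right hN (show (0 : ℝ) ≤ 48 * (x * 2 ^ 19) by positivity)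
    refine this.trans ?_
    nlinarith [mul_pos (mul_pos hxpos hypos) hxpos]
  have e5 : H * H * (12 / Q) ≤ 1 / 1024 := by
    rw [hH, hQ, mul_div_assoc', div_le_iff₀ (by positivity)]
    nlinarith [mul_le_mul_of_nonneg_right hyx hypos.le, mul_pos (mul_pos hxpos hypos) hxpos]
  linarith

/-! ### The success probability of the reduction -/

namespace Dim

variable {w : ℕ} {D : Dim w} {In : ℕ → ℕ} {val : ℕ → ℤ}

/-- The represented integers are too small for a sum to overflow. -/
theorem Small.sum_mod_eq_iff (h : D.Small In val) {i j l : ℕ} (hi : i < 3 * D.n) (hj : j < 3 * D.n)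
    (hl : l < 3 * D.n) : (In i + In j) % 2 ^ w = In l ↔ val i + val j = val l := by
  obtain ⟨a, ha⟩ := h.dvd i hi
  obtain ⟨b, hb⟩ := h.dvd j hj
  obtain ⟨c, hc⟩ := h.dvd l hl
  have e1 : (In i + In j) % 2 ^ w = In l ↔ (2 ^ w : ℤ) ∣ val l - (val i + val j) := by
    rw [← Nat.mod_eq_of_lt (h.lt l hl)]
    change In i + In j ≡ In l [MOD 2 ^ w] ↔ _
    rw [← Int.natCast_modEq_iff, Int.modEq_iff_dvd]
    push_cast
    constructor
    · rintro ⟨k, hk⟩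
      exact ⟨k - c + a + b, by linear_combination hk - hc + ha + hb⟩
    · rintro ⟨k, hk⟩
      exact ⟨k + c - a - b, by linear_combination hk + hc - ha - hb⟩
  rw [e1]
  constructor
  · intro hd
    have h1 := h.abs_le i hi
    have h2 := h.abs_le j hj
    have h3 := h.abs_le l hl
    have hle : (2 : ℤ) ^ (w - D.l1) ≤ 2 ^ w := pow_le_pow_right₀ (by norm_num) (Nat.sub_le _ _)
    have hpos : (0 : ℤ) < 2 ^ w := by positivity
    have h4 := abs_sub (val l) (val i + val j)
    have h5 := abs_add_le (val i) (val j)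
    have := Int.eq_zero_of_abs_lt_dvd hd (by linarith)
    linarith
  · intro he
    rw [he, sub_self]
    exact dvd_zero _

end Dim

/-- The entry of the input in a memory cell, as an integer. -/
def inputInt {n : ℕ} (A B C : Fin n → ℤ) (y : ℕ) : ℤ :=
  (List.ofFn A ++ List.ofFn B ++ List.ofFn C).getD y 0

section Input

variable {n : ℕ} (A B C : Fin n → ℤ)

theorem inputInt_first (i : Fin n) : inputInt A B C i = A i := by
  rw [inputInt, List.getD_eq_getElem _ _ (by simp; omega), List.getElem_append_left (by simp; omega),
    List.getElem_append_left (by simp), List.getElem_ofFn]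

theorem inputInt_second (i : Fin n) : inputInt A B C (n + i) = B i := by
  rw [inputInt, List.getD_eq_getElem _ _ (by simp; omega), List.getElem_append_left (by simp),
    List.getElem_append_right (by simp), List.getElem_ofFn]
  congr 1
  ext
  simp

theorem inputInt_third (i : Fin n) : inputInt A B C (2 * n + i) = C i := by
  rw [inputInt, List.getD_eq_getElem _ _ (by simp; omega),
    List.getElem_append_right (by simp; omega), List.getElem_ofFn]
  congr 1
  ext
  simp
  omega

theorem abs_inputInt_le {u : ℕ} (h : PolyBounded u A B C) {y : ℕ} (hy : y < 3 * n) :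
    |inputInt A B C y| ≤ (n : ℤ) ^ u := by
  rcases lt_or_ge y n with h1 | h1
  · rw [inputInt_first A B C ⟨y, h1⟩]
    exact (h _).1
  rcases lt_or_ge y (2 * n) with h2 | h2
  · have e := inputInt_second A B C ⟨y - n, by omega⟩
    rw [show n + ((⟨y - n, by omega⟩ : Fin n) : ℕ) = y by simp; omega] at e
    rw [e]
    exact (h _).2.1
  · have e := inputInt_third A B C ⟨y - 2 * n, by omega⟩
    rw [show 2 * n + ((⟨y - 2 * n, by omega⟩ : Fin n) : ℕ) = y by simp; omega] at e
    rw [e]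
    exact (h _).2.2

end Input

/-- Inputs have at most u `lamOf n` bits. The summand u in the word length leaves room for them
below the top bits used by `q1`. -/
theorem small_input {k k' n u : ℕ} (hk' : 4 ≤ k') (hk : 45 * k' + 200 ≤ k)
    (hu : u + 45 * k' + 200 ≤ k) {A B C : Fin n → ℤ} (h : PolyBounded u A B C) :
    (dim k k' n hk' hk).Small (inputCell (wordLength k n) A B C) (inputInt A B C) := by
  refine ⟨fun y _ => BitVec.isLt _, fun y _ => ?_, fun y hy => ?_⟩
  · unfold inputCell
    rw [BitVec.toNat_ofInt]
    change _ ∣ ((inputInt A B C y % _).toNat : ℤ) - _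
    have hpos : (0 : ℤ) < 2 ^ wordLength k n := by positivity
    push_cast
    rw [Int.toNat_of_nonneg (Int.emod_nonneg _ hpos.ne')]
    exact (Int.dvd_self_sub_emod).neg_right.trans (by rw [neg_sub])
  · have h1 := abs_inputInt_le A B C h hy
    have h2 : (n : ℤ) ^ u ≤ 2 ^ (lamOf n * u) := by
      rw [pow_mul]
      exact pow_le_pow_left₀ (by positivity) (by exact_mod_cast (lt_two_pow_lamOf n).le) u
    have h3 : 2 + lamOf n * u ≤ wordLength k n - (lamOf n + ellOf n + 40) := by
      have h4 : (u + 45 * k' + 200) * lamOf n ≤ k * lamOf n := Nat.mul_le_mul_right _ hu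
      have h5 : (u + 45 * k' + 200) * lamOf n = lamOf n * u + 45 * k' * lamOf n + 200 * lamOf n := by
        ring
      have h6 := ellOf_le n
      have h7 : 1 ≤ lamOf n := by unfold lamOf; omega
      change _ ≤ k * lamOf n - _
      omega
    calc 4 * |inputInt A B C y| ≤ 2 ^ 2 * 2 ^ (lamOf n * u) := by linarith
      _ = 2 ^ (2 + lamOf n * u) := (pow_add _ _ _).symm
      _ ≤ _ := pow_le_pow_right₀ (by norm_num) h3

theorem prob_eq_pr {w T : ℕ} (E : (Fin T → BitVec w) → Prop) : prob E = pr E :=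
  (pr_eq_card E).symm

/-- A single z that occurs in a solution is fixed, and the level is chosen according to the number
of its partners. `hdraw` ensures that the tape covers all words drawn. -/
theorem reduction_correct {k k' n u : ℕ} (hk' : 4 ≤ k') (hk : 45 * k' + 200 ≤ k)
    (hu : u + 45 * k' + 200 ≤ k) {P : Program} {T T' : ℕ} (hdet : P.Deterministic)
    (hP : Solves P (dim k k' n hk' hk).w' (dim k k' n hk' hk).m T) {A B C : Fin n → ℤ}
    (h : PolyBounded u A B C) (hT' : mainTime (dim k k' n hk' hk) P T ≤ T')
    (hdraw : lamOf n * (n + 2) ≤ T') :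
    let final := fun ω : Fin T' → BitVec (wordLength k n) =>
      run ((mainFrag k k' P).code 0) (tape ω) T' (init (wordLength k n) A B C)
    (∀ ω, (final ω).Halted ((mainFrag k k' P).code 0)) ∧
      2 / 3 ≤ prob fun ω => (final ω).reg 0 = BitVec.ofNat (wordLength k n) (threeSum A B C) := by
  intro final
  have hsmall := small_input hk' hk hu h
  set D := dim k k' n hk' hk with hD
  have hn : D.n = n := rfl
  set In := inputCell (wordLength k n) A B C with hIn
  have hiff : ∀ x y z : Fin n, (In x + In (n + y)) % 2 ^ wordLength k n = In (2 * n + z) ↔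
      A x + B y = C z := by
    intro x y z
    rw [hsmall.sum_mod_eq_iff (by omega) (by omega) (by omega), inputInt_first, inputInt_second,
      inputInt_third]
  have hmain := fun ω : Fin T' → BitVec (wordLength k n) =>
    mainFrag_correct (P := P) hk' hk hdet hP A B C (tape ω) (Yes := ∃ i j l, A i + B j = C l)
    (Good := fun κ => ∃ x < n, ∃ y < n, ∃ z < n,
      (In x + In (n + y)) % 2 ^ wordLength k n = In (2 * n + z) ∧
      D.Clear In κ (tape ω (κ * (n + 2))).toNat (tape ω (κ * (n + 2) + 1)).toNat
        (fun j => (tape ω (κ * (n + 2) + 2 + j)).toNat) x y z)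
    (fun κ _ a₁ a₂ ρ M arr htab hacc => by
      obtain ⟨i, hi, hacc⟩ := hacc
      obtain ⟨x, hx, y, hy, z, hz, e⟩ := htab.sound hi hacc
      exact ⟨⟨x, hx⟩, ⟨y, hy⟩, ⟨z, hz⟩, (hiff ⟨x, hx⟩ ⟨y, hy⟩ ⟨z, hz⟩).1 e⟩)
    (fun κ _ hg M arr htab => by
      obtain ⟨x, hx, y, hy, z, hz, e, hcl⟩ := hg
      exact hcl.exists_acceptAt hx hy hz htab e) hT'
  refine ⟨fun ω => (hmain ω).1, ?_⟩
  rw [prob_eq_pr]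
  by_cases hyes : ∃ i j l, A i + B j = C l
  · obtain ⟨x₀, y₀, z, hxyz⟩ := hyes
    classical
    set I := (Finset.range n).filter fun i => ∃ j < n,
      (In i + In (n + j)) % 2 ^ wordLength k n = In (2 * n + z) with hIdef
    have hxI : (x₀ : ℕ) ∈ I := Finset.mem_filter.2 ⟨Finset.mem_range.2 x₀.isLt, y₀, y₀.isLt,
      (hiff x₀ y₀ z).2 hxyz⟩
    have hcard : I.card ≤ n := (Finset.card_filter_le _ _).trans (Finset.card_range n).le
    obtain ⟨κ, hκ, hq, hr⟩ := exists_sampling_rate (Finset.card_pos.2 ⟨_, hxI⟩)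
    have hκlam : κ < lamOf n := by
      have := Nat.log_mono_right (b := 2) hcard
      unfold lamOf
      omega
    have hκT : κ * (n + 2) + (n + 2) ≤ T' := by
      refine le_trans ?_ hdraw
      rw [← Nat.succ_mul]
      exact Nat.mul_le_mul_right _ hκlam
    have hge := hsmall.pr_clear_ge (T := T') (b := κ * (n + 2)) (κ := κ) (z := z) (K := 2 ^ 11)
      (H := 2 ^ (lamOf n - ellOf n)) (hκlam.le.trans D.lam_le) hκT z.isLt I
      (fun i => by rw [hIdef, Finset.mem_filter, Finset.mem_range, hn]) ⟨_, hxI⟩ (by positivity)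
    have hfail := failure_le (lam := lamOf n) (ell := ellOf n) (K := 2 ^ 11) (N := D.n) (S := D.S)
      (Q := D.Q) (H := (2 ^ (lamOf n - ellOf n) : ℕ)) (ellOf_le n)
      (by unfold ellOf; omega) (Nat.cast_nonneg _)
      (by exact_mod_cast (lt_two_pow_lamOf n).le) (by rw [D.hS]; push_cast; rfl)
      (by rw [D.hQ]; push_cast; rfl) (by push_cast; rfl) rfl hq hr
    refine (show (2 : ℝ) / 3 ≤ 1 - 1 / 3 by norm_num).trans ((sub_le_sub_left hfail 1).trans
      (hge.trans (pr_mono fun ω hω => ?_)))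
    obtain ⟨x, hx, y, hy, e, hcl⟩ := hω
    have := (hmain ω).2.2 ⟨κ, hκlam, x, hx, y, hy, z, z.isLt, e, hcl⟩
    rw [threeSum, if_pos ⟨x₀, y₀, z, hxyz⟩]
    exact this
  · have hall : ∀ ω, (final ω).reg 0 = BitVec.ofNat (wordLength k n) (threeSum A B C) := by
      intro ω
      rw [threeSum, if_neg hyes]
      rcases (hmain ω).2.1 with h0 | h0
      · exact h0
      · exact absurd h0.2 hyes
    rw [pr_eq_one hall]
    norm_num

/-! ### Convolution takes at least linear time -/

/-- Every step writes at most one cell. -/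
theorem exists_changed {w : ℕ} (P : Program) (ω : ℕ → BitVec w) (σ : Config w) (t : ℕ) :
    ∃ s : Finset (BitVec w), s.card ≤ t ∧ ∀ x ∉ s, (run P ω t σ).mem x = σ.mem x := by
  classical
  induction t with
  | zero => exact ⟨∅, le_rfl, fun _ _ => rfl⟩
  | succ t ih =>
    obtain ⟨s, hs, hmem⟩ := ih
    have hstep : ∀ τ : Config w, ∃ y, ∀ x ≠ y, (step P ω τ).mem x = τ.mem x := by
      intro τ
      unfold step
      split
      · rename_i I _
        cases I with
        | store r s => exact ⟨τ.reg r, fun x hx => Function.update_of_ne hx _ _⟩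
        | _ => exact ⟨0, fun _ _ => rfl⟩
      · exact ⟨0, fun _ _ => rfl⟩
    obtain ⟨y, hy⟩ := hstep (run P ω t σ)
    refine ⟨insert y s, (Finset.card_insert_le _ _).trans (by omega), fun x hx => ?_⟩
    rw [Finset.mem_insert, not_or] at hx
    rw [run_add, ← hmem x hx.2]
    exact hy x hx.1

/-- If all entries are 2, every output is 1, so each of the first n cells has to change. -/
theorem le_time_of_monoConvolution {k' n T : ℕ} (hk' : 4 ≤ k') (hn : 2 ≤ n) {P : Program}
    (hP : Solves P (wordLength k' n) n T) : n ≤ T := by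
  obtain ⟨s, hs, hmem⟩ := exists_changed P (fun _ => 0)
    (init (wordLength k' n) (fun _ : Fin n => 2) (fun _ => 2) fun _ => 2) T
  have hb : PolyBounded 1 (fun _ : Fin n => (2 : ℤ)) (fun _ => 2) fun _ => 2 := by
    intro i
    have : |(2 : ℤ)| ≤ (n : ℤ) ^ 1 := by rw [pow_one]; simpa using hn
    exact ⟨this, this, this⟩
  have hw : lamOf n + 3 ≤ wordLength k' n := by
    have h1 : 4 * lamOf n ≤ k' * lamOf n := Nat.mul_le_mul_right _ hk'
    have h2 : 1 ≤ lamOf n := by unfold lamOf; omega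
    change _ ≤ k' * lamOf n
    omega
  have hpw : 2 ^ (lamOf n + 3) ≤ 2 ^ wordLength k' n := Nat.pow_le_pow_right (by norm_num) hw
  rw [pow_add] at hpw
  have hlam := lt_two_pow_lamOf n
  have hin : ∀ i : Fin n, BitVec.ofNat (wordLength k' n) i ∈ s := by
    intro i
    by_contra hi
    have h1 := hmem _ hi
    rw [(hP _ _ _ hb).2 i] at h1
    have h2 : monoConvolution (fun _ : Fin n => (2 : ℤ)) (fun _ => 2) (fun _ => 2) i = 1 :=
      if_pos ⟨⟨0, by omega⟩, i, by simp, rfl, rfl⟩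
    have hi' := i.isLt
    rw [h2] at h1
    have h3 := inputInt_first (fun _ : Fin n => (2 : ℤ)) (fun _ => 2) (fun _ => 2) i
    have h4 := congrArg BitVec.toNat h1
    simp only [init, BitVec.toNat_ofNat] at h4
    rw [Nat.mod_eq_of_lt (show (i : ℕ) < 2 ^ wordLength k' n by omega)] at h4
    change _ = (BitVec.ofInt _ (inputInt _ _ _ (i : ℕ))).toNat at h4
    rw [h3, BitVec.toNat_ofInt, Nat.mod_eq_of_lt (by omega),
      Int.emod_eq_of_lt (by norm_num) (by exact_mod_cast (show 2 < 2 ^ wordLength k' n by omega))] at h4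
    exact absurd h4 (by decide)
  refine le_trans ?_ hs
  have := Finset.card_le_card_of_injOn (s := (Finset.univ : Finset (Fin n)))
    (fun i : Fin n => BitVec.ofNat (wordLength k' n) i) (fun i _ => hin i) ?_
  · simpa using this
  · intro i _ j _ hij
    have := congrArg BitVec.toNat hij
    have hi := i.isLt
    have hj := j.isLt
    simp only [BitVec.toNat_ofNat] at this
    rw [Nat.mod_eq_of_lt (by omega), Nat.mod_eq_of_lt (by omega)] at this
    exact Fin.ext this

/-! ### The running time of the reduction -/

/-- The running time of the reduction as a function of the length of the lists. -/
def reductionTime (k k' : ℕ) (hk' : 4 ≤ k') (hk : 45 * k' + 200 ≤ k) (P : Program) (T : ℕ → ℕ)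
    (n : ℕ) : ℕ :=
  mainTime (dim k k' n hk' hk) P (T (2 ^ muOf n)) + lamOf n * (n + 2)

/-- There are `lamOf n` levels with `muOf n` calls each, which gives the squared logarithm. Filling
the tables costs O(n·S), which is O(m). -/
theorem reductionTime_le {k k' : ℕ} (hk' : 4 ≤ k') (hk : 45 * k' + 200 ≤ k) (P : Program)
    (T : ℕ → ℕ) (n : ℕ) : reductionTime k k' hk' hk P T n ≤
      (20000 + 45 * P.regBound) * (lamOf n ^ 2 * (2 ^ muOf n + T (2 ^ muOf n))) := by
  have hnS : n * 2 ^ (ellOf n + 19) ≤ 2 ^ muOf n := by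
    refine (Nat.mul_le_mul_right _ (lt_two_pow_lamOf n).le).trans ?_
    rw [← pow_add]
    exact Nat.pow_le_pow_right (by norm_num) (by unfold muOf; omega)
  have hn : n ≤ 2 ^ muOf n := (lt_two_pow_lamOf n).le.trans
    (Nat.pow_le_pow_right (by norm_num) (by unfold muOf; omega))
  have hm : 1 ≤ 2 ^ muOf n := Nat.one_le_two_pow
  have hmu : muOf n ≤ 45 * lamOf n := by have := muOf_le n; omega
  have hlam : 1 ≤ lamOf n := by unfold lamOf; omega
  change n * 20 + lamOf n * ((n * (2 ^ (ellOf n + 19) * 1000 + 300) + muOf n *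
    (2 ^ muOf n * 130 + 2 * T (2 ^ muOf n) + P.regBound + 25) + 2 ^ muOf n * 105 + 50) + 5) + 200 +
    lamOf n * (n + 2) ≤ _
  generalize T (2 ^ muOf n) = t
  generalize 2 ^ muOf n = m at *
  generalize 2 ^ (ellOf n + 19) = S at *
  generalize P.regBound = R
  generalize muOf n = mu at *
  generalize lamOf n = l at *
  have h1 : mu * (m * 130 + 2 * t + R + 25) ≤ 45 * l * ((m + t) * (155 + R)) := by
    apply Nat.mul_le_mul hmu
    have : R * 1 ≤ R * m := Nat.mul_le_mul_left R hm
    have : (m + t) * (155 + R) = 155 * m + 155 * t + R * m + R * t := by ring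
    omega
  have h2 : n * (S * 1000 + 300) ≤ 1300 * m := by
    have : n * (S * 1000 + 300) = 1000 * (n * S) + 300 * n := by ring
    omega
  have h3 : n * (S * 1000 + 300) + mu * (m * 130 + 2 * t + R + 25) + m * 105 + 50 + 5 ≤
      l * ((m + t) * (8435 + 45 * R)) := by
    have h4 : 1 * (m * 1460) ≤ l * ((m + t) * 1460) :=
      Nat.mul_le_mul hlam (Nat.mul_le_mul_right _ (by omega))
    have h5 : l * ((m + t) * (8435 + 45 * R)) =
      45 * l * ((m + t) * (155 + R)) + l * ((m + t) * 1460) := by ring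
    linarith
  have h6 := Nat.mul_le_mul_left l h3
  have h7 : l * (n + 2) ≤ l * (3 * m) := Nat.mul_le_mul_left l (by omega)
  have h8 : l * (3 * m) ≤ l * l * (3 * (m + t)) := by
    rw [mul_assoc]
    refine Nat.mul_le_mul_left l ?_
    calc 3 * m = 1 * (3 * m) := (one_mul _).symm
      _ ≤ _ := Nat.mul_le_mul hlam (by omega)
  have h9 : 1 * 1 * (220 * m) ≤ l * l * (220 * (m + t)) :=
    Nat.mul_le_mul (Nat.mul_le_mul hlam hlam) (by omega)
  have h10 : (20000 + 45 * R) * (l ^ 2 * (m + t)) = l * (l * ((m + t) * (8435 + 45 * R))) +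
    l * l * (3 * (m + t)) + l * l * (220 * (m + t)) + 11342 * (l ^ 2 * (m + t)) := by ring
  omega

/-- Rounding costs a factor 2 for n and a factor 2 for its cube root, since 3·`ellOf n` is at most
`lamOf n + 2`; the offset contributes 2^42. -/
theorem two_pow_muOf_le {n : ℕ} (hn : 1 ≤ n) :
    (2 : ℝ) ^ muOf n ≤ 2 ^ 44 * (n : ℝ) ^ (4 / 3 : ℝ) := by
  have hn0 : (0 : ℝ) < n := by exact_mod_cast hn
  have h1 : (2 : ℝ) ^ lamOf n ≤ 2 * n := by
    have : 2 ^ Nat.log 2 n ≤ n := Nat.pow_log_le_self 2 (by omega)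
    have : 2 ^ lamOf n ≤ 2 * n := by unfold lamOf; rw [pow_succ]; omega
    exact_mod_cast this
  have h2 : (2 : ℝ) ^ ellOf n ≤ 2 * (n : ℝ) ^ (1 / 3 : ℝ) := by
    have h3 : ((2 : ℝ) ^ ellOf n) ^ 3 ≤ (2 * (n : ℝ) ^ (1 / 3 : ℝ)) ^ 3 := by
      rw [mul_pow, ← Real.rpow_natCast ((n : ℝ) ^ (1 / 3 : ℝ)) 3, ← Real.rpow_mul hn0.le, ← pow_mul]
      norm_num
      calc (2 : ℝ) ^ (ellOf n * 3) ≤ 2 ^ (lamOf n + 2) :=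
            pow_le_pow_right₀ (by norm_num) (by unfold ellOf; omega)
        _ ≤ 8 * n := by rw [pow_add]; linarith
    exact le_of_pow_le_pow_left₀ (by norm_num) (by positivity) h3
  rw [muOf, pow_add, pow_add]
  have h4 : (n : ℝ) ^ (4 / 3 : ℝ) = n * (n : ℝ) ^ (1 / 3 : ℝ) := by
    rw [show (4 / 3 : ℝ) = 1 + 1 / 3 by norm_num, Real.rpow_add hn0, Real.rpow_one]
  rw [h4]
  have h5 := mul_le_mul h1 h2 (by positivity) (by positivity)
  nlinarith

theorem tendsto_two_pow_muOf : Tendsto (fun n => 2 ^ muOf n) atTop atTop := by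
  refine tendsto_atTop_mono (fun n => ?_) tendsto_id
  exact (lt_two_pow_lamOf n).le.trans (Nat.pow_le_pow_right (by norm_num) (by unfold muOf; omega))

theorem lamOf_isBigO : (fun n => (lamOf n : ℝ)) =O[atTop] fun n : ℕ => Real.log n := by
  refine IsBigO.of_bound (1 / Real.log 2 + 1) ?_
  filter_upwards [eventually_ge_atTop 3] with n hn
  have hn0 : (0 : ℝ) < n := by positivity
  have hl2 : 0 < Real.log 2 := Real.log_pos (by norm_num)
  have h1 : (Nat.log 2 n : ℝ) * Real.log 2 ≤ Real.log n := by
    rw [← Real.log_pow]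
    apply Real.log_le_log (by positivity)
    exact_mod_cast Nat.pow_log_le_self 2 (show n ≠ 0 by omega)
  have h2 : 1 ≤ Real.log n := by
    rw [Real.le_log_iff_exp_le hn0]
    have : (3 : ℝ) ≤ n := by exact_mod_cast hn
    linarith [Real.exp_one_lt_d9]
  rw [Real.norm_of_nonneg (by positivity), Real.norm_of_nonneg (by linarith), lamOf]
  push_cast
  have h3 : (Nat.log 2 n : ℝ) ≤ 1 / Real.log 2 * Real.log n := by
    rw [one_div_mul_eq_div, le_div_iff₀ hl2]; exact h1
  linarith

/-- The condition e ≥ 1 lets m^e absorb the additive term m. -/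
theorem reductionTime_isBigO {k k' : ℕ} (hk' : 4 ≤ k') (hk : 45 * k' + 200 ≤ k) (P : Program)
    {T : ℕ → ℕ} {e : ℝ} (he : 1 ≤ e) (hT : (fun n => (T n : ℝ)) =O[atTop] fun n : ℕ => (n : ℝ) ^ e) :
    (fun n => (reductionTime k k' hk' hk P T n : ℝ)) =O[atTop]
      fun n : ℕ => (n : ℝ) ^ (4 / 3 * e) * Real.log n ^ 2 := by
  have hm : (fun n : ℕ => ((2 ^ muOf n : ℕ) : ℝ) ^ e) =O[atTop]
      fun n : ℕ => (n : ℝ) ^ (4 / 3 * e) := by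
    refine IsBigO.of_bound ((2 ^ 44 : ℝ) ^ e) ?_
    filter_upwards [eventually_ge_atTop 1] with n hn
    rw [Real.norm_of_nonneg (by positivity), Real.norm_of_nonneg (by positivity),
      Real.rpow_mul (by positivity), ← Real.mul_rpow (by positivity) (by positivity)]
    push_cast
    exact Real.rpow_le_rpow (by positivity) (two_pow_muOf_le hn) (by linarith)
  have hm1 : (fun n : ℕ => ((2 ^ muOf n : ℕ) : ℝ)) =O[atTop]
      fun n : ℕ => ((2 ^ muOf n : ℕ) : ℝ) ^ e := by
    refine IsBigO.of_bound 1 (Eventually.of_forall fun n => ?_)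
    have h1 : (1 : ℝ) ≤ ((2 ^ muOf n : ℕ) : ℝ) := by exact_mod_cast Nat.one_le_two_pow
    rw [Real.norm_of_nonneg (by positivity), Real.norm_of_nonneg (by positivity), one_mul]
    exact Real.self_le_rpow_of_one_le h1 he
  have hTm := (hT.comp_tendsto tendsto_two_pow_muOf).trans hm
  have hsum := (hm1.trans hm).add hTm
  have hprod := ((lamOf_isBigO.pow 2).mul hsum).const_mul_left ((20000 + 45 * P.regBound : ℕ) : ℝ)
  refine IsBigO.trans (IsBigO.of_bound 1 (Eventually.of_forall fun n => ?_))
    (hprod.congr_right fun n => mul_comm _ _)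
  rw [Real.norm_of_nonneg (by positivity), one_mul]
  refine le_trans ?_ (le_abs_self _)
  have := reductionTime_le hk' hk P T n
  simp only [Function.comp_apply]
  exact_mod_cast this

theorem rpow_isLittleO_natCast {a : ℝ} (ha : a < 1) :
    (fun n : ℕ => (n : ℝ) ^ a) =o[atTop] fun n : ℕ => (n : ℝ) := by
  refine isLittleO_of_tendsto' ?_ ?_
  · filter_upwards [eventually_ge_atTop 1] with n hn h0
    have : n = 0 := by exact_mod_cast h0
    omega
  · have h := (tendsto_rpow_neg_atTop (sub_pos.2 ha)).comp (tendsto_natCast_atTop_atTop (R := ℝ))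
    refine h.congr' ?_
    filter_upwards [eventually_ge_atTop 1] with n hn
    have hn0 : (0 : ℝ) < n := by exact_mod_cast hn
    rw [Function.comp_apply, neg_sub, Real.rpow_sub hn0, Real.rpow_one]

end WordRAM

/-! ### The reduction assembled. -/

theorem theorem7 (ε : ℝ)
    (h : MonoConvolutionInTime fun n => (n : ℝ) ^ (3 / 2 - ε)) :
    ThreeSumInRandomizedSoftTime fun n => (n : ℝ) ^ (2 - 4 / 3 * ε) := by
  intro u
  -- Exponent 1 suffices, as colours are at most m.
  obtain ⟨k', hk', P, T, hdet, hT, hP⟩ := h 1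
  have hk4 : 4 ≤ k' := by omega
  -- Otherwise the convolution would run in sublinear time, although it has to write n cells.
  have he : 1 ≤ 3 / 2 - ε := by
    by_contra hlt
    rw [not_le] at hlt
    have h1 : (fun n : ℕ => (n : ℝ)) =O[atTop] fun n => (T n : ℝ) := by
      refine IsBigO.of_bound 1 ?_
      filter_upwards [eventually_ge_atTop 2] with n hn
      rw [Real.norm_of_nonneg (by positivity), Real.norm_of_nonneg (by positivity), one_mul]
      exact_mod_cast WordRAM.le_time_of_monoConvolution hk4 hn (hP n)
    have h4 : (fun n : ℕ => (n : ℝ)) =o[atTop] fun n : ℕ => (n : ℝ) :=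
      (h1.trans hT).trans_isLittleO (WordRAM.rpow_isLittleO_natCast hlt)
    refine isLittleO_irrefl ?_ h4
    exact (eventually_ge_atTop 1).frequently.mono fun n hn => by
      have : n ≠ 0 := by omega
      exact_mod_cast this
  have hk : 45 * k' + 200 ≤ u + 45 * k' + 200 := by omega
  refine ⟨u + 45 * k' + 200, by omega, (WordRAM.mainFrag (u + 45 * k' + 200) k' P).code 0,
    WordRAM.reductionTime (u + 45 * k' + 200) k' hk4 hk P T, 2, ?_, ?_⟩
  · refine (WordRAM.reductionTime_isBigO hk4 hk P he hT).congr_right fun n => ?_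
    rw [show 4 / 3 * (3 / 2 - ε) = 2 - 4 / 3 * ε by ring]
  · intro n A B C hbd
    refine WordRAM.reduction_correct hk4 hk le_rfl hdet (T := T (2 ^ WordRAM.muOf n)) ?_ hbd
      (Nat.le_add_right _ _) (Nat.le_add_left _ _)
    -- The instance length is a power of two, so its logarithm is exact and the simulated word
    -- length is the one built into `dim`.
    have hw : WordRAM.wordLength k' (2 ^ WordRAM.muOf n) = k' * (WordRAM.muOf n + 1) := by
      rw [WordRAM.wordLength, Nat.log_pow (by norm_num)]
    change WordRAM.Solves P (k' * (WordRAM.muOf n + 1)) (2 ^ WordRAM.muOf n) (T (2 ^ WordRAM.muOf n))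
    rw [← hw]
    exact hP _
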